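/- Let $\alpha\in(0,1)$ and $r\ge 1$. There is a constant $C>0$, depending only on $\alpha$ and $r$, such that the following holds. Let $d\ge 1$, let $\Omega\subset\mathbb R^d$ be a bounded open set (for instance, a bounded Lipschitz domain with $d\in\{1,2,3\}$), $T>0$, and $$\mathcal L v=\sum_{k=1}^d\bigl\{-\partial_{x_k}(a_k\,\partial_{x_k}v)+b_k\,\partial_{x_k}v\bigr\}+c\,v ,$$ where $a_k,b_k\in C^1(\Omega)\cap C(\bar\Omega)$, $c\in C(\bar\Omega)$ and $a_k>0$ in $\bar\Omega$. Let $p\in\{2,\infty\}$ and suppose that $c-p^{-1}\sum_{k=1}^d\partial_{x_k}b_k\ge 0$ in $\Omega$ (with $p^{-1}=0$ for $p=\infty$). We say that $v$ solves $\mathcal Lv=F$ in $\Omega$, $v=0$ on $\partial\Omega$, where $F\in L_{1,\rm loc}(\Omega)$, if $v\in C(\bar\Omega)$ vanishes on $\partial\Omega$, has weak first derivatives in $L_{2,\rm loc}(\Omega)$, and $\int_\Omega\bigl(\sum_k\{a_k\,\partial_{x_k}v\,\partial_{x_k}\varphi+b_k\,\partial_{x_k}v\,\varphi\}+c\,v\,\varphi\bigr)=\int_\Omega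 F\varphi$ for all $\varphi\in C_c^\infty(\Omega)$. (This includes classical solutions in $C^2(\Omega)\cap C(\bar\Omega)$.) Let $u\in C(\bar\Omega\times[0,T])$ be a solution of $$D_t^\alpha u+\mathcal Lu=f\ \text{ in }\Omega\times(0,T],\qquad u=0\ \text{ on }\partial\Omega\times(0,T],\qquad u(\cdot,0)=u_0\ \text{ in }\Omega,$$ in the above sense for every $t\in(0,T]$, where $$D_t^\alpha u(\cdot,t)=\frac1{\Gamma(1-\alpha)}\int_0^t(t-s)^{-\alpha}\,\partial_su(\cdot,s)\,ds ,$$ such that $u(x,\cdot)$ is twice differentiable on $(0,T)$ for each $x\in\Omega$ and, for some constant $K$, $|\partial_t^lu(x,t)|\le K(1+t^{\alpha-l})$ for all $x\in\Omega$, $t\in(0,T)$ and $l=1,2$. Let $M\ge 1$ and $t_j=T(j/M)^r$ for $j=0,\dots,M$, $\tau_j=t_j-t_{j-1}$, and let $U^0,\dots,U^M$ be a solution, in the same sense, of the L1 semidiscretization in time $$\delta_t^\alpha U^j+\mathcal LU^j=f(\cdot,t_j)\ \text{ in }\Omega,\quad U^j=0\ \text{ on }\partial\Omega\quad (j=1,\dots,M),\qquad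 U^0=u_0\ \text{ in }\Omega,$$ where $$\delta_t^\alpha U^m=\frac1{\Gamma(1-\alpha)}\sum_{j=1}^m\delta_tU^j\int_{t_{j-1}}^{t_j}(t_m-s)^{-\alpha}\,ds,\qquad \delta_tU^j=\frac{U^j-U^{j-1}}{\tau_j}.$$ For $x\in\Omega$ define, with values in $[0,\infty]$, $$\psi^1(x)=\tau_1^\alpha\sup_{s\in(0,t_1)}s^{1-\alpha}\Bigl|\frac{u(x,t_1)-u(x,0)}{\tau_1}-\partial_su(x,s)\Bigr|,\qquad \psi^j(x)=\tau_j^{2-\alpha}\,t_j^\alpha\sup_{s\in(t_{j-1},t_j)}|\partial_s^2u(x,s)|\quad(j\ge2).$$ (i) For $m=1,\dots,M$, $$\|u(\cdot,t_m)-U^m\|_{L_p(\Omega)}\le C\max_{j=1,\dots,m}\|\psi^j\|_{L_p(\Omega)} .$$ (ii) If $r=1$, then, with $\tau=T/M$ and $\gamma=\min\{\alpha,1-\alpha\}$, for $m=1,\dots,M$ also $$\|u(\cdot,t_m)-U^m\|_{L_p(\Omega)}\le C\,t_m^{\alpha-1}\max_{j=1,\dots,m}\bigl\{\tau^{-\gamma}\,t_j^{1-\alpha+\gamma}\,\|\psi^j\|_{L_p(\Omega)}\bigr\}.$$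 -/

import Mathlib

open scoped ENNReal ContDiff
open MeasureTheory

noncomputable section

namespace L1Method

/-- The graded temporal mesh `t_j = T (j / M) ^ r`. -/
def mesh (T r : ℝ) (M j : ℕ) : ℝ := T * ((j : ℝ) / (M : ℝ)) ^ r

/-- The backward difference quotient `δ_t V^j = (V^j - V^{j-1}) / (t_j - t_{j-1})`, for `j ≥ 1`. -/
def deltaT (t V : ℕ → ℝ) (j : ℕ) : ℝ := (V j - V (j - 1)) / (t j - t (j - 1))

/-- The L1 discretization of the Caputo derivative,
`δ_t^α V^m = Γ(1-α)⁻¹ ∑_{j=1}^m δ_t V^j ∫_{t_{j-1}}^{t_j} (t_m - s)^{-α} ds`. -/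
def deltaAlpha (α : ℝ) (t V : ℕ → ℝ) (m : ℕ) : ℝ :=
  1 / Real.Gamma (1 - α) *
    ∑ j ∈ Finset.Icc 1 m, deltaT t V j * ∫ s in (t (j - 1))..(t j), (t m - s) ^ (-α)

/-- The Caputo derivative `D_t^α v(t) = Γ(1-α)⁻¹ ∫_0^t (t - s)^{-α} v'(s) ds`. -/
def caputo (α : ℝ) (v : ℝ → ℝ) (t : ℝ) : ℝ :=
  1 / Real.Gamma (1 - α) * ∫ s in (0 : ℝ)..t, (t - s) ^ (-α) * deriv v s

/-- The quantities `ψ^j`, `j ≥ 1`, of a function `v` of time, with values in `[0, ∞]`: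
`ψ^1 = τ_1^α sup_{s ∈ (0, t_1)} s^{1-α} |δ_t v(t_1) - v'(s)|` and
`ψ^j = τ_j^{2-α} t_j^α sup_{s ∈ (t_{j-1}, t_j)} |v''(s)|` for `j ≥ 2`, where
`τ_j = t_j - t_{j-1}`. -/
def psi (α : ℝ) (t : ℕ → ℝ) (v : ℝ → ℝ) (j : ℕ) : ℝ≥0∞ :=
  if j = 1 then
    ENNReal.ofReal ((t 1 - t 0) ^ α) *
      ⨆ s ∈ Set.Ioo 0 (t 1),
        ENNReal.ofReal (s ^ (1 - α) * |deltaT t (fun i => v (t i)) 1 - deriv v s|)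
  else
    ENNReal.ofReal ((t j - t (j - 1)) ^ (2 - α) * t j ^ α) *
      ⨆ s ∈ Set.Ioo (t (j - 1)) (t j), ENNReal.ofReal |deriv (deriv v) s|

variable {d : ℕ}

/-- The classical partial derivative `∂_{x_k} φ (x)`. -/
def partialD (k : Fin d) (φ : EuclideanSpace ℝ (Fin d) → ℝ) (x : EuclideanSpace ℝ (Fin d)) : ℝ :=
  fderiv ℝ φ x (EuclideanSpace.single k 1)

/-- Test functions on `Ω`: the class `C_c^∞(Ω)`. -/
def IsTest (Ω : Set (EuclideanSpace ℝ (Fin d))) (φ : EuclideanSpace ℝ (Fin d) → ℝ) : Prop :=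
  ContDiff ℝ ∞ φ ∧ HasCompactSupport φ ∧ tsupport φ ⊆ Ω

/-- `g` is the weak partial derivative `∂_{x_k} v` in `Ω`, and it lies in `L_{2,loc}(Ω)`. -/
def IsWeakPartialL2Loc (Ω : Set (EuclideanSpace ℝ (Fin d))) (k : Fin d)
    (v g : EuclideanSpace ℝ (Fin d) → ℝ) : Prop :=
  (∀ K : Set (EuclideanSpace ℝ (Fin d)), IsCompact K → K ⊆ Ω → MemLp g 2 (volume.restrict K)) ∧
  ∀ φ, IsTest Ω φ → ∫ x in Ω, v x * partialD k φ x = -∫ x in Ω, g x * φ x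

/-- The coefficients of `L v = ∑_k { -∂_k (a_k ∂_k v) + b_k ∂_k v } + c v`. -/
structure Coeffs (d : ℕ) where
  a : Fin d → EuclideanSpace ℝ (Fin d) → ℝ
  b : Fin d → EuclideanSpace ℝ (Fin d) → ℝ
  c : EuclideanSpace ℝ (Fin d) → ℝ

/-- Smoothness of the coefficients, and ellipticity: `a_k > 0` in the closure of `Ω`. -/
structure Coeffs.Admissible (L : Coeffs d) (Ω : Set (EuclideanSpace ℝ (Fin d))) : Prop where
  a_cont : ∀ k, ContinuousOn (L.a k) (closure Ω)
  a_smooth : ∀ k, ContDiffOn ℝ 1 (L.a k) Ω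
  a_pos : ∀ k, ∀ x ∈ closure Ω, 0 < L.a k x
  b_cont : ∀ k, ContinuousOn (L.b k) (closure Ω)
  b_smooth : ∀ k, ContDiffOn ℝ 1 (L.b k) Ω
  c_cont : ContinuousOn L.c (closure Ω)

/-- `L v = F` in `Ω`, `v = 0` on `∂Ω`, for `v ∈ C(closure Ω) ∩ H^1_loc(Ω)`: the boundary
condition is attained pointwise, and the equation is understood in the weak sense. -/
def Coeffs.Solves (L : Coeffs d) (Ω : Set (EuclideanSpace ℝ (Fin d)))
    (v F : EuclideanSpace ℝ (Fin d) → ℝ) : Prop :=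
  ContinuousOn v (closure Ω) ∧ (∀ x ∈ frontier Ω, v x = 0) ∧ LocallyIntegrableOn F Ω ∧
  ∃ g : Fin d → EuclideanSpace ℝ (Fin d) → ℝ, (∀ k, IsWeakPartialL2Loc Ω k v (g k)) ∧
    ∀ φ, IsTest Ω φ →
      ∫ x in Ω, ((∑ k, (L.a k x * g k x * partialD k φ x + L.b k x * g k x * φ x))
        + L.c x * v x * φ x) = ∫ x in Ω, F x * φ x

/-- `u` solves `D_t^α u + L u = f` in `Ω × (0, T]`, `u = 0` on `∂Ω × (0, T]`, `u(·, 0) = u₀` in `Ω`;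
it lies in `C(closure Ω × [0, T])`, is twice differentiable in `t ∈ (0, T)`, and satisfies
`|∂_t^l u| ≤ K (1 + t^{α-l})` for `l = 1, 2` (for `l = 0` this follows from continuity when `Ω` is
bounded). -/
structure IsSolution (α T : ℝ) (Ω : Set (EuclideanSpace ℝ (Fin d))) (L : Coeffs d)
    (f : EuclideanSpace ℝ (Fin d) → ℝ → ℝ) (u₀ : EuclideanSpace ℝ (Fin d) → ℝ)
    (u : EuclideanSpace ℝ (Fin d) → ℝ → ℝ) : Prop where
  cont : ContinuousOn (Function.uncurry u) (closure Ω ×ˢ Set.Icc 0 T)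
  diff_one : ∀ x ∈ Ω, DifferentiableOn ℝ (u x) (Set.Ioo 0 T)
  diff_two : ∀ x ∈ Ω, DifferentiableOn ℝ (deriv (u x)) (Set.Ioo 0 T)
  bound : ∃ K : ℝ, ∀ x ∈ Ω, ∀ t ∈ Set.Ioo 0 T,
    |deriv (u x) t| ≤ K * (1 + t ^ (α - 1)) ∧ |deriv (deriv (u x)) t| ≤ K * (1 + t ^ (α - 2))
  equation : ∀ t ∈ Set.Ioc 0 T, L.Solves Ω (fun x => u x t) (fun x => f x t - caputo α (u x) t)
  initial : ∀ x ∈ Ω, u x 0 = u₀ x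

/-- The sequence `U^0, …, U^M` solves the L1 semidiscretization in time on the mesh `t`:
`δ_t^α U^j + L U^j = f(·, t_j)` in `Ω`, `U^j = 0` on `∂Ω` for `j = 1, …, M`, and `U^0 = u₀`. -/
structure IsSemidiscrete (α : ℝ) (t : ℕ → ℝ) (M : ℕ) (Ω : Set (EuclideanSpace ℝ (Fin d)))
    (L : Coeffs d) (f : EuclideanSpace ℝ (Fin d) → ℝ → ℝ) (u₀ : EuclideanSpace ℝ (Fin d) → ℝ)
    (U : ℕ → EuclideanSpace ℝ (Fin d) → ℝ) : Prop where
  equation : ∀ j ∈ Finset.Icc 1 M,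
    L.Solves Ω (U j) (fun x => f x (t j) - deltaAlpha α t (fun i => U i x) j)
  initial : ∀ x ∈ Ω, U 0 x = u₀ x

end L1Method

end

/-!
The error `e^m = u(t_m) - U^m` vanishes for `m = 0`, and subtracting the two problems gives
`δ_t^α e^m + L e^m = r^m` with the truncation error `r^m = δ_t^α u(t_m) - D_t^α u(t_m)`. Summation
by parts writes `δ_t^α e^m` as `d_{m,m} e^m - ∑_{1 ≤ j < m} (d_{m,j+1} - d_{m,j}) e^j`, where
`d_{m,j}` (`l1Weight`) is the average of the increasing function `(t_m - s)^{-α} / Γ(1-α)` over the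
`j`-th mesh interval, hence positive and increasing in `j`. Thus `e^m` solves an elliptic problem
`L v + κ v = G` with `κ = d_{m,m}`, and everything rests on three facts.

*Stability* (`L1Method.stability`): `κ ‖v‖_p ≤ ‖G‖_p` for `p = 2` and `p = ∞`. Solutions are only
continuous up to the boundary and locally in `H¹`, so the test functions are `H(v)` with `H` smooth
and zero near zero; they have compact support in `Ω`, and mollification makes them admissible
(`integral_test`). For `p = 2`, `H` tends to the identity, and the convection term is integrated by
parts (`integral_convection`). For `p = ∞`, `H(s) = exp(-1/(s-l))` for `s > l`, with a level `l`
just below the maximum of `v`: then `H = (s-l)² H'`, so that the diffusion term absorbs the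
convection term up to a small multiple of `H`, which forces `κ max v ≤ ‖G‖_∞`.

*Truncation error* (`L1Method.ofReal_abs_truncPiece_le`): pointwise in space, the contribution of
the `j`-th interval to `r^m` is at most a weight (`truncWeight`) times `ψ^j`. For `j < m` one
integrates by parts against the interpolation error, which vanishes at the mesh points; for `j = m`
one integrates the kernel. Consequently the norms `E^m = ‖e^m‖_p` satisfy a scalar L1 inequality
(`L1Method.error_recursion_real`).

*Scalar inequality.* On the graded mesh the truncation weights sum up to a multiple of `t_m^{-α}`
(`sum_truncWeight_le`), and `d_{m,1} ≥ t_m^{-α} / Γ(1-α)`, so that a constant is a barrier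
(`le_of_l1_weights`); this is (i). On a uniform mesh the weights are a multiple of the convolution
kernel `a_k = (k+1)^{1-α} - k^{1-α}`, which is positive, decreasing and log-convex. By Kaluza's
theorem (`kaluza_nonpos`) the resolvent kernel `P` with `∑_{j ≤ n} P_{n-j} a_j = 1` is decreasing,
hence `P_n ≤ 1 / ∑_{j ≤ n} a_j = (n+1)^{α-1}` (`le_sum_div_of_volterra`). The truncation error
decays like `j^{-1-γ}`, which is summable, and its convolution with `P` decays like `m^{α-1}`
(`exists_le_of_uniform`); this is (ii).
-/

/-! ### Discrete convolution kernels -/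

/-- Kaluza's theorem: the reciprocal `∑ D_n z^n` of the generating function of a positive
log-convex sequence `a` with `a_0 = 1` has nonpositive coefficients beyond the first one. -/
theorem kaluza_nonpos {a D : ℕ → ℝ} (ha0 : a 0 = 1) (hpos : ∀ n, 0 < a n)
    (hlc : ∀ n, a (n + 1) ^ 2 ≤ a n * a (n + 2)) (hD0 : D 0 = 1)
    (hD : ∀ n, ∑ k ∈ Finset.range (n + 2), D k * a (n + 1 - k) = 0) (n : ℕ) : D (n + 1) ≤ 0 := by
  have hmono : Monotone fun n => a (n + 1) / a n := by
    refine monotone_nat_of_le_succ fun n => ?_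
    rw [div_le_div_iff₀ (hpos _) (hpos _)]
    nlinarith [hlc n]
  induction n using Nat.strong_induction_on with
  | _ n ih =>
    have h1 := hD n
    rw [Finset.sum_range_succ, Nat.sub_self, ha0, mul_one] at h1
    rcases n with _ | n
    · simp [hD0] at h1
      linarith [hpos 1]
    · -- subtract a multiple of the preceding relation to cancel the contribution of `D 0`
      have h2 := hD n
      set q := a (n + 2) / a (n + 1) with hq
      have h3 : D (n + 2) = ∑ k ∈ Finset.range (n + 2),
          D k * (q * a (n + 1 - k) - a (n + 2 - k)) := by
        have : ∑ k ∈ Finset.range (n + 2), D k * (q * a (n + 1 - k) - a (n + 2 - k)) =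
            q * ∑ k ∈ Finset.range (n + 2), D k * a (n + 1 - k)
              - ∑ k ∈ Finset.range (n + 2), D k * a (n + 2 - k) := by
          rw [Finset.mul_sum, ← Finset.sum_sub_distrib]
          exact Finset.sum_congr rfl fun k _ => by ring
        rw [this, h2]
        linarith
      rw [h3]
      refine Finset.sum_nonpos fun k hk => ?_
      have hk' : k < n + 2 := Finset.mem_range.1 hk
      rcases k with _ | k
      · have : a (n + 1) ≠ 0 := (hpos _).ne'
        simp [hq, this]
      · refine mul_nonpos_of_nonpos_of_nonneg (ih k (by omega)) ?_
        have h4 : a (n - k + 1) / a (n - k) ≤ q := hmono (show n - k ≤ n + 1 by omega)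
        rw [div_le_iff₀ (hpos _)] at h4
        have e1 : n + 1 - (k + 1) = n - k := by omega
        have e2 : n + 2 - (k + 1) = n - k + 1 := by omega
        rw [e1, e2]
        linarith

open PowerSeries in
/-- A discrete Volterra inequality with a positive, nonincreasing, log-convex kernel is resolved
with the reciprocals of the partial sums of the kernel: the resolvent kernel `P`, defined by
`∑_{j ≤ n} P_{n-j} a_j = 1`, is nonincreasing by Kaluza's theorem, so that
`P_n ∑_{j ≤ n} a_j ≤ 1`. -/
theorem le_sum_div_of_volterra {a : ℕ → ℝ} (ha0 : a 0 = 1) (hpos : ∀ n, 0 < a n)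
    (hanti : Antitone a) (hlc : ∀ n, a (n + 1) ^ 2 ≤ a n * a (n + 2)) {E F : ℕ → ℝ} {N : ℕ}
    (hF : ∀ n, 0 ≤ F n)
    (hE : ∀ n, 1 ≤ n → n ≤ N →
      E n ≤ ∑ j ∈ Finset.Ico 1 n, (a (n - j - 1) - a (n - j)) * E j + F n)
    {n : ℕ} (hnN : n ≤ N) (hn : 1 ≤ n) :
    E n ≤ ∑ j ∈ Finset.Icc 1 n, F j / ∑ k ∈ Finset.range (n - j + 1), a k := by
  set A : ℝ⟦X⟧ := PowerSeries.mk a with hA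
  have hA0 : constantCoeff A ≠ 0 := by
    rw [← coeff_zero_eq_constantCoeff_apply, hA, coeff_mk, ha0]; exact one_ne_zero
  set D : ℕ → ℝ := fun n => coeff n A⁻¹ with hDdef
  set P : ℝ⟦X⟧ := PowerSeries.mk 1 * A⁻¹ with hP
  have hD0 : D 0 = 1 := by
    simp [hA, ha0, hDdef]
  have hD : ∀ n, ∑ k ∈ Finset.range (n + 2), D k * a (n + 1 - k) = 0 := by
    intro n
    have : coeff (n + 1) (A⁻¹ * A) = 0 := by
      rw [PowerSeries.inv_mul_cancel _ hA0, coeff_one]; simp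
    rw [coeff_mul, Finset.Nat.sum_antidiagonal_eq_sum_range_succ_mk] at this
    simpa [hA, hDdef] using this
  have hDneg := kaluza_nonpos ha0 hpos hlc hD0 hD
  have hPc : ∀ n, coeff n P = ∑ k ∈ Finset.range (n + 1), D k := by
    intro n
    rw [hP, mul_comm, coeff_mul, Finset.Nat.sum_antidiagonal_eq_sum_range_succ_mk]
    simp [hDdef]
  have hPanti : Antitone fun n => coeff n P := by
    refine antitone_nat_of_succ_le fun n => ?_
    rw [hPc, hPc, Finset.sum_range_succ _ (n + 1)]
    linarith [hDneg n]
  have hone : PowerSeries.mk 1 * (1 - X : ℝ⟦X⟧) = 1 := mk_one_mul_one_sub_eq_one ℝ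
  have hPA : P * A = PowerSeries.mk 1 := by
    rw [hP, mul_assoc, PowerSeries.inv_mul_cancel _ hA0, mul_one]
  set Q : ℝ⟦X⟧ := (1 - X) * A with hQ
  have hPQ : P * Q = 1 := by
    rw [hQ, mul_left_comm, hPA, mul_comm, hone]
  have hQ0 : coeff 0 Q = 1 := by
    simp [hQ, hA, coeff_mul, ha0]
  have hQs : ∀ k, coeff (k + 1) Q = a (k + 1) - a k := by
    intro k
    rw [hQ, sub_mul, one_mul, map_sub, coeff_succ_X_mul, hA, coeff_mk, coeff_mk]
  have hPnn : ∀ n, 0 ≤ coeff n P := by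
    intro n
    induction n using Nat.strong_induction_on with
    | _ n ih =>
      rcases n with _ | n
      · simp [hPc, hD0]
      · have : coeff (n + 1) (P * Q) = 0 := by rw [hPQ, coeff_one]; simp
        rw [coeff_mul, Finset.Nat.sum_antidiagonal_eq_sum_range_succ_mk,
          Finset.sum_range_succ, Nat.sub_self, hQ0, mul_one] at this
        have h2 : ∑ k ∈ Finset.range (n + 1), coeff k P * coeff (n + 1 - k) Q ≤ 0 := by
          refine Finset.sum_nonpos fun k hk => ?_
          have hk' := Finset.mem_range.1 hk
          refine mul_nonpos_of_nonneg_of_nonpos (ih k hk') ?_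
          rw [show n + 1 - k = (n - k) + 1 by omega, hQs]
          linarith [hanti (Nat.le_succ (n - k))]
        linarith
  have hPle : ∀ n, coeff n P ≤ 1 / ∑ k ∈ Finset.range (n + 1), a k := by
    intro n
    have hs : 0 < ∑ k ∈ Finset.range (n + 1), a k :=
      Finset.sum_pos (fun k _ => hpos k) ⟨0, by simp⟩
    rw [le_div_iff₀ hs, Finset.mul_sum]
    have : coeff n (A * P) = 1 := by rw [mul_comm, hPA]; simp
    rw [coeff_mul, Finset.Nat.sum_antidiagonal_eq_sum_range_succ_mk] at this
    rw [← this]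
    refine Finset.sum_le_sum fun k _ => ?_
    rw [hA, coeff_mk, mul_comm]
    exact mul_le_mul_of_nonneg_left (hPanti (Nat.sub_le n k)) (hpos k).le
  -- the sequence `E`, with its value at `0` replaced by `0`, is the convolution of `P` and `G`
  set E' : ℝ⟦X⟧ := PowerSeries.mk fun n => if n = 0 then 0 else E n with hE'
  set G : ℝ⟦X⟧ := Q * E' with hG
  have hGle : ∀ m, 1 ≤ m → m ≤ N → coeff m G ≤ F m := by
    intro m hm hmN
    have h1 := hE m hm hmN
    rw [hG, mul_comm, coeff_mul, Finset.Nat.sum_antidiagonal_eq_sum_range_succ_mk,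
      Finset.sum_range_succ, Nat.sub_self, hQ0, mul_one, Finset.range_eq_Ico,
      Finset.sum_eq_sum_Ico_succ_bot (by omega)]
    have h2 : ∑ k ∈ Finset.Ico (0 + 1) m, coeff k E' * coeff (m - k) Q =
        -∑ j ∈ Finset.Ico 1 m, (a (m - j - 1) - a (m - j)) * E j := by
      rw [zero_add, ← Finset.sum_neg_distrib]
      refine Finset.sum_congr rfl fun j hj => ?_
      have hj' := Finset.mem_Ico.1 hj
      have e : m - j = (m - j - 1) + 1 := by omega
      rw [e, hQs, hE', coeff_mk, if_neg (by omega), ← e]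
      ring
    rw [h2, hE', coeff_mk, coeff_mk, if_pos rfl, if_neg (by omega)]
    linarith
  have hG0 : coeff 0 G = 0 := by
    rw [hG, coeff_mul]; simp [hE']
  have hEn : E n = coeff n (G * P) := by
    rw [hG, mul_comm, ← mul_assoc, hPQ, one_mul, hE', coeff_mk, if_neg (by omega)]
  rw [hEn, coeff_mul, Finset.Nat.sum_antidiagonal_eq_sum_range_succ_mk, Finset.range_eq_Ico,
    Finset.sum_eq_sum_Ico_succ_bot (by omega), hG0, zero_mul, zero_add, zero_add,
    show Finset.Ico 1 (n + 1) = Finset.Icc 1 n from by ext; simp]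
  refine Finset.sum_le_sum fun j hj => ?_
  have hj' := Finset.mem_Icc.1 hj
  calc coeff j G * coeff (n - j) P ≤ F j * coeff (n - j) P :=
        mul_le_mul_of_nonneg_right (hGle j hj'.1 (by omega)) (hPnn _)
    _ ≤ F j * (1 / ∑ k ∈ Finset.range (n - j + 1), a k) :=
        mul_le_mul_of_nonneg_left (hPle _) (hF j)
    _ = _ := by ring

/-- The discrete maximum principle for weights nondecreasing in their second argument: the
constant sequence `B` is a barrier. -/
theorem le_of_l1_weights {w : ℕ → ℕ → ℝ} {E R : ℕ → ℝ} {B : ℝ} {N : ℕ}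
    (hpos : ∀ m, 1 ≤ m → m ≤ N → 0 < w m m)
    (hmono : ∀ m, m ≤ N → ∀ j ∈ Finset.Ico 1 m, w m j ≤ w m (j + 1))
    (hE : ∀ m, 1 ≤ m → m ≤ N →
      w m m * E m ≤ ∑ j ∈ Finset.Ico 1 m, (w m (j + 1) - w m j) * E j + R m)
    (hR : ∀ m, 1 ≤ m → m ≤ N → R m ≤ B * w m 1) {m : ℕ} (hm : 1 ≤ m) (hmN : m ≤ N) :
    E m ≤ B := by
  induction m using Nat.strong_induction_on with
  | _ m ih =>
    have h1 : ∑ j ∈ Finset.Ico 1 m, (w m (j + 1) - w m j) * E j ≤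
        ∑ j ∈ Finset.Ico 1 m, (w m (j + 1) - w m j) * B := by
      refine Finset.sum_le_sum fun j hj => ?_
      have hj' := Finset.mem_Ico.1 hj
      exact mul_le_mul_of_nonneg_left (ih j hj'.2 hj'.1 (by omega))
        (sub_nonneg.2 (hmono m hmN j hj))
    rw [← Finset.sum_mul, Finset.sum_Ico_sub _ hm] at h1
    have h2 := hE m hm hmN
    have h3 := hR m hm hmN
    refine le_of_mul_le_mul_left ?_ (hpos m hm hmN)
    linarith

/-! ### Power inequalities and sums over the mesh -/

/-- A mean value bound for `x ↦ x ^ (-α)`. -/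
theorem rpow_neg_sub_rpow_neg_le {α x y : ℝ} (hα : 0 ≤ α) (hx : 0 < x) (hxy : x ≤ y) :
    x ^ (-α) - y ^ (-α) ≤ α * x ^ (-α - 1) * (y - x) := by
  have hy : 0 < y := hx.trans_le hxy
  have h1 : 1 - α * ((y - x) / x) ≤ (y / x) ^ (-α) := by
    rw [Real.rpow_def_of_pos (div_pos hy hx)]
    have h2 := Real.add_one_le_exp (Real.log (y / x) * -α)
    have h3 := Real.log_le_sub_one_of_pos (div_pos hy hx)
    have h4 : (y - x) / x = y / x - 1 := by field_simp
    rw [h4]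
    nlinarith
  have h5 : y ^ (-α) = x ^ (-α) * (y / x) ^ (-α) := by
    rw [← Real.mul_rpow hx.le (div_pos hy hx).le, mul_div_cancel₀ _ hx.ne']
  have h6 : x ^ (-α - 1) = x ^ (-α) / x := by rw [Real.rpow_sub_one hx.ne']
  rw [h5, h6]
  have h7 : 0 < x ^ (-α) := Real.rpow_pos_of_pos hx _
  have h8 := mul_le_mul_of_nonneg_left h1 h7.le
  have h9 : α * (x ^ (-α) / x) * (y - x) = x ^ (-α) * (α * ((y - x) / x)) := by ring
  rw [h9]
  linarith

theorem sum_rpow_sub_one_le {α : ℝ} (hα0 : 0 < α) (hα1 : α < 1) (m : ℕ) :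
    ∑ k ∈ Finset.range m, ((k : ℝ) + 1) ^ (α - 1) ≤ (m : ℝ) ^ α / α := by
  induction m with
  | zero => simp [Real.zero_rpow hα0.ne']
  | succ m ih =>
    rw [Finset.sum_range_succ]
    have hm : (0 : ℝ) < (m : ℝ) + 1 := by positivity
    have h1 : (1 + -(1 / ((m : ℝ) + 1))) ^ α ≤ 1 + α * -(1 / ((m : ℝ) + 1)) := by
      refine rpow_one_add_le_one_add_mul_self ?_ hα0.le hα1.le
      rw [neg_le_neg_iff, div_le_one hm]
      linarith [(Nat.cast_nonneg m : (0 : ℝ) ≤ m)]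
    have h2 : (m : ℝ) ^ α = ((m : ℝ) + 1) ^ α * (1 + -(1 / ((m : ℝ) + 1))) ^ α := by
      have : (1 + -(1 / ((m : ℝ) + 1))) = m / ((m : ℝ) + 1) := by field_simp; ring
      rw [this, ← Real.mul_rpow hm.le (by positivity), mul_div_cancel₀ _ hm.ne']
    have h3 : ((m : ℝ) + 1) ^ (α - 1) = ((m : ℝ) + 1) ^ α / ((m : ℝ) + 1) := by
      rw [Real.rpow_sub_one hm.ne']
    have h4 : 0 < ((m : ℝ) + 1) ^ α := Real.rpow_pos_of_pos hm _
    push_cast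
    have h5 := mul_le_mul_of_nonneg_left h1 h4.le
    rw [← h2] at h5
    rw [h3]
    rw [le_div_iff₀ hα0] at ih ⊢
    have h6 : ((m : ℝ) + 1) ^ α * (1 + α * -(1 / ((m : ℝ) + 1))) =
      ((m : ℝ) + 1) ^ α - ((m : ℝ) + 1) ^ α / ((m : ℝ) + 1) * α := by ring
    rw [h6] at h5
    linarith

/-- The L1 kernel on a uniform mesh, up to a constant factor. -/
noncomputable def l1Kernel (α : ℝ) (k : ℕ) : ℝ := ((k : ℝ) + 1) ^ (1 - α) - (k : ℝ) ^ (1 - α)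

theorem l1Kernel_eq_integral {α : ℝ} (hα1 : α < 1) (k : ℕ) :
    l1Kernel α k = (1 - α) * ∫ s in (0 : ℝ)..1, ((k : ℝ) + s) ^ (-α) := by
  rw [intervalIntegral.integral_comp_add_left (fun s => s ^ (-α)) (k : ℝ),
    integral_rpow (Or.inl (by linarith)), add_zero, neg_add_eq_sub, l1Kernel,
    mul_div_cancel₀ _ (by linarith)]

theorem intervalIntegrable_add_rpow_neg {α : ℝ} (hα1 : α < 1) (k : ℝ) :
    IntervalIntegrable (fun s => (k + s) ^ (-α)) volume 0 1 := by
  have := (intervalIntegral.intervalIntegrable_rpow' (a := k) (b := k + 1)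
    (show (-1 : ℝ) < -α by linarith)).comp_add_left k
  simpa using this

theorem l1Kernel_zero {α : ℝ} (hα1 : α < 1) : l1Kernel α 0 = 1 := by
  simp [l1Kernel, Real.zero_rpow (show (1 : ℝ) - α ≠ 0 by linarith)]

theorem l1Kernel_pos {α : ℝ} (hα1 : α < 1) (k : ℕ) : 0 < l1Kernel α k :=
  sub_pos.2 (Real.rpow_lt_rpow (Nat.cast_nonneg k) (by linarith) (by linarith))

theorem l1Kernel_antitone {α : ℝ} (hα0 : 0 < α) (hα1 : α < 1) : Antitone (l1Kernel α) := by
  refine antitone_nat_of_succ_le fun k => ?_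
  rw [l1Kernel_eq_integral hα1, l1Kernel_eq_integral hα1]
  refine mul_le_mul_of_nonneg_left ?_ (by linarith)
  refine intervalIntegral.integral_mono_on_of_le_Ioo zero_le_one
    (intervalIntegrable_add_rpow_neg hα1 _) (intervalIntegrable_add_rpow_neg hα1 _) fun s hs => ?_
  have hk : (0 : ℝ) ≤ k := Nat.cast_nonneg k
  push_cast
  exact Real.rpow_le_rpow_of_nonpos (by linarith [hs.1]) (by linarith) (by linarith)

/-- Log-convexity of the kernel, inherited from that of `s ↦ s ^ (-α)`. -/
theorem l1Kernel_sq_le {α : ℝ} (hα0 : 0 < α) (hα1 : α < 1) (k : ℕ) :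
    l1Kernel α (k + 1) ^ 2 ≤ l1Kernel α k * l1Kernel α (k + 2) := by
  have h0 := l1Kernel_pos hα1 k
  have h1 := l1Kernel_pos hα1 (k + 1)
  set q := l1Kernel α (k + 1) / l1Kernel α k with hq
  have hqpos : 0 < q := div_pos h1 h0
  have key : 2 * l1Kernel α (k + 1) ≤ q * l1Kernel α k + q⁻¹ * l1Kernel α (k + 2) := by
    rw [l1Kernel_eq_integral hα1 k, l1Kernel_eq_integral hα1 (k + 1),
      l1Kernel_eq_integral hα1 (k + 2)]
    have : (2 : ℝ) * ∫ s in (0 : ℝ)..1, (((k + 1 : ℕ) : ℝ) + s) ^ (-α) ≤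
        q * (∫ s in (0 : ℝ)..1, ((k : ℝ) + s) ^ (-α))
          + q⁻¹ * ∫ s in (0 : ℝ)..1, (((k + 2 : ℕ) : ℝ) + s) ^ (-α) := by
      rw [← intervalIntegral.integral_const_mul, ← intervalIntegral.integral_const_mul,
        ← intervalIntegral.integral_const_mul, ← intervalIntegral.integral_add
          ((intervalIntegrable_add_rpow_neg hα1 _).const_mul _)
          ((intervalIntegrable_add_rpow_neg hα1 _).const_mul _)]
      refine intervalIntegral.integral_mono_on_of_le_Ioo zero_le_one
        ((intervalIntegrable_add_rpow_neg hα1 _).const_mul _)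
        (((intervalIntegrable_add_rpow_neg hα1 _).const_mul _).add
          ((intervalIntegrable_add_rpow_neg hα1 _).const_mul _)) fun s hs => ?_
      have hk : (0 : ℝ) ≤ k := Nat.cast_nonneg k
      have hs0 := hs.1
      push_cast
      set x := (k : ℝ) + s with hx
      have hxpos : 0 < x := by linarith
      have e1 : (k : ℝ) + 1 + s = x + 1 := by ring
      have e2 : (k : ℝ) + 2 + s = x + 2 := by ring
      rw [e1, e2]
      have h3 : ((x + 1) ^ (-α)) ^ 2 ≤ x ^ (-α) * (x + 2) ^ (-α) := by
        rw [← Real.mul_rpow hxpos.le (by linarith), sq, ← Real.mul_rpow (by linarith) (by linarith)]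
        exact Real.rpow_le_rpow_of_nonpos (by positivity) (by nlinarith) (by linarith)
      have hX : 0 < x ^ (-α) := Real.rpow_pos_of_pos hxpos _
      have hY : 0 < (x + 1) ^ (-α) := Real.rpow_pos_of_pos (by linarith) _
      have hZ : 0 < (x + 2) ^ (-α) := Real.rpow_pos_of_pos (by linarith) _
      set X := x ^ (-α)
      set Y := (x + 1) ^ (-α)
      set Z := (x + 2) ^ (-α)
      have h4 : (2 * Y) ^ 2 ≤ (q * X + q⁻¹ * Z) ^ 2 := by
        have e3 : (q * X) * (q⁻¹ * Z) = X * Z := by field_simp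
        nlinarith [sq_nonneg (q * X - q⁻¹ * Z)]
      exact le_of_sq_le_sq h4 (by positivity)
    nlinarith
  have e4 : q * l1Kernel α k = l1Kernel α (k + 1) := by rw [hq, div_mul_cancel₀ _ h0.ne']
  have e5 : q⁻¹ = l1Kernel α k / l1Kernel α (k + 1) := by rw [hq, inv_div]
  rw [e4, e5] at key
  have h6 : l1Kernel α (k + 1) ≤ l1Kernel α k * l1Kernel α (k + 2) / l1Kernel α (k + 1) := by
    rw [mul_div_right_comm]; linarith
  rw [le_div_iff₀ h1] at h6
  linarith

/-- The partial sums of the kernel telescope. -/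
theorem sum_l1Kernel {α : ℝ} (hα1 : α < 1) (n : ℕ) :
    ∑ k ∈ Finset.range n, l1Kernel α k = (n : ℝ) ^ (1 - α) := by
  have := Finset.sum_range_sub (fun k : ℕ => (k : ℝ) ^ (1 - α)) n
  simp only [Nat.cast_add, Nat.cast_one, Nat.cast_zero,
    Real.zero_rpow (show (1 : ℝ) - α ≠ 0 by linarith), sub_zero] at this
  exact this

/-- Convolution of `j ^ (-1-γ)` with `j ^ (α-1)`: the summable factor lets the other one
dominate. -/
theorem exists_sum_div_le {α γ : ℝ} (hα0 : 0 < α) (hα1 : α < 1) (hγ : 0 < γ) :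
    ∃ C : ℝ, 0 < C ∧ ∀ m : ℕ, 1 ≤ m →
      ∑ j ∈ Finset.Icc 1 m, (j : ℝ) ^ (-1 - γ) / ((m - j + 1 : ℕ) : ℝ) ^ (1 - α) ≤
        C * (m : ℝ) ^ (α - 1) := by
  have hsum : Summable fun n : ℕ => (n : ℝ) ^ (-1 - γ) := Real.summable_nat_rpow.2 (by linarith)
  set S := ∑' n : ℕ, (n : ℝ) ^ (-1 - γ) with hS
  have hSnn : 0 ≤ S := tsum_nonneg fun n => by positivity
  refine ⟨2 ^ (1 - α) * S + 2 ^ (1 + γ) / α, by positivity, fun m hm => ?_⟩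
  have hm0 : (0 : ℝ) < m := by exact_mod_cast hm
  have hm1 : (1 : ℝ) ≤ m := by exact_mod_cast hm
  have hterm : ∀ j ∈ Finset.Icc 1 m,
      (j : ℝ) ^ (-1 - γ) / ((m - j + 1 : ℕ) : ℝ) ^ (1 - α) ≤
        ((m : ℝ) / 2) ^ (α - 1) * (j : ℝ) ^ (-1 - γ)
          + ((m : ℝ) / 2) ^ (-1 - γ) * ((m - j + 1 : ℕ) : ℝ) ^ (α - 1) := by
    intro j hj
    obtain ⟨hj1, hjm⟩ := Finset.mem_Icc.1 hj
    have hj0 : (0 : ℝ) < j := by exact_mod_cast hj1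
    have hc : ((m - j + 1 : ℕ) : ℝ) = m - j + 1 := by push_cast [Nat.cast_sub hjm]; ring
    have hjm' : (j : ℝ) ≤ m := by exact_mod_cast hjm
    have e : (j : ℝ) ^ (-1 - γ) / ((m - j + 1 : ℕ) : ℝ) ^ (1 - α) =
        (j : ℝ) ^ (-1 - γ) * ((m - j + 1 : ℕ) : ℝ) ^ (α - 1) := by
      rw [show α - 1 = -(1 - α) by ring, Real.rpow_neg (by positivity), div_eq_mul_inv]
    rw [e]
    -- for `j ≤ m / 2` the second factor is nearly constant, for `j ≥ m / 2` the first one is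
    rcases le_total ((j : ℝ)) (m / 2) with h | h
    · have h1 : ((m - j + 1 : ℕ) : ℝ) ^ (α - 1) ≤ ((m : ℝ) / 2) ^ (α - 1) :=
        Real.rpow_le_rpow_of_nonpos (by positivity) (by rw [hc]; linarith) (by linarith)
      have h2 : 0 ≤ ((m : ℝ) / 2) ^ (-1 - γ) * ((m - j + 1 : ℕ) : ℝ) ^ (α - 1) := by positivity
      have h3 := mul_le_mul_of_nonneg_left h1 (show 0 ≤ (j : ℝ) ^ (-1 - γ) by positivity)
      linarith
    · have h1 : (j : ℝ) ^ (-1 - γ) ≤ ((m : ℝ) / 2) ^ (-1 - γ) :=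
        Real.rpow_le_rpow_of_nonpos (by positivity) h (by linarith)
      have h2 : 0 ≤ ((m : ℝ) / 2) ^ (α - 1) * (j : ℝ) ^ (-1 - γ) := by positivity
      have h3 := mul_le_mul_of_nonneg_right h1
        (show 0 ≤ ((m - j + 1 : ℕ) : ℝ) ^ (α - 1) by positivity)
      linarith
  refine (Finset.sum_le_sum hterm).trans ?_
  rw [Finset.sum_add_distrib, ← Finset.mul_sum, ← Finset.mul_sum]
  have hS1 : ∑ j ∈ Finset.Icc 1 m, (j : ℝ) ^ (-1 - γ) ≤ S :=
    hsum.sum_le_tsum _ fun n _ => by positivity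
  have hS2 : ∑ j ∈ Finset.Icc 1 m, ((m - j + 1 : ℕ) : ℝ) ^ (α - 1) ≤ (m : ℝ) ^ α / α := by
    refine le_trans (le_of_eq ?_) (sum_rpow_sub_one_le hα0 hα1 m)
    refine Finset.sum_nbij' (fun j => m - j) (fun k => m - k) ?_ ?_ ?_ ?_ ?_
    all_goals intro j hj; simp only [Finset.mem_Icc, Finset.mem_range] at hj ⊢
    · omega
    · omega
    · omega
    · omega
    · push_cast; rfl
  have e1 : ((m : ℝ) / 2) ^ (α - 1) = 2 ^ (1 - α) * (m : ℝ) ^ (α - 1) := by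
    rw [Real.div_rpow hm0.le zero_le_two, show (1 - α : ℝ) = -(α - 1) by ring,
      Real.rpow_neg zero_le_two]; ring
  have e2 : ((m : ℝ) / 2) ^ (-1 - γ) = 2 ^ (1 + γ) * (m : ℝ) ^ (-1 - γ) := by
    rw [Real.div_rpow hm0.le zero_le_two, show (1 + γ : ℝ) = -(-1 - γ) by ring,
      Real.rpow_neg zero_le_two]; ring
  have e3 : (m : ℝ) ^ (-1 - γ) * (m : ℝ) ^ α ≤ (m : ℝ) ^ (α - 1) := by
    rw [← Real.rpow_add hm0]
    exact Real.rpow_le_rpow_of_exponent_le hm1 (by linarith)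
  calc ((m : ℝ) / 2) ^ (α - 1) * ∑ j ∈ Finset.Icc 1 m, (j : ℝ) ^ (-1 - γ)
        + ((m : ℝ) / 2) ^ (-1 - γ) * ∑ j ∈ Finset.Icc 1 m, ((m - j + 1 : ℕ) : ℝ) ^ (α - 1)
      ≤ ((m : ℝ) / 2) ^ (α - 1) * S + ((m : ℝ) / 2) ^ (-1 - γ) * ((m : ℝ) ^ α / α) := by gcongr
    _ = 2 ^ (1 - α) * S * (m : ℝ) ^ (α - 1)
        + 2 ^ (1 + γ) / α * ((m : ℝ) ^ (-1 - γ) * (m : ℝ) ^ α) := by rw [e1, e2]; ring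
    _ ≤ 2 ^ (1 - α) * S * (m : ℝ) ^ (α - 1) + 2 ^ (1 + γ) / α * (m : ℝ) ^ (α - 1) := by gcongr
    _ = _ := by ring

/-- Convolution of `j ^ (-1-γ)` with the differences of `j ^ (-α)`, which decay at least as fast
as `j ^ (-1-γ)` because of `γ ≤ α`: the sum decays like the slower factor. -/
theorem exists_sum_mul_diff_le {α γ : ℝ} (hα0 : 0 < α) (hγ : 0 < γ) (hγα : γ ≤ α) :
    ∃ C : ℝ, 0 < C ∧ ∀ m : ℕ, 1 ≤ m →
      ∑ j ∈ Finset.Ico 1 m, (j : ℝ) ^ (-1 - γ) *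
        (((m : ℝ) - j) ^ (-α) - ((m : ℝ) - (j - 1 : ℕ)) ^ (-α)) ≤ C * (m : ℝ) ^ (-1 - γ) := by
  have hsum : Summable fun n : ℕ => (n : ℝ) ^ (-1 - γ) := Real.summable_nat_rpow.2 (by linarith)
  set S := ∑' n : ℕ, (n : ℝ) ^ (-1 - γ) with hS
  have hSnn : 0 ≤ S := tsum_nonneg fun n => by positivity
  refine ⟨α * 2 ^ (1 + α) * S + 2 ^ (1 + γ), by positivity, fun m hm => ?_⟩
  have hm0 : (0 : ℝ) < m := by exact_mod_cast hm
  have hm1 : (1 : ℝ) ≤ m := by exact_mod_cast hm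
  set D : ℕ → ℝ := fun j => ((m : ℝ) - j) ^ (-α) - ((m : ℝ) - (j - 1 : ℕ)) ^ (-α) with hD
  have hDnn : ∀ j ∈ Finset.Ico 1 m, 0 ≤ D j ∧ D j ≤ α * ((m : ℝ) - j) ^ (-α - 1) := by
    intro j hj
    obtain ⟨hj1, hjm⟩ := Finset.mem_Ico.1 hj
    have hjm' : (j : ℝ) < m := by exact_mod_cast hjm
    have hc : ((j - 1 : ℕ) : ℝ) = j - 1 := by push_cast [Nat.cast_sub hj1]; ring
    simp only [hD, hc]
    constructor
    · exact sub_nonneg.2 (Real.rpow_le_rpow_of_nonpos (by linarith) (by linarith) (by linarith))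
    · have := rpow_neg_sub_rpow_neg_le hα0.le (show 0 < (m : ℝ) - j by linarith)
        (show (m : ℝ) - j ≤ m - (j - 1) by linarith)
      refine this.trans (le_of_eq ?_)
      ring
  have hterm : ∀ j ∈ Finset.Ico 1 m, (j : ℝ) ^ (-1 - γ) * D j ≤
        α * ((m : ℝ) / 2) ^ (-α - 1) * (j : ℝ) ^ (-1 - γ) + ((m : ℝ) / 2) ^ (-1 - γ) * D j := by
    intro j hj
    obtain ⟨h1, h2⟩ := hDnn j hj
    obtain ⟨hj1, hjm⟩ := Finset.mem_Ico.1 hj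
    have hj0 : (0 : ℝ) < j := by exact_mod_cast hj1
    have hjm' : (j : ℝ) < m := by exact_mod_cast hjm
    have hp : 0 ≤ (j : ℝ) ^ (-1 - γ) := by positivity
    rcases le_total ((j : ℝ)) (m / 2) with h | h
    · have h3 : ((m : ℝ) - j) ^ (-α - 1) ≤ ((m : ℝ) / 2) ^ (-α - 1) :=
        Real.rpow_le_rpow_of_nonpos (by positivity) (by linarith) (by linarith)
      have h4 : 0 ≤ ((m : ℝ) / 2) ^ (-1 - γ) * D j := by positivity
      have h5 : (j : ℝ) ^ (-1 - γ) * D j ≤ (j : ℝ) ^ (-1 - γ) * (α * ((m : ℝ) / 2) ^ (-α - 1)) :=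
        mul_le_mul_of_nonneg_left (h2.trans (by gcongr)) hp
      linarith
    · have h3 : (j : ℝ) ^ (-1 - γ) ≤ ((m : ℝ) / 2) ^ (-1 - γ) :=
        Real.rpow_le_rpow_of_nonpos (by positivity) h (by linarith)
      have h4 : 0 ≤ α * ((m : ℝ) / 2) ^ (-α - 1) * (j : ℝ) ^ (-1 - γ) := by positivity
      linarith [mul_le_mul_of_nonneg_right h3 h1]
  refine (Finset.sum_le_sum hterm).trans ?_
  rw [Finset.sum_add_distrib, ← Finset.mul_sum, ← Finset.mul_sum]
  have hS1 : ∑ j ∈ Finset.Ico 1 m, (j : ℝ) ^ (-1 - γ) ≤ S :=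
    hsum.sum_le_tsum _ fun n _ => by positivity
  have hS2 : ∑ j ∈ Finset.Ico 1 m, D j ≤ 1 := by
    obtain ⟨n, rfl⟩ : ∃ n, m = n + 1 := ⟨m - 1, by omega⟩
    have : ∑ j ∈ Finset.Ico 1 (n + 1), D j =
        ∑ j ∈ Finset.range n, ((((n + 1 : ℕ) : ℝ) - (j + 1 : ℕ)) ^ (-α)
          - (((n + 1 : ℕ) : ℝ) - j) ^ (-α)) := by
      rw [Finset.range_eq_Ico, ← Finset.sum_Ico_add' D 0 n 1]
      refine Finset.sum_congr rfl fun j _ => ?_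
      simp only [hD, Nat.add_sub_cancel]
    rw [this, Finset.sum_range_sub fun j : ℕ => (((n + 1 : ℕ) : ℝ) - j) ^ (-α)]
    have h0 : (0 : ℝ) ≤ ((n + 1 : ℕ) : ℝ) ^ (-α) := by positivity
    have h1 : (((n + 1 : ℕ) : ℝ) - n) = 1 := by push_cast; ring
    rw [h1, Real.one_rpow, Nat.cast_zero, sub_zero]
    linarith
  have e1 : ((m : ℝ) / 2) ^ (-α - 1) = 2 ^ (1 + α) * (m : ℝ) ^ (-α - 1) := by
    rw [Real.div_rpow hm0.le zero_le_two, show (1 + α : ℝ) = -(-α - 1) by ring,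
      Real.rpow_neg zero_le_two]; ring
  have e2 : ((m : ℝ) / 2) ^ (-1 - γ) = 2 ^ (1 + γ) * (m : ℝ) ^ (-1 - γ) := by
    rw [Real.div_rpow hm0.le zero_le_two, show (1 + γ : ℝ) = -(-1 - γ) by ring,
      Real.rpow_neg zero_le_two]; ring
  have e3 : (m : ℝ) ^ (-α - 1) ≤ (m : ℝ) ^ (-1 - γ) :=
    Real.rpow_le_rpow_of_exponent_le hm1 (by linarith)
  calc α * ((m : ℝ) / 2) ^ (-α - 1) * ∑ j ∈ Finset.Ico 1 m, (j : ℝ) ^ (-1 - γ)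
        + ((m : ℝ) / 2) ^ (-1 - γ) * ∑ j ∈ Finset.Ico 1 m, D j
      ≤ α * ((m : ℝ) / 2) ^ (-α - 1) * S + ((m : ℝ) / 2) ^ (-1 - γ) * 1 := by gcongr
    _ = α * 2 ^ (1 + α) * S * (m : ℝ) ^ (-α - 1) + 2 ^ (1 + γ) * (m : ℝ) ^ (-1 - γ) := by
        rw [e1, e2]; ring
    _ ≤ α * 2 ^ (1 + α) * S * (m : ℝ) ^ (-1 - γ) + 2 ^ (1 + γ) * (m : ℝ) ^ (-1 - γ) := by gcongr
    _ = _ := by ring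

/-! ### The graded mesh -/

namespace L1Method

theorem mesh_zero {T r : ℝ} (hr : 1 ≤ r) (M : ℕ) : mesh T r M 0 = 0 := by
  simp [mesh, Real.zero_rpow (show r ≠ 0 by linarith)]

theorem mesh_strictMono {T r : ℝ} (hT : 0 < T) (hr : 1 ≤ r) {M : ℕ} (hM : 1 ≤ M) :
    StrictMono (mesh T r M) := by
  intro i j hij
  have hM' : (0 : ℝ) < M := by exact_mod_cast hM
  have hij' : (i : ℝ) < j := by exact_mod_cast hij
  refine mul_lt_mul_of_pos_left (Real.rpow_lt_rpow (by positivity) ?_ (by linarith)) hT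
  gcongr

theorem mesh_self {T r : ℝ} {M : ℕ} (hM : 1 ≤ M) : mesh T r M M = T := by
  have hM' : (M : ℝ) ≠ 0 := by positivity
  simp [mesh, hM']

theorem mesh_one_right (T : ℝ) (M j : ℕ) : mesh T 1 M j = T / M * j := by
  rw [mesh, Real.rpow_one]; ring

theorem mesh_pos {T r : ℝ} (hT : 0 < T) {M : ℕ} (hM : 1 ≤ M) {j : ℕ} (hj : 1 ≤ j) :
    0 < mesh T r M j := by
  have hM' : (0 : ℝ) < M := by exact_mod_cast hM
  have hj' : (0 : ℝ) < j := by exact_mod_cast hj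
  unfold mesh
  positivity

theorem mesh_pred {T r : ℝ} {M j : ℕ} (hj : 1 ≤ j) :
    mesh T r M (j - 1) = mesh T r M j * (1 + -(1 / (j : ℝ))) ^ r := by
  have hj' : (1 : ℝ) ≤ j := by exact_mod_cast hj
  have hj0 : (0 : ℝ) < j := by linarith
  have h1 : 0 ≤ 1 + -(1 / (j : ℝ)) := by
    rw [← sub_eq_add_neg, sub_nonneg, div_le_one hj0]; exact hj'
  rw [mesh, mesh, mul_assoc, ← Real.mul_rpow (by positivity) h1, Nat.cast_sub hj]
  congr 2
  push_cast
  field_simp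
  ring

theorem mesh_step_le {T r : ℝ} (hT : 0 < T) (hr : 1 ≤ r) {M j : ℕ} (hM : 1 ≤ M) (hj : 1 ≤ j) :
    mesh T r M j - mesh T r M (j - 1) ≤ r / j * mesh T r M j := by
  have hj' : (1 : ℝ) ≤ j := by exact_mod_cast hj
  have hj0 : (0 : ℝ) < j := by linarith
  have h1 : -1 ≤ -(1 / (j : ℝ)) := by
    rw [neg_le_neg_iff, div_le_one hj0]; exact hj'
  have h2 := mul_le_mul_of_nonneg_left (one_add_mul_self_le_rpow_one_add h1 hr)
    (mesh_pos (r := r) hT hM hj).le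
  rw [mesh_pred hj]
  have h3 : mesh T r M j * (1 + r * -(1 / (j : ℝ))) = mesh T r M j - r / j * mesh T r M j := by
    ring
  linarith

theorem le_mesh_step {T r : ℝ} (hT : 0 < T) (hr : 1 ≤ r) {M j : ℕ} (hM : 1 ≤ M) (hj : 1 ≤ j) :
    mesh T r M j ≤ j * (mesh T r M j - mesh T r M (j - 1)) := by
  have hj' : (1 : ℝ) ≤ j := by exact_mod_cast hj
  have hj0 : (0 : ℝ) < j := by linarith
  have h1 : 0 ≤ 1 + -(1 / (j : ℝ)) := by
    rw [← sub_eq_add_neg, sub_nonneg, div_le_one hj0]; exact hj'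
  have h2 : (1 + -(1 / (j : ℝ))) ^ r ≤ 1 + -(1 / (j : ℝ)) :=
    Real.rpow_le_self_of_le_one h1 (by have : 0 ≤ 1 / (j : ℝ) := by positivity
                                       linarith) hr
  have h3 := mul_le_mul_of_nonneg_left h2 (mesh_pos (r := r) hT hM hj).le
  have h4 : (j : ℝ) * (mesh T r M j * (1 + -(1 / (j : ℝ)))) = j * mesh T r M j - mesh T r M j := by
    field_simp
    ring
  rw [mesh_pred hj]
  nlinarith [mul_le_mul_of_nonneg_left h3 hj0.le]

theorem two_mul_mesh_le {T r : ℝ} (hT : 0 < T) (hr : 1 ≤ r) {M i j : ℕ} (hM : 1 ≤ M)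
    (hij : 2 * i ≤ j) : 2 * mesh T r M i ≤ mesh T r M j := by
  have hM' : (0 : ℝ) < M := by exact_mod_cast hM
  have hij' : 2 * (i : ℝ) ≤ j := by exact_mod_cast hij
  have h1 : (2 : ℝ) ≤ 2 ^ r := by
    simpa using Real.rpow_le_rpow_of_exponent_le one_le_two hr
  have h2 : (2 * ((i : ℝ) / M)) ^ r ≤ ((j : ℝ) / M) ^ r := by
    refine Real.rpow_le_rpow (by positivity) ?_ (by linarith)
    rw [← mul_div_assoc]
    gcongr
  rw [Real.mul_rpow zero_le_two (by positivity)] at h2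
  have h3 : 0 ≤ ((i : ℝ) / M) ^ r := by positivity
  unfold mesh
  nlinarith [mul_le_mul_of_nonneg_right h1 h3]

/-- The contribution to the truncation error of the mesh intervals before the last one, on the
graded mesh. For `2 j ≤ m` the kernel is regular, because `t_m - t_j ≥ t_m / 2`; for
`2 j ≥ m` the factor `τ_j / t_j ≤ r / j` is of size `1 / m`, and the differences telescope. -/
theorem sum_mesh_le {α T r : ℝ} (hα0 : 0 < α) (hT : 0 < T) (hr : 1 ≤ r) {M : ℕ}
    (hM : 1 ≤ M) {m : ℕ} (hm : 1 ≤ m) :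
    ∑ j ∈ Finset.Ico 1 m, ((mesh T r M j - mesh T r M (j - 1)) / mesh T r M j) ^ α *
        ((mesh T r M m - mesh T r M j) ^ (-α) - (mesh T r M m - mesh T r M (j - 1)) ^ (-α)) ≤
      (α * 2 ^ (α + 1) + (2 * r) ^ α) * mesh T r M m ^ (-α) := by
  set t := mesh T r M with ht
  have hmono : StrictMono t := mesh_strictMono hT hr hM
  have ht0 : t 0 = 0 := mesh_zero hr M
  have hpos : ∀ j, 1 ≤ j → 0 < t j := fun j hj => mesh_pos hT hM hj
  have hm0 : (0 : ℝ) < m := by exact_mod_cast hm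
  set D : ℕ → ℝ := fun j => (t m - t j) ^ (-α) - (t m - t (j - 1)) ^ (-α) with hD
  have htm := hpos m hm
  have hDb : ∀ j ∈ Finset.Ico 1 m, 0 ≤ D j ∧
      D j ≤ α * (t m - t j) ^ (-α - 1) * (t j - t (j - 1)) := by
    intro j hj
    obtain ⟨hj1, hjm⟩ := Finset.mem_Ico.1 hj
    have h1 : t j < t m := hmono hjm
    have h2 : t (j - 1) < t j := hmono (by omega)
    constructor
    · exact sub_nonneg.2 (Real.rpow_le_rpow_of_nonpos (by linarith) (by linarith) (by linarith))
    · refine (rpow_neg_sub_rpow_neg_le hα0.le (by linarith) (by linarith)).trans (le_of_eq ?_)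
      ring
  have hterm : ∀ j ∈ Finset.Ico 1 m, ((t j - t (j - 1)) / t j) ^ α * D j ≤
      α * (t m / 2) ^ (-α - 1) * (t j - t (j - 1)) + (2 * r / m) ^ α * D j := by
    intro j hj
    obtain ⟨h1, h2⟩ := hDb j hj
    obtain ⟨hj1, hjm⟩ := Finset.mem_Ico.1 hj
    have hj0 : (0 : ℝ) < j := by exact_mod_cast hj1
    have htj := hpos j hj1
    have h3 : t (j - 1) < t j := hmono (by omega)
    have h4 : 0 ≤ t (j - 1) := by rw [← ht0]; exact hmono.monotone (Nat.zero_le _)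
    have h5 : 0 ≤ (t j - t (j - 1)) / t j := div_nonneg (by linarith) htj.le
    rcases le_total (2 * j) m with h | h
    · have h6 : 2 * t j ≤ t m := two_mul_mesh_le hT hr hM h
      have h7 : ((t j - t (j - 1)) / t j) ^ α ≤ 1 :=
        Real.rpow_le_one h5 ((div_le_one htj).2 (by linarith)) hα0.le
      have h8 : (t m - t j) ^ (-α - 1) ≤ (t m / 2) ^ (-α - 1) :=
        Real.rpow_le_rpow_of_nonpos (by positivity) (by linarith) (by linarith)
      have h9 : D j ≤ α * (t m / 2) ^ (-α - 1) * (t j - t (j - 1)) :=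
        h2.trans (mul_le_mul_of_nonneg_right (mul_le_mul_of_nonneg_left h8 hα0.le) (by linarith))
      have h10 : 0 ≤ (2 * r / m) ^ α * D j := mul_nonneg (by positivity) h1
      nlinarith [mul_le_mul_of_nonneg_right h7 h1]
    · have h6 : (t j - t (j - 1)) / t j ≤ 2 * r / m := by
        rw [div_le_iff₀ htj]
        refine (mesh_step_le hT hr hM hj1).trans (mul_le_mul_of_nonneg_right ?_ htj.le)
        have h' : (m : ℝ) ≤ 2 * j := by exact_mod_cast h
        rw [div_le_div_iff₀ hj0 hm0]
        nlinarith
      have h7 : ((t j - t (j - 1)) / t j) ^ α ≤ (2 * r / m) ^ α :=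
        Real.rpow_le_rpow h5 h6 hα0.le
      have h10 : 0 ≤ α * (t m / 2) ^ (-α - 1) * (t j - t (j - 1)) :=
        mul_nonneg (by positivity) (by linarith)
      linarith [mul_le_mul_of_nonneg_right h7 h1]
  refine (Finset.sum_le_sum hterm).trans ?_
  rw [Finset.sum_add_distrib, ← Finset.mul_sum, ← Finset.mul_sum]
  obtain ⟨n, rfl⟩ : ∃ n, m = n + 1 := ⟨m - 1, by omega⟩
  have hshift : ∀ f : ℕ → ℝ, ∑ j ∈ Finset.Ico 1 (n + 1), (f j - f (j - 1)) = f n - f 0 := by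
    intro f
    rw [← Finset.sum_range_sub, Finset.range_eq_Ico,
      ← Finset.sum_Ico_add' (fun j => f j - f (j - 1)) 0 n 1]
    simp
  have hS1 : ∑ j ∈ Finset.Ico 1 (n + 1), (t j - t (j - 1)) ≤ t (n + 1) := by
    rw [hshift, ht0, sub_zero]
    exact (hmono (Nat.lt_succ_self n)).le
  have hstep : t (n + 1) / ((n + 1 : ℕ) : ℝ) ≤ t (n + 1) - t n := by
    rw [div_le_iff₀ hm0, mul_comm]
    exact le_mesh_step hT hr hM hm
  have hS2 : ∑ j ∈ Finset.Ico 1 (n + 1), D j ≤ (t (n + 1) / ((n + 1 : ℕ) : ℝ)) ^ (-α) := by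
    have h1 := hshift fun j => (t (n + 1) - t j) ^ (-α)
    simp only [hD]
    rw [h1, ht0, sub_zero]
    have h2 : (t (n + 1) - t n) ^ (-α) ≤ (t (n + 1) / ((n + 1 : ℕ) : ℝ)) ^ (-α) :=
      Real.rpow_le_rpow_of_nonpos (by positivity) hstep (by linarith)
    linarith [Real.rpow_pos_of_pos htm (-α)]
  have e1 : (t (n + 1) / 2) ^ (-α - 1) * t (n + 1) = 2 ^ (α + 1) * t (n + 1) ^ (-α) := by
    rw [Real.div_rpow htm.le zero_le_two, show (α + 1 : ℝ) = -(-α - 1) by ring,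
      Real.rpow_neg zero_le_two, Real.rpow_sub_one htm.ne']
    field_simp
  have e2 : (2 * r / ((n + 1 : ℕ) : ℝ)) ^ α * (t (n + 1) / ((n + 1 : ℕ) : ℝ)) ^ (-α) =
      (2 * r) ^ α * t (n + 1) ^ (-α) := by
    rw [Real.div_rpow (by positivity) hm0.le, Real.div_rpow htm.le hm0.le, Real.rpow_neg hm0.le]
    have : ((n + 1 : ℕ) : ℝ) ^ α ≠ 0 := by positivity
    field_simp
  calc α * (t (n + 1) / 2) ^ (-α - 1) * ∑ j ∈ Finset.Ico 1 (n + 1), (t j - t (j - 1))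
        + (2 * r / ((n + 1 : ℕ) : ℝ)) ^ α * ∑ j ∈ Finset.Ico 1 (n + 1), D j
      ≤ α * (t (n + 1) / 2) ^ (-α - 1) * t (n + 1)
        + (2 * r / ((n + 1 : ℕ) : ℝ)) ^ α * (t (n + 1) / ((n + 1 : ℕ) : ℝ)) ^ (-α) := by gcongr
    _ = _ := by rw [mul_assoc, e1, e2]; ring

end L1Method

/-! ### The truncation error of the L1 method -/

theorem intervalIntegrable_sub_rpow_neg {α : ℝ} (hα1 : α < 1) (a b c : ℝ) :
    IntervalIntegrable (fun s => (c - s) ^ (-α)) volume a b := by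
  have := (intervalIntegral.intervalIntegrable_rpow' (a := c - a) (b := c - b)
    (show (-1 : ℝ) < -α by linarith)).comp_sub_left c
  simpa using this

theorem integral_sub_rpow_neg {α : ℝ} (hα1 : α < 1) {a b c : ℝ} :
    ∫ s in a..b, (c - s) ^ (-α) = ((c - a) ^ (1 - α) - (c - b) ^ (1 - α)) / (1 - α) := by
  rw [intervalIntegral.integral_comp_sub_left (fun s => s ^ (-α)) c,
    integral_rpow (Or.inl (by linarith)), neg_add_eq_sub]

theorem intervalIntegrable_of_abs_le_Ioo {f g : ℝ → ℝ} {a b : ℝ} (hab : a ≤ b)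
    (hf : Measurable f) (hg : IntervalIntegrable g volume a b)
    (h : ∀ s ∈ Set.Ioo a b, |f s| ≤ g s) : IntervalIntegrable f volume a b := by
  rw [intervalIntegrable_iff_integrableOn_Ioo_of_le hab] at hg ⊢
  refine Integrable.mono' hg hf.aestronglyMeasurable ?_
  filter_upwards [ae_restrict_mem measurableSet_Ioo] with s hs using h s hs

theorem abs_integral_le_of_abs_le_Ioo {f g : ℝ → ℝ} {a b : ℝ} (hab : a ≤ b)
    (hf : Measurable f) (hg : IntervalIntegrable g volume a b)
    (h : ∀ s ∈ Set.Ioo a b, |f s| ≤ g s) : |∫ s in a..b, f s| ≤ ∫ s in a..b, g s := by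
  refine (intervalIntegral.abs_integral_le_integral_abs hab).trans ?_
  exact intervalIntegral.integral_mono_on_of_le_Ioo hab
    (intervalIntegrable_of_abs_le_Ioo hab hf hg h).abs hg h

/-- The beta kernel is dominated by the sum of its two endpoint singularities. -/
theorem sub_rpow_mul_rpow_le {α b s : ℝ} (hα0 : 0 < α) (hα1 : α < 1) (hs : s ∈ Set.Ioo 0 b) :
    (b - s) ^ (-α) * s ^ (α - 1) ≤
      (b / 2) ^ (-α) * s ^ (α - 1) + (b / 2) ^ (α - 1) * (b - s) ^ (-α) := by
  obtain ⟨h0, h1⟩ := hs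
  have hb : 0 < b := h0.trans h1
  have hx : 0 ≤ s ^ (α - 1) := by positivity
  have hy : 0 ≤ (b - s) ^ (-α) := Real.rpow_nonneg (by linarith) _
  rcases le_total s (b / 2) with h | h
  · have h2 : (b - s) ^ (-α) ≤ (b / 2) ^ (-α) :=
      Real.rpow_le_rpow_of_nonpos (by linarith) (by linarith) (by linarith)
    have h3 : 0 ≤ (b / 2) ^ (α - 1) * (b - s) ^ (-α) := by positivity
    linarith [mul_le_mul_of_nonneg_right h2 hx]
  · have h2 : s ^ (α - 1) ≤ (b / 2) ^ (α - 1) :=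
      Real.rpow_le_rpow_of_nonpos (by linarith) h (by linarith)
    have h3 : 0 ≤ (b / 2) ^ (-α) * s ^ (α - 1) := by positivity
    linarith [mul_le_mul_of_nonneg_right h2 hy]

theorem intervalIntegrable_beta_majorant {α : ℝ} (hα0 : 0 < α) (hα1 : α < 1) (b : ℝ) :
    IntervalIntegrable (fun s => (b / 2) ^ (-α) * s ^ (α - 1) + (b / 2) ^ (α - 1) * (b - s) ^ (-α))
      volume 0 b :=
  ((intervalIntegral.intervalIntegrable_rpow' (by linarith)).const_mul _).add
    ((intervalIntegrable_sub_rpow_neg hα1 _ _ _).const_mul _)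

/-- Scale invariance makes the bound independent of `b`. -/
theorem integral_beta_majorant_le {α b : ℝ} (hα0 : 0 < α) (hα1 : α < 1) (hb : 0 < b) :
    ∫ s in (0 : ℝ)..b,
      ((b / 2) ^ (-α) * s ^ (α - 1) + (b / 2) ^ (α - 1) * (b - s) ^ (-α)) ≤
      2 / α + 2 / (1 - α) := by
  rw [intervalIntegral.integral_add
    ((intervalIntegral.intervalIntegrable_rpow' (by linarith)).const_mul _)
    ((intervalIntegrable_sub_rpow_neg hα1 _ _ _).const_mul _),
    intervalIntegral.integral_const_mul, intervalIntegral.integral_const_mul,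
    integral_rpow (Or.inl (by linarith)), integral_sub_rpow_neg hα1, sub_add_cancel,
    Real.zero_rpow hα0.ne', sub_zero, sub_zero, sub_self,
    Real.zero_rpow (show 1 - α ≠ 0 by linarith), sub_zero]
  have e1 : (b / 2) ^ (-α) * (b ^ α / α) = 2 ^ α / α := by
    rw [Real.div_rpow hb.le zero_le_two, Real.rpow_neg hb.le, Real.rpow_neg zero_le_two]
    have : b ^ α ≠ 0 := by positivity
    field_simp
  have e2 : (b / 2) ^ (α - 1) * (b ^ (1 - α) / (1 - α)) = 2 ^ (1 - α) / (1 - α) := by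
    rw [show α - 1 = -(1 - α) by ring, Real.div_rpow hb.le zero_le_two, Real.rpow_neg hb.le,
      Real.rpow_neg zero_le_two]
    have : b ^ (1 - α) ≠ 0 := by positivity
    field_simp
  have h1 : (2 : ℝ) ^ α ≤ 2 := by
    simpa using Real.rpow_le_rpow_of_exponent_le one_le_two hα1.le
  have h2 : (2 : ℝ) ^ (1 - α) ≤ 2 := by
    simpa using Real.rpow_le_rpow_of_exponent_le one_le_two (show 1 - α ≤ 1 by linarith)
  have h3 : 0 < 1 - α := by linarith
  rw [e1, e2]
  gcongr

/-- Integration by parts against the interpolation error of `v` on `[a, b]`, which vanishes at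
both ends, moves the derivative to the kernel. -/
theorem abs_integral_kernel_mul_le {α a b c X δ : ℝ} {v : ℝ → ℝ} (hα0 : 0 < α) (hab : a < b)
    (hbc : b < c) (hv : ContinuousOn v (Set.Icc a b)) (hd : DifferentiableOn ℝ v (Set.Ioo a b))
    (hi : IntervalIntegrable (deriv v) volume a b) (hδ : δ * (b - a) = v b - v a)
    (hX : ∀ s ∈ Set.Icc a b, |δ * (s - a) - (v s - v a)| ≤ X) :
    |∫ s in a..b, (c - s) ^ (-α) * (δ - deriv v s)| ≤
      X * ((c - b) ^ (-α) - (c - a) ^ (-α)) := by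
  have hU : ∀ s ∈ Set.uIcc a b,
      HasDerivAt (fun s => (c - s) ^ (-α)) (α * (c - s) ^ (-α - 1)) s := by
    intro s hs
    rw [Set.uIcc_of_le hab.le] at hs
    have := ((hasDerivAt_id' s).const_sub c).rpow_const (p := -α)
      (Or.inl (show c - s ≠ 0 by linarith [hs.2]))
    convert this using 1
    ring
  have hcont : ContinuousOn (fun s => (c - s) ^ (-α - 1)) (Set.uIcc a b) := by
    rw [Set.uIcc_of_le hab.le]
    exact ContinuousOn.rpow_const (by fun_prop) fun s hs => Or.inl (by linarith [hs.2])
  have hU' : IntervalIntegrable (fun s => α * (c - s) ^ (-α - 1)) volume a b :=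
    (continuousOn_const.mul hcont).intervalIntegrable
  have hV : ∀ s ∈ Set.Ioo a b,
      HasDerivAt (fun s => δ * (s - a) - (v s - v a)) (δ - deriv v s) s := by
    intro s hs
    have h1 := (hd.differentiableAt (isOpen_Ioo.mem_nhds hs)).hasDerivAt
    have h2 := (((hasDerivAt_id s).sub_const a).const_mul δ).sub (h1.sub_const (v a))
    convert! h2 using 1
    simp
  have hVc : ContinuousOn (fun s => δ * (s - a) - (v s - v a)) (Set.uIcc a b) := by
    rw [Set.uIcc_of_le hab.le]
    exact (by fun_prop : ContinuousOn (fun s => δ * (s - a)) (Set.Icc a b)).sub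
      (hv.sub continuousOn_const)
  have hibp := intervalIntegral.integral_mul_deriv_eq_deriv_mul_of_hasDeriv_right
    (u := fun s => (c - s) ^ (-α)) (v := fun s => δ * (s - a) - (v s - v a))
    (u' := fun s => α * (c - s) ^ (-α - 1)) (v' := fun s => δ - deriv v s) (a := a) (b := b)
    (fun s hs => (hU s hs).continuousAt.continuousWithinAt) hVc
    (fun s hs => (hU s (by
      rw [min_eq_left hab.le, max_eq_right hab.le] at hs
      rw [Set.uIcc_of_le hab.le]
      exact Set.Ioo_subset_Icc_self hs)).hasDerivWithinAt)
    (fun s hs => (hV s (by rwa [min_eq_left hab.le, max_eq_right hab.le] at hs)).hasDerivWithinAt)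
    hU' (intervalIntegrable_const.sub hi)
  rw [hibp]
  simp only [hδ, sub_self, mul_zero, zero_sub, abs_neg]
  have h1 : |∫ s in a..b, α * (c - s) ^ (-α - 1) * (δ * (s - a) - (v s - v a))| ≤
      ∫ s in a..b, α * (c - s) ^ (-α - 1) * X := by
    refine (intervalIntegral.abs_integral_le_integral_abs hab.le).trans ?_
    refine intervalIntegral.integral_mono_on hab.le
      (((continuousOn_const.mul hcont).mul hVc).abs.intervalIntegrable) (hU'.mul_const X)
      fun s hs => ?_
    have : 0 ≤ α * (c - s) ^ (-α - 1) :=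
      mul_nonneg hα0.le (Real.rpow_nonneg (by linarith [hs.2]) _)
    rw [abs_mul, abs_of_nonneg this]
    exact mul_le_mul_of_nonneg_left (hX s hs) this
  refine h1.trans (le_of_eq ?_)
  rw [intervalIntegral.integral_mul_const, intervalIntegral.integral_eq_sub_of_hasDerivAt hU hU']
  ring

/-- A bound for the second derivative bounds the error of the slope of the chord. -/
theorem abs_slope_sub_deriv_le {a b A δ : ℝ} {v : ℝ → ℝ} (hab : a < b)
    (hv : ContinuousOn v (Set.Icc a b)) (hd : DifferentiableOn ℝ v (Set.Ioo a b))
    (hd2 : DifferentiableOn ℝ (deriv v) (Set.Ioo a b))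
    (hA : ∀ s ∈ Set.Ioo a b, |deriv (deriv v) s| ≤ A) (hδ : δ * (b - a) = v b - v a)
    {s : ℝ} (hs : s ∈ Set.Ioo a b) : |δ - deriv v s| ≤ A * (b - a) := by
  obtain ⟨ξ, hξ, hξ'⟩ := exists_deriv_eq_slope v hab hv hd
  have hδξ : δ = deriv v ξ := by
    rw [hξ', eq_div_iff (by linarith), hδ]
  have h1 := (convex_Ioo a b).norm_image_sub_le_of_norm_deriv_le
    (fun x hx => hd2.differentiableAt (isOpen_Ioo.mem_nhds hx)) (fun x hx => hA x hx) hs hξ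
  rw [hδξ]
  refine h1.trans (mul_le_mul_of_nonneg_left ?_ ((abs_nonneg _).trans (hA s hs)))
  rw [Real.norm_eq_abs, abs_le]
  constructor <;> linarith [hs.1, hs.2, hξ.1, hξ.2]

/-- The interpolation error is controlled by an integrable bound of its derivative. -/
theorem abs_interp_error_le {a b δ : ℝ} {v g G : ℝ → ℝ}
    (hv : ContinuousOn v (Set.Icc a b)) (hd : DifferentiableOn ℝ v (Set.Ioo a b))
    (hG : ContinuousOn G (Set.Icc a b)) (hGd : ∀ s ∈ Set.Ioo a b, HasDerivAt G (g s) s)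
    (hGa : G a = 0)
    (hg : ∀ s ∈ Set.Ioo a b, |δ - deriv v s| ≤ g s) {s : ℝ} (hs : s ∈ Set.Icc a b) :
    |δ * (s - a) - (v s - v a)| ≤ G s := by
  have hV : ∀ s ∈ Set.Ioo a b,
      HasDerivAt (fun s => δ * (s - a) - (v s - v a)) (δ - deriv v s) s := by
    intro s hs
    have h1 := (hd.differentiableAt (isOpen_Ioo.mem_nhds hs)).hasDerivAt
    have h2 := (((hasDerivAt_id s).sub_const a).const_mul δ).sub (h1.sub_const (v a))
    convert! h2 using 1
    simp
  have hVc : ContinuousOn (fun s => δ * (s - a) - (v s - v a)) (Set.Icc a b) :=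
    (by fun_prop : ContinuousOn (fun s => δ * (s - a)) (Set.Icc a b)).sub
      (hv.sub continuousOn_const)
  have ha : a ∈ Set.Icc a b := ⟨le_rfl, hs.1.trans hs.2⟩
  have key : ∀ (f f' : ℝ → ℝ), ContinuousOn f (Set.Icc a b) →
      (∀ s ∈ Set.Ioo a b, HasDerivAt f (f' s) s) → (∀ s ∈ Set.Ioo a b, 0 ≤ f' s) →
      f a = 0 → 0 ≤ f s := by
    intro f f' hf hf' hf'' hfa
    have := monotoneOn_of_deriv_nonneg (convex_Icc a b) hf
      (by rw [interior_Icc]; exact fun x hx => (hf' x hx).differentiableAt.differentiableWithinAt)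
      (by rw [interior_Icc]; exact fun x hx => by rw [(hf' x hx).deriv]; exact hf'' x hx)
    rw [← hfa]
    exact this ha hs hs.1
  rw [abs_le]
  constructor
  · have := key (fun s => G s + (δ * (s - a) - (v s - v a))) (fun s => g s + (δ - deriv v s))
      (hG.add hVc) (fun s hs => (hGd s hs).add (hV s hs))
      (fun s hs => by linarith [(abs_le.1 (hg s hs)).1]) (by simp [hGa])
    linarith
  · have := key (fun s => G s - (δ * (s - a) - (v s - v a))) (fun s => g s - (δ - deriv v s))
      (hG.sub hVc) (fun s hs => (hGd s hs).sub (hV s hs))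
      (fun s hs => by linarith [(abs_le.1 (hg s hs)).2]) (by simp [hGa])
    linarith

namespace L1Method

/-- The contribution of the `j`-th mesh interval to `Γ(1-α)` times the truncation error
`δ_t^α v - D_t^α v` at `t_m`. -/
noncomputable def truncPiece (α : ℝ) (t : ℕ → ℝ) (v : ℝ → ℝ) (m j : ℕ) : ℝ :=
  ∫ s in (t (j - 1))..(t j), (t m - s) ^ (-α) * (deltaT t (fun i => v (t i)) j - deriv v s)

/-- The weight of `ψ^j` in the bound for the truncation error at `t_m`. -/
noncomputable def truncWeight (α : ℝ) (t : ℕ → ℝ) (m j : ℕ) : ℝ :=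
  if j = m then (2 / α + 2 / (1 - α)) * t m ^ (-α)
  else 1 / α * (((t j - t (j - 1)) / t j) ^ α *
    ((t m - t j) ^ (-α) - (t m - t (j - 1)) ^ (-α)))

/-- Time regularity of a solution at a fixed point of `Ω`. No bound on the second derivative is
needed, since `psi` is infinite where the second derivative is unbounded. -/
structure TimeRegular (α T K : ℝ) (v : ℝ → ℝ) : Prop where
  cont : ContinuousOn v (Set.Icc 0 T)
  diff_one : DifferentiableOn ℝ v (Set.Ioo 0 T)
  diff_two : DifferentiableOn ℝ (deriv v) (Set.Ioo 0 T)
  bound : ∀ t ∈ Set.Ioo 0 T, |deriv v t| ≤ K * (1 + t ^ (α - 1))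

variable {α T K : ℝ} {v : ℝ → ℝ} {t : ℕ → ℝ}

theorem TimeRegular.intervalIntegrable_deriv (h : TimeRegular α T K v) (hα0 : 0 < α)
    {b : ℝ} (hb : 0 ≤ b) (hbT : b ≤ T) : IntervalIntegrable (deriv v) volume 0 b := by
  refine intervalIntegrable_of_abs_le_Ioo hb (measurable_deriv v) (g := fun s =>
    K * (1 + s ^ (α - 1))) ((intervalIntegrable_const.add
      (intervalIntegral.intervalIntegrable_rpow' (by linarith))).const_mul _) fun s hs => ?_
  exact h.bound s ⟨hs.1, hs.2.trans_le hbT⟩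

theorem TimeRegular.intervalIntegrable_kernel_mul_deriv (h : TimeRegular α T K v) (hα0 : 0 < α)
    (hα1 : α < 1) {b : ℝ} (hb : 0 ≤ b) (hbT : b ≤ T) :
    IntervalIntegrable (fun s => (b - s) ^ (-α) * deriv v s) volume 0 b := by
  refine intervalIntegrable_of_abs_le_Ioo hb
    ((by fun_prop : Measurable fun s : ℝ => (b - s) ^ (-α)).mul (measurable_deriv v)) (g := fun s =>
    |K| * ((b - s) ^ (-α) +
      ((b / 2) ^ (-α) * s ^ (α - 1) + (b / 2) ^ (α - 1) * (b - s) ^ (-α))))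
    (((intervalIntegrable_sub_rpow_neg hα1 _ _ _).add
      (intervalIntegrable_beta_majorant hα0 hα1 b)).const_mul _) fun s hs => ?_
  have h1 := h.bound s ⟨hs.1, hs.2.trans_le hbT⟩
  have h2 := sub_rpow_mul_rpow_le hα0 hα1 hs
  have h3 : 0 ≤ (b - s) ^ (-α) := Real.rpow_nonneg (by linarith [hs.2]) _
  have h4 : 0 ≤ s ^ (α - 1) := Real.rpow_nonneg hs.1.le _
  have h5 : |deriv v s| ≤ |K| * (1 + s ^ (α - 1)) :=
    h1.trans (mul_le_mul_of_nonneg_right (le_abs_self K) (by linarith))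
  rw [abs_mul, abs_of_nonneg h3]
  calc (b - s) ^ (-α) * |deriv v s| ≤ (b - s) ^ (-α) * (|K| * (1 + s ^ (α - 1))) := by gcongr
    _ = |K| * ((b - s) ^ (-α) + (b - s) ^ (-α) * s ^ (α - 1)) := by ring
    _ ≤ _ := by gcongr

theorem mesh_mem_Icc (hmono : StrictMono t) (ht0 : t 0 = 0) {m : ℕ} (hmT : t m ≤ T) {j : ℕ}
    (hj : j ≤ m) : t j ∈ Set.Icc 0 T :=
  ⟨ht0 ▸ hmono.monotone (Nat.zero_le j), (hmono.monotone hj).trans hmT⟩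

/-- The truncation error is the sum of the contributions of the mesh intervals. -/
theorem TimeRegular.deltaAlpha_sub_caputo (h : TimeRegular α T K v) (hα0 : 0 < α) (hα1 : α < 1)
    (hmono : StrictMono t) (ht0 : t 0 = 0) {m : ℕ} (hmT : t m ≤ T) :
    deltaAlpha α t (fun i => v (t i)) m - caputo α v (t m) =
      1 / Real.Gamma (1 - α) * ∑ j ∈ Finset.Icc 1 m, truncPiece α t v m j := by
  have hm := mesh_mem_Icc hmono ht0 hmT le_rfl
  have hint := h.intervalIntegrable_kernel_mul_deriv hα0 hα1 hm.1 hm.2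
  have hj : ∀ j ≤ m, IntervalIntegrable (fun s => (t m - s) ^ (-α) * deriv v s) volume
      (t (j - 1)) (t j) := by
    intro j hj
    refine hint.mono_set ?_
    rw [Set.uIcc_of_le (hmono.monotone (Nat.sub_le j 1)), Set.uIcc_of_le hm.1]
    exact Set.Icc_subset_Icc (ht0 ▸ hmono.monotone (Nat.zero_le _)) (hmono.monotone hj)
  have hsum : ∫ s in (0 : ℝ)..(t m), (t m - s) ^ (-α) * deriv v s =
      ∑ j ∈ Finset.Icc 1 m, ∫ s in (t (j - 1))..(t j), (t m - s) ^ (-α) * deriv v s := by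
    have := intervalIntegral.sum_integral_adjacent_intervals (μ := volume) (a := t) (n := m)
      (f := fun s => (t m - s) ^ (-α) * deriv v s) fun k hk => by simpa using hj (k + 1) hk
    rw [ht0] at this
    rw [← this, Finset.range_eq_Ico,
      show Finset.Icc 1 m = Finset.Ico (0 + 1) (m + 1) from by ext; simp,
      ← Finset.sum_Ico_add' (fun j => ∫ s in (t (j - 1))..(t j), (t m - s) ^ (-α) * deriv v s)]
    simp
  rw [deltaAlpha, caputo, hsum, ← mul_sub, ← Finset.sum_sub_distrib]
  congr 1
  refine Finset.sum_congr rfl fun j hj' => ?_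
  rw [truncPiece, ← intervalIntegral.integral_const_mul, ← intervalIntegral.integral_sub
    ((intervalIntegrable_sub_rpow_neg hα1 _ _ _).const_mul _) (hj j (Finset.mem_Icc.1 hj').2)]
  refine intervalIntegral.integral_congr fun s _ => ?_
  ring

theorem truncWeight_pos (hα0 : 0 < α) (hα1 : α < 1) (hmono : StrictMono t) (ht0 : t 0 = 0)
    {m j : ℕ} (hj : j ∈ Finset.Icc 1 m) : 0 < truncWeight α t m j := by
  obtain ⟨hj1, hjm⟩ := Finset.mem_Icc.1 hj
  have htj : 0 < t j := ht0 ▸ hmono hj1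
  have htm : 0 < t m := htj.trans_le (hmono.monotone hjm)
  have h1 : t (j - 1) < t j := hmono (by omega)
  have h3 : 0 < 1 - α := by linarith
  unfold truncWeight
  split_ifs with hm
  · positivity
  · have h2 : t j < t m := hmono (lt_of_le_of_ne hjm hm)
    have h4 : (t m - t (j - 1)) ^ (-α) < (t m - t j) ^ (-α) :=
      Real.rpow_lt_rpow_of_neg (by linarith) (by linarith) (by linarith)
    have h5 : 0 < (t j - t (j - 1)) / t j := div_pos (by linarith) htj
    have h6 : 0 < (t m - t j) ^ (-α) - (t m - t (j - 1)) ^ (-α) := by linarith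
    positivity

/-- A finite supremum of nonnegative reals in `ℝ≥0∞`, as a real bound. -/
theorem exists_real_bound_of_iSup_ne_top {S : Set ℝ} {h : ℝ → ℝ}
    (hfin : (⨆ s ∈ S, ENNReal.ofReal (h s)) ≠ ⊤) :
    ∃ A : ℝ, 0 ≤ A ∧ ENNReal.ofReal A = (⨆ s ∈ S, ENNReal.ofReal (h s)) ∧ ∀ s ∈ S, h s ≤ A := by
  refine ⟨(⨆ s ∈ S, ENNReal.ofReal (h s)).toReal, ENNReal.toReal_nonneg,
    ENNReal.ofReal_toReal hfin, fun s hs => ?_⟩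
  rw [← ENNReal.ofReal_le_iff_le_toReal hfin]
  exact le_iSup₂ (f := fun s (_ : s ∈ S) => ENNReal.ofReal (h s)) s hs

/-- Away from `t_m` the derivative of the interpolation error is moved to the kernel; on the last
interval the kernel is integrated directly. -/
theorem ofReal_abs_truncPiece_le (h : TimeRegular α T K v) (hα0 : 0 < α) (hα1 : α < 1)
    (hmono : StrictMono t) (ht0 : t 0 = 0) {m j : ℕ} (hmT : t m ≤ T) (hj : j ∈ Finset.Icc 1 m) :
    ENNReal.ofReal |truncPiece α t v m j| ≤
      ENNReal.ofReal (truncWeight α t m j) * psi α t v j := by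
  have hw := truncWeight_pos hα0 hα1 hmono ht0 hj
  obtain ⟨hj1, hjm⟩ := Finset.mem_Icc.1 hj
  by_cases htop : psi α t v j = ⊤
  · rw [htop, ENNReal.mul_top (ENNReal.ofReal_pos.2 hw).ne']
    exact le_top
  have htj : 0 < t j := ht0 ▸ hmono hj1
  have htjT := (mesh_mem_Icc hmono ht0 hmT hjm).2
  have htm : 0 < t m := htj.trans_le (hmono.monotone hjm)
  have h1 : t (j - 1) < t j := hmono (by omega)
  have h0 : 0 ≤ t (j - 1) := ht0 ▸ hmono.monotone (Nat.zero_le _)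
  have h3 : 0 < 1 - α := by linarith
  have hτ : 0 < t j - t (j - 1) := by linarith
  set τ := t j - t (j - 1) with hτdef
  set δ := deltaT t (fun i => v (t i)) j with hδdef
  have hδ : δ * (t j - t (j - 1)) = v (t j) - v (t (j - 1)) := by
    rw [hδdef, deltaT, div_mul_cancel₀ _ hτ.ne']
  have hsub : Set.Icc (t (j - 1)) (t j) ⊆ Set.Icc 0 T := Set.Icc_subset_Icc h0 htjT
  have hsub' : Set.Ioo (t (j - 1)) (t j) ⊆ Set.Ioo 0 T := Set.Ioo_subset_Ioo h0 htjT
  have hv := h.cont.mono hsub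
  have hd := h.diff_one.mono hsub'
  have hd2 := h.diff_two.mono hsub'
  have hi : IntervalIntegrable (deriv v) volume (t (j - 1)) (t j) := by
    refine (h.intervalIntegrable_deriv hα0 htj.le htjT).mono_set ?_
    rw [Set.uIcc_of_le h1.le, Set.uIcc_of_le htj.le]
    exact Set.Icc_subset_Icc h0 le_rfl
  have hmeas : Measurable fun s => (t m - s) ^ (-α) * (δ - deriv v s) :=
    (by fun_prop : Measurable fun s : ℝ => (t m - s) ^ (-α)).mul
      (measurable_const.sub (measurable_deriv v))
  have hα' : 1 ≤ 1 / α := by rw [le_div_iff₀ hα0]; linarith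
  -- it suffices to bound the interpolation error and the contribution of the last interval
  suffices hmain : ∃ B : ℝ, 0 ≤ B ∧ psi α t v j = ENNReal.ofReal B ∧
      (∀ s ∈ Set.Icc (t (j - 1)) (t j),
        |δ * (s - t (j - 1)) - (v s - v (t (j - 1)))| ≤ 1 / α * (τ / t j) ^ α * B) ∧
      (j = m → |truncPiece α t v m j| ≤ (2 / α + 2 / (1 - α)) * t m ^ (-α) * B) by
    obtain ⟨B, hB0, hB, hB1, hB2⟩ := hmain
    rw [hB, ← ENNReal.ofReal_mul hw.le]
    refine ENNReal.ofReal_le_ofReal ?_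
    unfold truncWeight
    split_ifs with hm
    · exact hB2 hm
    · have h2 : t j < t m := hmono (lt_of_le_of_ne hjm hm)
      refine (abs_integral_kernel_mul_le hα0 h1 h2 hv hd hi hδ hB1).trans (le_of_eq ?_)
      ring
  rcases eq_or_ne j 1 with rfl | hj2
  · -- the first interval, where `v` is only weakly regular
    have hτ1 : τ = t 1 := by simp [hτdef, ht0]
    have hz : t (1 - 1) = 0 := ht0
    rw [hz] at hδ hv hd ⊢
    rw [psi, if_pos rfl, ht0, sub_zero] at htop ⊢
    have hc : 0 < t 1 ^ α := by positivity
    have hfin : (⨆ s ∈ Set.Ioo 0 (t 1), ENNReal.ofReal (s ^ (1 - α) * |δ - deriv v s|)) ≠ ⊤ := by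
      intro h'
      rw [h', ENNReal.mul_top (ENNReal.ofReal_pos.2 hc).ne'] at htop
      exact htop rfl
    obtain ⟨A, hA0, hA1, hA2⟩ := exists_real_bound_of_iSup_ne_top hfin
    have hA3 : ∀ s ∈ Set.Ioo 0 (t 1), |δ - deriv v s| ≤ A * s ^ (α - 1) := by
      intro s hs
      have hs' : 0 < s ^ (1 - α) := Real.rpow_pos_of_pos hs.1 _
      have := hA2 s hs
      rw [show α - 1 = -(1 - α) by ring, Real.rpow_neg hs.1.le, ← div_eq_mul_inv,
        le_div_iff₀ hs']
      linarith
    refine ⟨t 1 ^ α * A, by positivity, ?_, ?_, ?_⟩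
    · rw [ENNReal.ofReal_mul hc.le, hA1]
    · intro s hs
      have := abs_interp_error_le (G := fun s => A * (s ^ α / α)) (g := fun s => A * s ^ (α - 1))
        (δ := δ) hv hd
        ((continuousOn_const.mul ((continuousOn_id.rpow_const
          fun x hx => Or.inr hα0.le).div_const _)))
        (fun x hx => by
          have := ((hasDerivAt_id' x).rpow_const (p := α) (Or.inl hx.1.ne')).div_const α
          have := this.const_mul A
          convert! this using 1
          field_simp) (by simp [Real.zero_rpow hα0.ne']) hA3 hs
      refine this.trans ?_
      rw [hτ1, div_self htj.ne', Real.one_rpow, mul_one]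
      have h5 : s ^ α ≤ t 1 ^ α := Real.rpow_le_rpow hs.1 hs.2 hα0.le
      calc A * (s ^ α / α) ≤ A * (t 1 ^ α / α) := by gcongr
        _ = _ := by ring
    · rintro rfl
      have h5 : |truncPiece α t v 1 1| ≤ ∫ s in (0 : ℝ)..(t 1), A * ((t 1 / 2) ^ (-α) * s ^ (α - 1)
          + (t 1 / 2) ^ (α - 1) * (t 1 - s) ^ (-α)) := by
        rw [truncPiece, show (1 : ℕ) - 1 = 0 from rfl, ht0]
        refine abs_integral_le_of_abs_le_Ioo htj.le hmeas
          ((intervalIntegrable_beta_majorant hα0 hα1 _).const_mul A) fun s hs => ?_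
        have h6 : 0 ≤ (t 1 - s) ^ (-α) := Real.rpow_nonneg (by linarith [hs.2]) _
        rw [abs_mul, abs_of_nonneg h6]
        calc (t 1 - s) ^ (-α) * |δ - deriv v s| ≤ (t 1 - s) ^ (-α) * (A * s ^ (α - 1)) :=
              mul_le_mul_of_nonneg_left (hA3 s hs) h6
          _ = A * ((t 1 - s) ^ (-α) * s ^ (α - 1)) := by ring
          _ ≤ _ := mul_le_mul_of_nonneg_left (sub_rpow_mul_rpow_le hα0 hα1 hs) hA0
      rw [intervalIntegral.integral_const_mul] at h5
      have h7 := mul_le_mul_of_nonneg_left (integral_beta_majorant_le hα0 hα1 htj) hA0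
      have h8 : t 1 ^ (-α) * t 1 ^ α = 1 := by
        rw [← Real.rpow_add htj, neg_add_cancel, Real.rpow_zero]
      calc |truncPiece α t v 1 1| ≤ A * (2 / α + 2 / (1 - α)) := h5.trans h7
        _ = (2 / α + 2 / (1 - α)) * (t 1 ^ (-α) * t 1 ^ α) * A := by rw [h8]; ring
        _ = _ := by ring
  · rw [psi, if_neg hj2] at htop ⊢
    rw [← hτdef] at htop ⊢
    have hc : 0 < τ ^ (2 - α) * t j ^ α := by positivity
    have hfin : (⨆ s ∈ Set.Ioo (t (j - 1)) (t j), ENNReal.ofReal |deriv (deriv v) s|) ≠ ⊤ := by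
      intro h'
      rw [h', ENNReal.mul_top (ENNReal.ofReal_pos.2 hc).ne'] at htop
      exact htop rfl
    obtain ⟨A, hA0, hA1, hA2⟩ := exists_real_bound_of_iSup_ne_top hfin
    have hA3 : ∀ s ∈ Set.Ioo (t (j - 1)) (t j), |δ - deriv v s| ≤ A * τ :=
      fun s hs => abs_slope_sub_deriv_le h1 hv hd hd2 hA2 hδ hs
    have h8 : t j ^ (-α) * t j ^ α = 1 := by
      rw [← Real.rpow_add htj, neg_add_cancel, Real.rpow_zero]
    have e2 : τ ^ (2 - α) * τ ^ α = τ * τ := by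
      rw [← Real.rpow_add hτ, sub_add_cancel, Real.rpow_two, sq]
    refine ⟨τ ^ (2 - α) * t j ^ α * A, by positivity, ?_, ?_, ?_⟩
    · rw [ENNReal.ofReal_mul hc.le, hA1]
    · intro s hs
      have := abs_interp_error_le (G := fun s => A * τ * (s - t (j - 1))) (g := fun _ => A * τ)
        (δ := δ) hv hd (by fun_prop)
        (fun x hx => by
          simpa using ((hasDerivAt_id x).sub_const (t (j - 1))).const_mul (A * τ))
        (by simp) hA3 hs
      refine this.trans ?_
      have e3 : (τ / t j) ^ α = τ ^ α * t j ^ (-α) := by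
        rw [Real.div_rpow hτ.le htj.le, Real.rpow_neg htj.le, div_eq_mul_inv]
      have e4 : 1 / α * (τ / t j) ^ α * (τ ^ (2 - α) * t j ^ α * A) = 1 / α * (A * τ * τ) := by
        rw [e3]
        calc 1 / α * (τ ^ α * t j ^ (-α)) * (τ ^ (2 - α) * t j ^ α * A)
            = 1 / α * (τ ^ (2 - α) * τ ^ α) * (t j ^ (-α) * t j ^ α) * A := by ring
          _ = _ := by rw [e2, h8]; ring
      rw [e4]
      have h5 : A * τ * (s - t (j - 1)) ≤ A * τ * τ :=
        mul_le_mul_of_nonneg_left (by linarith [hs.2]) (by positivity)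
      have h6 : 0 ≤ A * τ * τ := by positivity
      nlinarith [mul_le_mul_of_nonneg_right hα' h6]
    · rintro rfl
      have h5 : |truncPiece α t v j j| ≤
          ∫ s in (t (j - 1))..(t j), A * τ * (t j - s) ^ (-α) := by
        rw [truncPiece]
        refine abs_integral_le_of_abs_le_Ioo h1.le hmeas
          ((intervalIntegrable_sub_rpow_neg hα1 _ _ _).const_mul _) fun s hs => ?_
        have h6 : 0 ≤ (t j - s) ^ (-α) := Real.rpow_nonneg (by linarith [hs.2]) _
        rw [abs_mul, abs_of_nonneg h6, mul_comm]
        exact mul_le_mul_of_nonneg_right (hA3 s hs) h6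
      rw [intervalIntegral.integral_const_mul, integral_sub_rpow_neg hα1, sub_self,
        Real.zero_rpow h3.ne', sub_zero, ← hτdef] at h5
      have e5 : τ * τ ^ (1 - α) = τ ^ (2 - α) := by
        rw [show 2 - α = 1 + (1 - α) by ring, Real.rpow_add hτ, Real.rpow_one]
      have h9 : 0 ≤ τ ^ (2 - α) * A := by positivity
      have h10 : 1 / (1 - α) ≤ 2 / α + 2 / (1 - α) := by
        have : 0 ≤ 2 / α := by positivity
        have : 1 / (1 - α) ≤ 2 / (1 - α) := by gcongr; norm_num
        linarith
      calc |truncPiece α t v j j| ≤ A * τ * (τ ^ (1 - α) / (1 - α)) := h5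
        _ = (1 / (1 - α)) * (τ * τ ^ (1 - α) * A) := by ring
        _ = (1 / (1 - α)) * (τ ^ (2 - α) * A) := by rw [e5]
        _ ≤ (2 / α + 2 / (1 - α)) * (τ ^ (2 - α) * A) := by gcongr
        _ = (2 / α + 2 / (1 - α)) * (t j ^ (-α) * t j ^ α) * (τ ^ (2 - α) * A) := by
            rw [h8, mul_one]
        _ = _ := by ring

end L1Method

/-! ### Mollification in `L²` -/

section Mollification

open scoped Topology Convolution

variable {E : Type*} [NormedAddCommGroup E] [NormedSpace ℝ E] [FiniteDimensional ℝ E]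
  [MeasurableSpace E] [BorelSpace E] {μ : Measure E} [μ.IsAddHaarMeasure]

/-- Translations are continuous in `L²`. -/
theorem tendsto_eLpNorm_translate_sub {g : E → ℝ} (hg : MemLp g 2 μ) :
    Filter.Tendsto (fun y => eLpNorm (fun x => g (x - y) - g x) 2 μ) (𝓝 0) (𝓝 0) := by
  have hmp : ∀ y : E, MeasurePreserving (fun x => x - y) μ μ := fun y =>
    measurePreserving_sub_right μ y
  let τ : E → C(E, E) := fun y => ⟨fun x => x - y, by fun_prop⟩
  have hτ : Continuous τ := by
    have : Continuous fun p : E × E => p.2 - p.1 := by fun_prop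
    exact (ContinuousMap.curry ⟨fun p : E × E => p.2 - p.1, this⟩).continuous
  have : Fact ((1 : ℝ≥0∞) ≤ 2) := ⟨one_le_two⟩
  have hcont : Continuous fun y => Lp.compMeasurePreserving (τ y) (hmp y) (hg.toLp g) :=
    Continuous.compMeasurePreservingLp continuous_const hτ hmp (by norm_num)
  have h0 := (hcont.tendsto 0)
  rw [tendsto_iff_edist_tendsto_0] at h0
  refine h0.congr fun y => ?_
  rw [Lp.edist_def]
  refine eLpNorm_congr_ae ?_
  have h1 : ∀ y, Lp.compMeasurePreserving (τ y) (hmp y) (hg.toLp g) =ᵐ[μ] fun x => g (x - y) := by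
    intro y
    refine (Lp.coeFn_compMeasurePreserving _ (hmp y)).trans ?_
    exact (hmp y).quasiMeasurePreserving.ae_eq_comp hg.coeFn_toLp
  filter_upwards [h1 y, h1 0] with x hx hx'
  rw [Pi.sub_apply, hx, hx', sub_zero]

/-- Jensen's inequality for the square and a density of total mass one. -/
theorem sq_lintegral_mul_le {X : Type*} [MeasurableSpace X] {ν : Measure X} {ρ f : X → ℝ≥0∞}
    (hρ : AEMeasurable ρ ν) (hf : AEMeasurable f ν) (h1 : ∫⁻ y, ρ y ∂ν = 1) :
    (∫⁻ y, ρ y * f y ∂ν) ^ 2 ≤ ∫⁻ y, ρ y * f y ^ 2 ∂ν := by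
  have h := ENNReal.lintegral_mul_le_Lp_mul_Lq ν (Real.HolderConjugate.two_two)
    (hρ.pow_const (1 / 2 : ℝ)) ((hρ.pow_const (1 / 2 : ℝ)).mul hf)
  have hhalf : ∀ a : ℝ≥0∞, a ^ (1 / 2 : ℝ) * a ^ (1 / 2 : ℝ) = a := fun a => by
    rw [← ENNReal.rpow_add_of_nonneg _ _ (by norm_num) (by norm_num)]; norm_num
  have hsq : ∀ a : ℝ≥0∞, (a ^ (1 / 2 : ℝ)) ^ (2 : ℝ) = a := fun a => by
    rw [← ENNReal.rpow_mul]; norm_num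
  simp only [Pi.mul_apply, ← mul_assoc, hhalf, hsq, h1, ENNReal.one_rpow, one_mul,
    ENNReal.mul_rpow_of_nonneg _ _ zero_le_two] at h
  calc (∫⁻ y, ρ y * f y ∂ν) ^ 2 ≤ ((∫⁻ y, ρ y * f y ^ (2 : ℝ) ∂ν) ^ (1 / 2 : ℝ)) ^ 2 := by
        gcongr
    _ = ∫⁻ y, ρ y * f y ^ (2 : ℝ) ∂ν := by
        rw [← ENNReal.rpow_two, hsq]
    _ = _ := by simp only [ENNReal.rpow_two]

theorem eLpNorm_two_sq {X : Type*} [MeasurableSpace X] {ν : Measure X} (f : X → ℝ) :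
    eLpNorm f 2 ν ^ 2 = ∫⁻ x, ‖f x‖ₑ ^ 2 ∂ν := by
  rw [eLpNorm_eq_lintegral_rpow_enorm_toReal (by norm_num) (by norm_num)]
  simp only [ENNReal.toReal_ofNat, ENNReal.rpow_ofNat]
  rw [← ENNReal.rpow_two, ← ENNReal.rpow_mul]
  norm_num

/-- The mollification error in `L²` is at most the largest `L²` translation error. -/
theorem eLpNorm_normed_convolution_sub_le {g : E → ℝ} (hg : MemLp g 2 μ)
    (φ : ContDiffBump (0 : E)) {ε : ℝ≥0∞}
    (hε : ∀ y ∈ Metric.ball (0 : E) φ.rOut, eLpNorm (fun x => g (x - y) - g x) 2 μ ≤ ε) :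
    eLpNorm (fun x => (φ.normed μ ⋆[ContinuousLinearMap.lsmul ℝ ℝ, μ] g) x - g x) 2 μ ≤ ε := by
  set ρ : E → ℝ≥0∞ := fun y => ENNReal.ofReal (φ.normed μ y) with hρ
  have hρm : Measurable ρ := φ.continuous_normed.measurable.ennreal_ofReal
  have hρ1 : ∫⁻ y, ρ y ∂μ = 1 := by
    rw [hρ, ← ofReal_integral_eq_lintegral_ofReal φ.integrable_normed
      (Filter.Eventually.of_forall φ.nonneg_normed), φ.integral_normed, ENNReal.ofReal_one]
  have hloc : LocallyIntegrable g μ := hg.locallyIntegrable one_le_two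
  have hm2 : AEStronglyMeasurable (fun p : E × E => g (p.1 - p.2) - g p.1) (μ.prod μ) :=
    (hg.1.comp_quasiMeasurePreserving (quasiMeasurePreserving_sub_of_right_invariant μ μ)).sub
      (hg.1.comp_quasiMeasurePreserving Measure.quasiMeasurePreserving_fst)
  have hpt : ∀ x, ‖(φ.normed μ ⋆[ContinuousLinearMap.lsmul ℝ ℝ, μ] g) x - g x‖ₑ ≤
      ∫⁻ y, ρ y * ‖g (x - y) - g x‖ₑ ∂μ := by
    intro x
    have hi1 : Integrable (fun y => φ.normed μ y * g (x - y)) μ :=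
      (φ.hasCompactSupport_normed.convolutionExists_left (ContinuousLinearMap.lsmul ℝ ℝ)
        φ.continuous_normed hloc x)
    have hi2 : Integrable (fun y => φ.normed μ y * g x) μ := φ.integrable_normed.mul_const _
    have e : (φ.normed μ ⋆[ContinuousLinearMap.lsmul ℝ ℝ, μ] g) x - g x =
        ∫ y, φ.normed μ y * (g (x - y) - g x) ∂μ := by
      simp only [mul_sub]
      rw [integral_sub hi1 hi2, integral_mul_const, φ.integral_normed, one_mul, convolution_def]
      rfl
    rw [e]
    refine (enorm_integral_le_lintegral_enorm _).trans (le_of_eq ?_)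
    refine lintegral_congr fun y => ?_
    rw [enorm_mul, Real.enorm_of_nonneg (φ.nonneg_normed y)]
  have hsq : eLpNorm (fun x => (φ.normed μ ⋆[ContinuousLinearMap.lsmul ℝ ℝ, μ] g) x - g x) 2 μ ^ 2
      ≤ ε ^ 2 := by
    rw [eLpNorm_two_sq]
    calc ∫⁻ x, ‖(φ.normed μ ⋆[ContinuousLinearMap.lsmul ℝ ℝ, μ] g) x - g x‖ₑ ^ 2 ∂μ
        ≤ ∫⁻ x, ∫⁻ y, ρ y * ‖g (x - y) - g x‖ₑ ^ 2 ∂μ ∂μ := by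
          have hae := hm2.prodMk_left
          refine lintegral_mono_ae ?_
          filter_upwards [hae] with x hx
          exact (pow_le_pow_left' (hpt x) 2).trans
            (sq_lintegral_mul_le hρm.aemeasurable hx.enorm hρ1)
      _ = ∫⁻ y, ∫⁻ x, ρ y * ‖g (x - y) - g x‖ₑ ^ 2 ∂μ ∂μ := by
          refine lintegral_lintegral_swap ?_
          exact (hρm.comp measurable_snd).aemeasurable.mul (hm2.enorm.pow_const 2)
      _ ≤ ∫⁻ y, ρ y * ε ^ 2 ∂μ := by
          refine lintegral_mono fun y => ?_
          by_cases hy : y ∈ Metric.ball (0 : E) φ.rOut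
          · rw [lintegral_const_mul' _ _ ENNReal.ofReal_ne_top, ← eLpNorm_two_sq]
            gcongr
            exact hε y hy
          · have : ρ y = 0 := by
              rw [← φ.support_normed_eq (μ := μ), Function.notMem_support] at hy
              simp [hρ, hy]
            simp [this]
      _ = ε ^ 2 := by rw [lintegral_mul_const _ hρm, hρ1, one_mul]
  exact (ENNReal.pow_le_pow_left_iff two_ne_zero).1 hsq

theorem tendsto_eLpNorm_normed_convolution_sub {g : E → ℝ} (hg : MemLp g 2 μ)
    {φ : ℕ → ContDiffBump (0 : E)} (hφ : Filter.Tendsto (fun n => (φ n).rOut) Filter.atTop (𝓝 0)) :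
    Filter.Tendsto (fun n => eLpNorm (fun x =>
      ((φ n).normed μ ⋆[ContinuousLinearMap.lsmul ℝ ℝ, μ] g) x - g x) 2 μ) Filter.atTop (𝓝 0) := by
  rw [ENNReal.tendsto_nhds_zero]
  intro ε hε
  have h := (ENNReal.tendsto_nhds_zero.1 (tendsto_eLpNorm_translate_sub hg)) ε hε
  obtain ⟨δ, hδ, hδ'⟩ := Metric.eventually_nhds_iff_ball.1 h
  filter_upwards [hφ.eventually_lt_const hδ] with n hn
  exact eLpNorm_normed_convolution_sub_le hg (φ n) fun y hy =>
    hδ' y (Metric.ball_subset_ball hn.le hy)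

end Mollification

/-! ### Smooth approximation of functions with weak derivatives -/

namespace L1Method

open scoped Topology Convolution

variable {d : ℕ} {Ω : Set (EuclideanSpace ℝ (Fin d))} {v : EuclideanSpace ℝ (Fin d) → ℝ}
  {g : Fin d → EuclideanSpace ℝ (Fin d) → ℝ}

/-- Smooth functions on the whole space that converge uniformly to the extension of `v` by zero,
and whose gradients converge to `g` in `L²` on the compact subsets of `Ω`. -/
structure IsSmoothApprox (Ω : Set (EuclideanSpace ℝ (Fin d))) (v : EuclideanSpace ℝ (Fin d) → ℝ)
    (g : Fin d → EuclideanSpace ℝ (Fin d) → ℝ) (w : ℕ → EuclideanSpace ℝ (Fin d) → ℝ) :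
    Prop where
  smooth : ∀ n, ContDiff ℝ ∞ (w n)
  unif : ∀ ε > 0, ∀ᶠ n in Filter.atTop, ∀ x, |w n x - Ω.indicator v x| ≤ ε
  grad : ∀ K, IsCompact K → K ⊆ Ω → ∀ k, Filter.Tendsto
    (fun n => eLpNorm (fun x => partialD k (w n) x - g k x) 2 (volume.restrict K))
    Filter.atTop (𝓝 0)

theorem continuous_indicator_of_frontier (hv : ContinuousOn v (closure Ω))
    (hv0 : ∀ x ∈ frontier Ω, v x = 0) : Continuous (Ω.indicator v) :=
  continuous_indicator hv0 hv

theorem hasCompactSupport_indicator (hΩb : Bornology.IsBounded Ω)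
    (v : EuclideanSpace ℝ (Fin d) → ℝ) : HasCompactSupport (Ω.indicator v) :=
  HasCompactSupport.intro hΩb.isCompact_closure fun _ hx =>
    Set.indicator_of_notMem (fun h => hx (subset_closure h)) _

/-- Where a mollification only sees points of `Ω`, its derivative is the mollification of the weak
derivative. -/
theorem partialD_convolution {k : Fin d} {gk : EuclideanSpace ℝ (Fin d) → ℝ}
    (hΩ : IsOpen Ω) (hc : Continuous (Ω.indicator v))
    (hg : IsWeakPartialL2Loc Ω k v gk) (φ : ContDiffBump (0 : EuclideanSpace ℝ (Fin d)))
    {K : Set (EuclideanSpace ℝ (Fin d))} (hK : K ⊆ Ω) {x : EuclideanSpace ℝ (Fin d)}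
    (hx : Metric.closedBall x φ.rOut ⊆ K) :
    partialD k (φ.normed volume ⋆[ContinuousLinearMap.lsmul ℝ ℝ, volume] (Ω.indicator v)) x =
      (φ.normed volume ⋆[ContinuousLinearMap.lsmul ℝ ℝ, volume] (K.indicator gk)) x := by
  set ρ := φ.normed (volume : Measure (EuclideanSpace ℝ (Fin d))) with hρ
  have hρs : ContDiff ℝ ∞ ρ := φ.contDiff_normed
  have hρd : Differentiable ℝ ρ := hρs.differentiable (by simp)
  have hder := (φ.hasCompactSupport_normed (μ := volume)).hasFDerivAt_convolution_left
    (ContinuousLinearMap.lsmul ℝ ℝ) (φ.contDiff_normed (n := 1)) hc.locallyIntegrable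
    (μ := (volume : Measure (EuclideanSpace ℝ (Fin d)))) x
  have hψd : ∀ z, HasFDerivAt (fun z => ρ (x - z)) (-(fderiv ℝ ρ (x - z))) z := by
    intro z
    have h1 := (hρd (x - z)).hasFDerivAt
    have h2 := h1.comp z ((hasFDerivAt_id z).const_sub x)
    convert! h2 using 1
    ext y
    simp
  have htest : IsTest Ω fun z => ρ (x - z) := by
    have hts : tsupport (fun z => ρ (x - z)) ⊆ Metric.closedBall x φ.rOut := by
      refine closure_minimal (fun z hz => ?_) Metric.isClosed_closedBall
      have : x - z ∈ Function.support ρ := hz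
      rw [hρ, φ.support_normed_eq, mem_ball_zero_iff] at this
      rw [Metric.mem_closedBall, dist_comm, dist_eq_norm]
      exact this.le
    exact ⟨hρs.comp (contDiff_const.sub contDiff_id),
      HasCompactSupport.intro (isCompact_closedBall x φ.rOut)
        fun z hz => by_contra fun h => hz (hts (subset_tsupport _ h)), hts.trans (hx.trans hK)⟩
  have hweak := hg.2 _ htest
  have hL : partialD k (ρ ⋆[ContinuousLinearMap.lsmul ℝ ℝ, volume] (Ω.indicator v)) x =
      -∫ z in Ω, v z * partialD k (fun z => ρ (x - z)) z := by
    unfold partialD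
    have hint := ((φ.hasCompactSupport_normed (μ := volume)).fderiv ℝ).convolutionExists_left
      ((ContinuousLinearMap.lsmul ℝ ℝ).precompL (EuclideanSpace ℝ (Fin d)))
      (hρs.continuous_fderiv (by simp)) hc.locallyIntegrable x (μ := volume)
    rw [hder.fderiv, convolution_eq_swap, ContinuousLinearMap.integral_apply hint.integrable_swap,
      ← integral_neg, ← integral_indicator hΩ.measurableSet]
    refine integral_congr_ae (Filter.Eventually.of_forall fun z => ?_)
    by_cases hz : z ∈ Ω
    · simp [hz, (hψd z).fderiv, mul_comm, ← hρ]
    · simp [hz]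
  rw [hL, hweak, neg_neg, convolution_eq_swap, ← integral_indicator hΩ.measurableSet]
  refine integral_congr_ae (Filter.Eventually.of_forall fun z => ?_)
  simp only [ContinuousLinearMap.lsmul_apply, smul_eq_mul]
  by_cases hz : z ∈ K
  · simp [hz, hK hz, mul_comm]
  · have : ρ (x - z) = 0 := by
      rw [← Function.notMem_support, hρ, φ.support_normed_eq, mem_ball_zero_iff]
      intro h
      refine hz (hx ?_)
      rw [Metric.mem_closedBall, dist_comm, dist_eq_norm]
      exact h.le
    simp [this]

/-- Mollification of the extension by zero provides a smooth approximation. -/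
theorem exists_isSmoothApprox (hΩ : IsOpen Ω) (hΩb : Bornology.IsBounded Ω)
    (hv : ContinuousOn v (closure Ω)) (hv0 : ∀ x ∈ frontier Ω, v x = 0)
    (hg : ∀ k, IsWeakPartialL2Loc Ω k v (g k)) : ∃ w, IsSmoothApprox Ω v g w := by
  have hc := continuous_indicator_of_frontier hv hv0
  have hu : UniformContinuous (Ω.indicator v) :=
    (hasCompactSupport_indicator hΩb v).uniformContinuous_of_continuous hc
  let φ : ℕ → ContDiffBump (0 : EuclideanSpace ℝ (Fin d)) := fun n =>
    ⟨1 / ((n : ℝ) + 2), 1 / ((n : ℝ) + 1), by positivity, by gcongr; norm_num⟩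
  have hφ : Filter.Tendsto (fun n => (φ n).rOut) Filter.atTop (𝓝 0) :=
    tendsto_one_div_add_atTop_nhds_zero_nat
  refine ⟨fun n => (φ n).normed volume ⋆[ContinuousLinearMap.lsmul ℝ ℝ, volume] (Ω.indicator v),
    ⟨fun n => (φ n).hasCompactSupport_normed.contDiff_convolution_left _ (φ n).contDiff_normed
      hc.locallyIntegrable, fun ε hε => ?_, fun K hK hKΩ k => ?_⟩⟩
  · obtain ⟨δ, hδ, hδ'⟩ := Metric.uniformContinuous_iff.1 hu ε hε
    filter_upwards [hφ.eventually_lt_const hδ] with n hn x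
    rw [← Real.dist_eq]
    refine (φ n).dist_normed_convolution_le hc.aestronglyMeasurable fun y hy => ?_
    exact (hδ' ((Metric.mem_ball.1 hy).trans hn)).le
  · obtain ⟨δ, hδ, hδ'⟩ := hK.exists_cthickening_subset_open hΩ hKΩ
    set K' := Metric.cthickening δ K with hK'
    have hK'c : IsCompact K' := hK.cthickening
    have hmem : MemLp (K'.indicator (g k)) 2 volume :=
      (memLp_indicator_iff_restrict hK'c.measurableSet).2 ((hg k).1 K' hK'c hδ')
    have ht := tendsto_eLpNorm_normed_convolution_sub hmem hφ
    refine tendsto_of_tendsto_of_tendsto_of_le_of_le' tendsto_const_nhds ht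
      (Filter.Eventually.of_forall fun n => zero_le) ?_
    filter_upwards [hφ.eventually_lt_const hδ] with n hn
    refine le_trans (le_of_eq ?_) (eLpNorm_mono_measure _ (Measure.restrict_le_self (s := K)))
    refine eLpNorm_congr_ae ?_
    filter_upwards [ae_restrict_mem hK.measurableSet] with x hx
    have hx' : Metric.closedBall x (φ n).rOut ⊆ K' :=
      (Metric.closedBall_subset_closedBall hn.le).trans (Metric.closedBall_subset_cthickening hx δ)
    rw [partialD_convolution hΩ hc (hg k) (φ n) hδ' hx', Set.indicator_of_mem
      (Metric.self_subset_cthickening K hx)]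

end L1Method

/-! ### Limits of integrals of products -/

section Limits

open scoped Topology

variable {X : Type*} [MeasurableSpace X] {ν : Measure X}

theorem tendsto_integral_mul_of_bounded {β : ℕ → X → ℝ} {β₀ h : X → ℝ} {C : ℝ}
    (hh : Integrable h ν) (hβ : ∀ n, AEStronglyMeasurable (β n) ν)
    (hC : ∀ᶠ n in Filter.atTop, ∀ᵐ x ∂ν, |β n x| ≤ C)
    (hlim : ∀ᵐ x ∂ν, Filter.Tendsto (fun n => β n x) Filter.atTop (𝓝 (β₀ x))) :
    Filter.Tendsto (fun n => ∫ x, β n x * h x ∂ν) Filter.atTop (𝓝 (∫ x, β₀ x * h x ∂ν)) := by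
  refine tendsto_integral_filter_of_dominated_convergence (fun x => C * |h x|)
    (Filter.Eventually.of_forall fun n => (hβ n).mul hh.1) ?_ (hh.abs.const_mul C) ?_
  · filter_upwards [hC] with n hn
    filter_upwards [hn] with x hx
    rw [Real.norm_eq_abs, abs_mul]
    gcongr
  · filter_upwards [hlim] with x hx using hx.mul_const _

/-- Products of a bounded, pointwise convergent factor, a fixed `L²` factor and a factor that
converges in `L²` have convergent integrals. -/
theorem tendsto_integral_mul_mul_of_L2 {β P : ℕ → X → ℝ} {β₀ h P₀ : X → ℝ} {C : ℝ}
    (hh : MemLp h 2 ν) (hP₀ : MemLp P₀ 2 ν) (hPm : ∀ n, AEStronglyMeasurable (P n) ν)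
    (hP : Filter.Tendsto (fun n => eLpNorm (fun x => P n x - P₀ x) 2 ν) Filter.atTop (𝓝 0))
    (hβ : ∀ n, AEStronglyMeasurable (β n) ν)
    (hC : ∀ᶠ n in Filter.atTop, ∀ᵐ x ∂ν, |β n x| ≤ C)
    (hlim : ∀ᵐ x ∂ν, Filter.Tendsto (fun n => β n x) Filter.atTop (𝓝 (β₀ x))) :
    Filter.Tendsto (fun n => ∫ x, β n x * (h x * P n x) ∂ν) Filter.atTop
      (𝓝 (∫ x, β₀ x * (h x * P₀ x) ∂ν)) := by
  have hi0 : Integrable (fun x => h x * P₀ x) ν := hh.integrable_mul hP₀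
  have h1 := tendsto_integral_mul_of_bounded hi0 hβ hC hlim
  have hfin : ∀ᶠ n in Filter.atTop, eLpNorm (fun x => P n x - P₀ x) 2 ν < ⊤ :=
    hP.eventually_lt_const ENNReal.zero_lt_top
  have h2 : Filter.Tendsto (fun n => ∫ x, β n x * (h x * (P n x - P₀ x)) ∂ν) Filter.atTop
      (𝓝 0) := by
    rw [tendsto_zero_iff_norm_tendsto_zero]
    have h3 : Filter.Tendsto (fun n => ENNReal.toReal
        (ENNReal.ofReal C * (eLpNorm h 2 ν * eLpNorm (fun x => P n x - P₀ x) 2 ν)))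
        Filter.atTop (𝓝 0) := by
      have h4 : Filter.Tendsto (fun n =>
          ENNReal.ofReal C * (eLpNorm h 2 ν * eLpNorm (fun x => P n x - P₀ x) 2 ν))
          Filter.atTop (𝓝 (ENNReal.ofReal C * (eLpNorm h 2 ν * 0))) :=
        ENNReal.Tendsto.const_mul (ENNReal.Tendsto.const_mul hP (Or.inr hh.2.ne))
          (Or.inr ENNReal.ofReal_ne_top)
      rw [mul_zero, mul_zero] at h4
      exact (ENNReal.tendsto_toReal ENNReal.zero_ne_top).comp h4
    refine tendsto_of_tendsto_of_tendsto_of_le_of_le' tendsto_const_nhds h3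
      (Filter.Eventually.of_forall fun n => norm_nonneg _) ?_
    filter_upwards [hC, hfin] with n hn hf
    have hm : AEStronglyMeasurable (fun x => P n x - P₀ x) ν := (hPm n).sub hP₀.1
    rw [← toReal_enorm]
    refine ENNReal.toReal_mono (ENNReal.mul_ne_top ENNReal.ofReal_ne_top
      (ENNReal.mul_ne_top hh.2.ne hf.ne)) ?_
    refine (enorm_integral_le_lintegral_enorm _).trans ?_
    have h5 : eLpNorm (fun x => h x * (P n x - P₀ x)) 1 ν ≤
        eLpNorm h 2 ν * eLpNorm (fun x => P n x - P₀ x) 2 ν := by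
      have := eLpNorm_smul_le_mul_eLpNorm (p := 2) (q := 2) (r := 1) hm hh.1
      exact this
    rw [eLpNorm_one_eq_lintegral_enorm] at h5
    refine le_trans ?_ (mul_le_mul_right h5 _)
    rw [← lintegral_const_mul' _ _ ENNReal.ofReal_ne_top]
    refine lintegral_mono_ae ?_
    filter_upwards [hn] with x hx
    rw [enorm_mul]
    gcongr
    rw [Real.enorm_eq_ofReal_abs]
    exact ENNReal.ofReal_le_ofReal hx
  have h6 := h1.add h2
  rw [add_zero] at h6
  refine h6.congr' ?_
  filter_upwards [hC, hfin] with n hn hf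
  have hm : MemLp (fun x => P n x - P₀ x) 2 ν := ⟨(hPm n).sub hP₀.1, hf⟩
  have hbd : ∀ q : X → ℝ, Integrable q ν → Integrable (fun x => β n x * q x) ν := fun q hq =>
    hq.bdd_mul (hβ n) hn
  have him : Integrable (fun x => h x * (P n x - P₀ x)) ν := hh.integrable_mul hm
  rw [← integral_add (hbd _ hi0) (hbd _ him)]
  refine integral_congr_ae (Filter.Eventually.of_forall fun x => ?_)
  simp only
  ring

end Limits

/-! ### Testing the equation with functions of the solution -/

namespace L1Method

open scoped Topology

variable {d : ℕ} {Ω : Set (EuclideanSpace ℝ (Fin d))} {v F : EuclideanSpace ℝ (Fin d) → ℝ}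
  {g : Fin d → EuclideanSpace ℝ (Fin d) → ℝ} {w : ℕ → EuclideanSpace ℝ (Fin d) → ℝ}
  {L : Coeffs d} {η : ℝ} {H : ℝ → ℝ}

theorem memLp_restrict_of_continuousOn {K : Set (EuclideanSpace ℝ (Fin d))} (hK : IsCompact K)
    {f : EuclideanSpace ℝ (Fin d) → ℝ} (hf : ContinuousOn f K) (p : ℝ≥0∞) :
    MemLp f p (volume.restrict K) := by
  have : IsFiniteMeasure (volume.restrict K) := ⟨by simpa using hK.measure_lt_top⟩
  obtain ⟨C, hC⟩ := hK.exists_bound_of_continuousOn hf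
  refine MemLp.of_bound (hf.aestronglyMeasurable hK.measurableSet) C ?_
  filter_upwards [ae_restrict_mem hK.measurableSet] with x hx using hC x hx

/-- A superlevel set of `|v|`, as a subset of `Ω`. -/
def superlevel (Ω : Set (EuclideanSpace ℝ (Fin d))) (v : EuclideanSpace ℝ (Fin d) → ℝ) (η : ℝ) :
    Set (EuclideanSpace ℝ (Fin d)) := {x | η ≤ |Ω.indicator v x|}

theorem superlevel_subset (hη : 0 < η) : superlevel Ω v η ⊆ Ω := by
  intro x hx
  by_contra h
  rw [superlevel, Set.mem_ofPred_eq, Set.indicator_of_notMem h, abs_zero] at hx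
  linarith

theorem isCompact_superlevel (hΩb : Bornology.IsBounded Ω) (hc : Continuous (Ω.indicator v))
    (hη : 0 < η) : IsCompact (superlevel Ω v η) :=
  Metric.isCompact_of_isClosed_isBounded (isClosed_le continuous_const hc.abs)
    (hΩb.subset (superlevel_subset hη))

theorem IsSmoothApprox.tendsto (hw : IsSmoothApprox Ω v g w) (x : EuclideanSpace ℝ (Fin d)) :
    Filter.Tendsto (fun n => w n x) Filter.atTop (𝓝 (Ω.indicator v x)) := by
  rw [Metric.tendsto_nhds]
  intro ε hε
  filter_upwards [hw.unif (ε / 2) (by positivity)] with n hn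
  rw [Real.dist_eq]
  linarith [hn x]

theorem IsSmoothApprox.eventually_bounded (hw : IsSmoothApprox Ω v g w)
    (hΩb : Bornology.IsBounded Ω) (hc : Continuous (Ω.indicator v)) {φ : ℝ → ℝ}
    (hφ : Continuous φ) : ∃ C, ∀ᶠ n in Filter.atTop, ∀ x, |φ (w n x)| ≤ C := by
  obtain ⟨R, hR⟩ := (hasCompactSupport_indicator hΩb v).exists_bound_of_continuous hc
  obtain ⟨C, hC⟩ := (isCompact_Icc (a := -(R + 1)) (b := R + 1)).exists_bound_of_continuousOn
    hφ.continuousOn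
  refine ⟨C, ?_⟩
  filter_upwards [hw.unif 1 one_pos] with n hn x
  refine hC _ ?_
  have h1 := abs_le.1 (hn x)
  have h2 := abs_le.1 (hR x)
  constructor <;> linarith [h1.1, h1.2, h2.1, h2.2]

/-- Functions of the approximations that vanish near zero are eventually supported in a fixed
compact subset of `Ω`. -/
theorem IsSmoothApprox.eventually_zero (hw : IsSmoothApprox Ω v g w) (hη : 0 < η)
    (hH0 : ∀ s, |s| ≤ η → H s = 0) : ∀ᶠ n in Filter.atTop, ∀ x ∉ superlevel Ω v (η / 2),
      H (w n x) = 0 ∧ deriv H (w n x) = 0 := by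
  filter_upwards [hw.unif (η / 4) (by positivity)] with n hn x hx
  rw [superlevel, Set.mem_ofPred_eq, not_le] at hx
  have h1 : |w n x| < η := by
    have h1 := abs_le.1 (hn x)
    have h2 := abs_lt.1 hx
    rw [abs_lt]
    constructor <;> linarith [h1.1, h1.2, h2.1, h2.2]
  refine ⟨hH0 _ h1.le, ?_⟩
  have h2 : H =ᶠ[𝓝 (w n x)] fun _ => 0 := by
    filter_upwards [(continuous_abs.isOpen_preimage _ isOpen_Iio).mem_nhds
      (show w n x ∈ abs ⁻¹' Set.Iio η from h1)] with s hs
    exact hH0 s (le_of_lt hs)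
  rw [h2.deriv_eq, deriv_const]

theorem isTest_comp (hK : IsCompact (superlevel Ω v (η / 2))) (hη : 0 < η)
    {φ : EuclideanSpace ℝ (Fin d) → ℝ} (hH : ContDiff ℝ ∞ H) (hφ : ContDiff ℝ ∞ φ)
    (h0 : ∀ x ∉ superlevel Ω v (η / 2), H (φ x) = 0) : IsTest Ω fun x => H (φ x) := by
  have hts : tsupport (fun x => H (φ x)) ⊆ superlevel Ω v (η / 2) :=
    closure_minimal (fun x hx => by_contra fun h => hx (h0 x h)) hK.isClosed
  exact ⟨hH.comp hφ, HasCompactSupport.intro hK h0,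
    hts.trans (superlevel_subset (by positivity))⟩

theorem partialD_comp {φ : EuclideanSpace ℝ (Fin d) → ℝ} {x : EuclideanSpace ℝ (Fin d)} {h' : ℝ}
    (hH : HasDerivAt H h' (φ x)) (hφ : DifferentiableAt ℝ φ x) (k : Fin d) :
    partialD k (fun x => H (φ x)) x = h' * partialD k φ x := by
  have := hH.comp_hasFDerivAt x hφ.hasFDerivAt
  unfold partialD
  rw [show (fun x => H (φ x)) = H ∘ φ from rfl, this.fderiv]
  simp

theorem continuous_partialD {φ : EuclideanSpace ℝ (Fin d) → ℝ} (hφ : ContDiff ℝ ∞ φ) (k : Fin d) :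
    Continuous (partialD k φ) :=
  (hφ.continuous_fderiv (by simp)).clm_apply continuous_const

theorem setIntegral_superlevel (hΩ : IsOpen Ω) (hη : 0 < η)
    {f : EuclideanSpace ℝ (Fin d) → ℝ} (h0 : ∀ x ∈ Ω \ superlevel Ω v η, f x = 0) :
    ∫ x in Ω, f x = ∫ x in superlevel Ω v η, f x :=
  setIntegral_eq_of_subset_of_forall_sdiff_eq_zero hΩ.measurableSet (superlevel_subset hη) h0

/-- The weak formulation holds for the test function `H(v)` whenever the smooth function `H`
vanishes near zero. -/
theorem integral_test (hΩ : IsOpen Ω) (hΩb : Bornology.IsBounded Ω) (hL : L.Admissible Ω)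
    (hv : ContinuousOn v (closure Ω)) (hv0 : ∀ x ∈ frontier Ω, v x = 0)
    (hF : LocallyIntegrableOn F Ω) (hg : ∀ k, IsWeakPartialL2Loc Ω k v (g k))
    (heq : ∀ φ, IsTest Ω φ →
      ∫ x in Ω, ((∑ k, (L.a k x * g k x * partialD k φ x + L.b k x * g k x * φ x))
        + L.c x * v x * φ x) = ∫ x in Ω, F x * φ x)
    (hη : 0 < η) (hH : ContDiff ℝ ∞ H) (hH0 : ∀ s, |s| ≤ η → H s = 0) :
    (∀ k, IntegrableOn (fun x => deriv H (v x) * (L.a k x * g k x * g k x)) Ω) ∧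
    (∀ k, IntegrableOn (fun x => H (v x) * (L.b k x * g k x)) Ω) ∧
    IntegrableOn (fun x => H (v x) * (L.c x * v x)) Ω ∧
    IntegrableOn (fun x => H (v x) * F x) Ω ∧
    (∑ k, ((∫ x in Ω, deriv H (v x) * (L.a k x * g k x * g k x))
        + ∫ x in Ω, H (v x) * (L.b k x * g k x)))
      + ∫ x in Ω, H (v x) * (L.c x * v x) = ∫ x in Ω, H (v x) * F x := by
  have hc := continuous_indicator_of_frontier hv hv0
  obtain ⟨w, hw⟩ := exists_isSmoothApprox hΩ hΩb hv hv0 hg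
  have hη2 : 0 < η / 2 := by positivity
  set K := superlevel Ω v (η / 2) with hK
  have hKΩ : K ⊆ Ω := superlevel_subset hη2
  have hKc : IsCompact K := isCompact_superlevel hΩb hc hη2
  have hKm := hKc.measurableSet
  have hKcl : K ⊆ closure Ω := hKΩ.trans subset_closure
  have hdH : Continuous (deriv H) := hH.continuous_deriv (by simp)
  have hgK : ∀ k, MemLp (g k) 2 (volume.restrict K) := fun k => (hg k).1 K hKc hKΩ
  have hagK : ∀ k, MemLp (fun x => L.a k x * g k x) 2 (volume.restrict K) := fun k =>
    (hgK k).mul (memLp_restrict_of_continuousOn hKc ((hL.a_cont k).mono hKcl) ⊤)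
  have hbgK : ∀ k, IntegrableOn (fun x => L.b k x * g k x) K := fun k =>
    (memLp_restrict_of_continuousOn hKc ((hL.b_cont k).mono hKcl) 2).integrable_mul (hgK k)
  have hcvK : IntegrableOn (fun x => L.c x * v x) K :=
    ((hL.c_cont.mono hKcl).mul (hv.mono hKcl)).integrableOn_compact hKc
  have hFK : IntegrableOn F K := hF.integrableOn_compact_subset hKΩ hKc
  have hvK : ∀ x ∈ K, Ω.indicator v x = v x := fun x hx => Set.indicator_of_mem (hKΩ hx) v
  obtain ⟨C₀, hC₀⟩ := hw.eventually_bounded hΩb hc hH.continuous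
  obtain ⟨C₁, hC₁⟩ := hw.eventually_bounded hΩb hc hdH
  have hzero := hw.eventually_zero hη hH0
  have hz : ∀ x ∈ Ω \ K, H (v x) = 0 ∧ deriv H (v x) = 0 := by
    rintro x ⟨hx, hxK⟩
    rw [hK, superlevel, Set.mem_ofPred_eq, not_le, Set.indicator_of_mem hx] at hxK
    refine ⟨hH0 _ (by linarith), ?_⟩
    have h2 : H =ᶠ[𝓝 (v x)] fun _ => 0 := by
      filter_upwards [(continuous_abs.isOpen_preimage _ isOpen_Iio).mem_nhds
        (show v x ∈ abs ⁻¹' Set.Iio η from by simp only [Set.mem_preimage, Set.mem_Iio]; linarith)]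
        with s hs
      exact hH0 s (le_of_lt hs)
    rw [h2.deriv_eq, deriv_const]
  have hlim : ∀ {φ : ℝ → ℝ}, Continuous φ → ∀ᵐ x ∂(volume.restrict K),
      Filter.Tendsto (fun n => φ (w n x)) Filter.atTop (𝓝 (φ (v x))) := by
    intro φ hφ
    filter_upwards [ae_restrict_mem hKm] with x hx
    rw [← hvK x hx]
    exact (hφ.tendsto _).comp (hw.tendsto x)
  have hmeas : ∀ {φ : ℝ → ℝ}, Continuous φ → ∀ n,
      AEStronglyMeasurable (fun x => φ (w n x)) (volume.restrict K) := fun hφ n =>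
    (hφ.comp (hw.smooth n).continuous).aestronglyMeasurable
  have hC₀' : ∀ᶠ n in Filter.atTop, ∀ᵐ x ∂(volume.restrict K), |H (w n x)| ≤ C₀ := by
    filter_upwards [hC₀] with n hn using Filter.Eventually.of_forall hn
  have hC₁' : ∀ᶠ n in Filter.atTop, ∀ᵐ x ∂(volume.restrict K), |deriv H (w n x)| ≤ C₁ := by
    filter_upwards [hC₁] with n hn using Filter.Eventually.of_forall hn
  have hPm : ∀ k n, AEStronglyMeasurable (partialD k (w n)) (volume.restrict K) := fun k n =>
    (continuous_partialD (hw.smooth n) k).aestronglyMeasurable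
  -- the limits of the terms of the weak formulation
  have lim_a : ∀ k, Filter.Tendsto (fun n => ∫ x in K, deriv H (w n x) *
      (L.a k x * g k x * partialD k (w n) x)) Filter.atTop
      (𝓝 (∫ x in K, deriv H (v x) * (L.a k x * g k x * g k x))) := fun k =>
    tendsto_integral_mul_mul_of_L2 (hagK k) (hgK k) (hPm k) (hw.grad K hKc hKΩ k) (hmeas hdH)
      hC₁' (hlim hdH)
  have lim_b : ∀ k, Filter.Tendsto (fun n => ∫ x in K, H (w n x) * (L.b k x * g k x)) Filter.atTop
      (𝓝 (∫ x in K, H (v x) * (L.b k x * g k x))) := fun k =>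
    tendsto_integral_mul_of_bounded (hbgK k) (hmeas hH.continuous) hC₀' (hlim hH.continuous)
  have lim_c : Filter.Tendsto (fun n => ∫ x in K, H (w n x) * (L.c x * v x)) Filter.atTop
      (𝓝 (∫ x in K, H (v x) * (L.c x * v x))) :=
    tendsto_integral_mul_of_bounded hcvK (hmeas hH.continuous) hC₀' (hlim hH.continuous)
  have lim_F : Filter.Tendsto (fun n => ∫ x in K, H (w n x) * F x) Filter.atTop
      (𝓝 (∫ x in K, H (v x) * F x)) :=
    tendsto_integral_mul_of_bounded hFK (hmeas hH.continuous) hC₀' (hlim hH.continuous)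
  have hcontHv : ∀ {φ : ℝ → ℝ}, Continuous φ → ContinuousOn (fun x => φ (v x)) K :=
    fun hφ => hφ.comp_continuousOn (hv.mono hKcl)
  refine ⟨fun k => ?_, fun k => ?_, ?_, ?_, ?_⟩
  · refine IntegrableOn.of_forall_sdiff_eq_zero (s := K) ?_ hΩ.measurableSet fun x hx => by
      simp [(hz x hx).2]
    exact IntegrableOn.continuousOn_mul (hcontHv hdH) ((hagK k).integrable_mul (hgK k)) hKc
  · refine IntegrableOn.of_forall_sdiff_eq_zero (s := K) ?_ hΩ.measurableSet fun x hx => by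
      simp [(hz x hx).1]
    exact IntegrableOn.continuousOn_mul (hcontHv hH.continuous) (hbgK k) hKc
  · refine IntegrableOn.of_forall_sdiff_eq_zero (s := K) ?_ hΩ.measurableSet fun x hx => by
      simp [(hz x hx).1]
    exact IntegrableOn.continuousOn_mul (hcontHv hH.continuous) hcvK hKc
  · refine IntegrableOn.of_forall_sdiff_eq_zero (s := K) ?_ hΩ.measurableSet fun x hx => by
      simp [(hz x hx).1]
    exact IntegrableOn.continuousOn_mul (hcontHv hH.continuous) hFK hKc
  · rw [setIntegral_superlevel hΩ hη2 (f := fun x => H (v x) * (L.c x * v x))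
        (fun x hx => by simp [(hz x hx).1]),
      setIntegral_superlevel hΩ hη2 (f := fun x => H (v x) * F x)
        (fun x hx => by simp [(hz x hx).1])]
    have hsum : ∑ k, ((∫ x in Ω, deriv H (v x) * (L.a k x * g k x * g k x))
        + ∫ x in Ω, H (v x) * (L.b k x * g k x)) =
        ∑ k, ((∫ x in K, deriv H (v x) * (L.a k x * g k x * g k x))
        + ∫ x in K, H (v x) * (L.b k x * g k x)) := by
      refine Finset.sum_congr rfl fun k _ => ?_
      rw [setIntegral_superlevel hΩ hη2
          (f := fun x => deriv H (v x) * (L.a k x * g k x * g k x))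
          (fun x hx => by simp [(hz x hx).2]),
        setIntegral_superlevel hΩ hη2 (f := fun x => H (v x) * (L.b k x * g k x))
          (fun x hx => by simp [(hz x hx).1])]
    rw [hsum]
    refine tendsto_nhds_unique ((tendsto_finsetSum _ fun k _ =>
      (lim_a k).add (lim_b k)).add lim_c) (lim_F.congr' ?_)
    filter_upwards [hzero] with n hn
    have htest := isTest_comp hKc hη hH (hw.smooth n) fun x hx => (hn x hx).1
    have hpd : ∀ k x, partialD k (fun x => H (w n x)) x = deriv H (w n x) * partialD k (w n) x :=
      fun k x => partialD_comp (hH.differentiable (by simp) _).hasDerivAt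
        ((hw.smooth n).differentiable (by simp) _) k
    have h1 := heq _ htest
    simp only [hpd] at h1
    rw [setIntegral_superlevel (v := v) hΩ hη2
        (fun x hx => by simp [(hn x hx.2).1, (hn x hx.2).2]),
      setIntegral_superlevel (v := v) (f := fun x => F x * H (w n x)) hΩ hη2
        (fun x hx => by simp [(hn x hx.2).1])] at h1
    have hcw : ∀ {φ : ℝ → ℝ}, Continuous φ → ContinuousOn (fun x => φ (w n x)) K :=
      fun hφ => (hφ.comp (hw.smooth n).continuous).continuousOn
    have ia : ∀ k, IntegrableOn (fun x => deriv H (w n x) *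
        (L.a k x * g k x * partialD k (w n) x)) K := fun k =>
      IntegrableOn.continuousOn_mul (hcw hdH) ((hagK k).integrable_mul
        (memLp_restrict_of_continuousOn hKc
          (continuous_partialD (hw.smooth n) k).continuousOn 2)) hKc
    have ib : ∀ k, IntegrableOn (fun x => H (w n x) * (L.b k x * g k x)) K := fun k =>
      IntegrableOn.continuousOn_mul (hcw hH.continuous) (hbgK k) hKc
    have ic : IntegrableOn (fun x => H (w n x) * (L.c x * v x)) K :=
      IntegrableOn.continuousOn_mul (hcw hH.continuous) hcvK hKc
    have e1 : ∫ x in K, H (w n x) * F x = ∫ x in K, F x * H (w n x) :=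
      integral_congr_ae (Filter.Eventually.of_forall fun x => mul_comm _ _)
    rw [e1, ← h1]
    have e2 : ∀ k, ((∫ x in K, deriv H (w n x) * (L.a k x * g k x * partialD k (w n) x))
        + ∫ x in K, H (w n x) * (L.b k x * g k x)) =
        ∫ x in K, (deriv H (w n x) * (L.a k x * g k x * partialD k (w n) x)
          + H (w n x) * (L.b k x * g k x)) := fun k => (integral_add (ia k) (ib k)).symm
    simp only [e2]
    have iab : ∀ k, IntegrableOn (fun x => deriv H (w n x) *
        (L.a k x * g k x * partialD k (w n) x) + H (w n x) * (L.b k x * g k x)) K :=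
      fun k => (ia k).add (ib k)
    rw [← integral_finsetSum _ fun k _ => iab k,
      ← integral_add (integrable_finsetSum _ fun k _ => iab k) ic]
    refine integral_congr_ae (Filter.Eventually.of_forall fun x => ?_)
    simp only
    congr 1
    · exact Finset.sum_congr rfl fun k _ => by ring
    · ring

/-- Integration by parts for the convection term: `H(v) ∂_k v` is the derivative of a
primitive of `H` at `v`. -/
theorem integral_convection (hΩ : IsOpen Ω) (hΩb : Bornology.IsBounded Ω)
    (hv : ContinuousOn v (closure Ω)) (hv0 : ∀ x ∈ frontier Ω, v x = 0)
    (hg : ∀ k, IsWeakPartialL2Loc Ω k v (g k)) {b : EuclideanSpace ℝ (Fin d) → ℝ}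
    (hb : ContDiffOn ℝ 1 b Ω) (k : Fin d)
    (hη : 0 < η) (hH : Continuous H) (hH0 : ∀ s, |s| ≤ η → H s = 0) {P : ℝ → ℝ}
    (hP : ∀ s, HasDerivAt P (H s) s) (hP0 : ∀ s, |s| ≤ η → P s = 0) :
    IntegrableOn (fun x => P (v x) * partialD k b x) Ω ∧
    ∫ x in Ω, H (v x) * (b x * g k x) = -∫ x in Ω, P (v x) * partialD k b x := by
  have hc := continuous_indicator_of_frontier hv hv0
  obtain ⟨w, hw⟩ := exists_isSmoothApprox hΩ hΩb hv hv0 hg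
  have hη2 : 0 < η / 2 := by positivity
  set K := superlevel Ω v (η / 2) with hK
  have hKΩ : K ⊆ Ω := superlevel_subset hη2
  have hKc : IsCompact K := isCompact_superlevel hΩb hc hη2
  have hKm := hKc.measurableSet
  have hKcl : K ⊆ closure Ω := hKΩ.trans subset_closure
  have hPc : Continuous P := continuous_iff_continuousAt.2 fun s => (hP s).continuousAt
  have hvK : ∀ x ∈ K, Ω.indicator v x = v x := fun x hx => Set.indicator_of_mem (hKΩ hx) v
  have hbd : ∀ x ∈ Ω, DifferentiableAt ℝ b x := fun x hx =>
    (hb.differentiableOn one_ne_zero).differentiableAt (hΩ.mem_nhds hx)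
  have hbK : ContinuousOn b K := hb.continuousOn.mono hKΩ
  have hdbK : ContinuousOn (partialD k b) K :=
    ((hb.continuousOn_fderiv_of_isOpen hΩ le_rfl).mono hKΩ).clm_apply continuousOn_const
  obtain ⟨C₀, hC₀⟩ := hw.eventually_bounded hΩb hc hH
  obtain ⟨C₁, hC₁⟩ := hw.eventually_bounded hΩb hc hPc
  have hz : ∀ x ∈ Ω \ K, H (v x) = 0 ∧ P (v x) = 0 := by
    rintro x ⟨hx, hxK⟩
    rw [hK, superlevel, Set.mem_ofPred_eq, not_le, Set.indicator_of_mem hx] at hxK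
    exact ⟨hH0 _ (by linarith), hP0 _ (by linarith)⟩
  have hlim : ∀ {φ : ℝ → ℝ}, Continuous φ → ∀ᵐ x ∂(volume.restrict K),
      Filter.Tendsto (fun n => φ (w n x)) Filter.atTop (𝓝 (φ (v x))) := by
    intro φ hφ
    filter_upwards [ae_restrict_mem hKm] with x hx
    rw [← hvK x hx]
    exact (hφ.tendsto _).comp (hw.tendsto x)
  have hmeas : ∀ {φ : ℝ → ℝ}, Continuous φ → ∀ n,
      AEStronglyMeasurable (fun x => φ (w n x)) (volume.restrict K) := fun hφ n =>
    (hφ.comp (hw.smooth n).continuous).aestronglyMeasurable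
  have lim_l : Filter.Tendsto (fun n => ∫ x in K, H (w n x) * (b x * partialD k (w n) x))
      Filter.atTop (𝓝 (∫ x in K, H (v x) * (b x * g k x))) :=
    tendsto_integral_mul_mul_of_L2 (memLp_restrict_of_continuousOn hKc hbK 2)
      ((hg k).1 K hKc hKΩ)
      (fun n => (continuous_partialD (hw.smooth n) k).aestronglyMeasurable)
      (hw.grad K hKc hKΩ k) (hmeas hH)
      (by filter_upwards [hC₀] with n hn using Filter.Eventually.of_forall hn) (hlim hH)
  have lim_r : Filter.Tendsto (fun n => ∫ x in K, P (w n x) * partialD k b x)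
      Filter.atTop (𝓝 (∫ x in K, P (v x) * partialD k b x)) :=
    tendsto_integral_mul_of_bounded (hdbK.integrableOn_compact hKc) (hmeas hPc)
      (by filter_upwards [hC₁] with n hn using Filter.Eventually.of_forall hn) (hlim hPc)
  constructor
  · refine IntegrableOn.of_forall_sdiff_eq_zero (s := K) ?_ hΩ.measurableSet fun x hx => by
      simp [(hz x hx).2]
    exact ((hPc.comp_continuousOn (hv.mono hKcl)).mul hdbK).integrableOn_compact hKc
  rw [setIntegral_superlevel hΩ hη2 (f := fun x => H (v x) * (b x * g k x))
      (fun x hx => by simp [(hz x hx).1]),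
    setIntegral_superlevel hΩ hη2 (f := fun x => P (v x) * partialD k b x)
      (fun x hx => by simp [(hz x hx).2])]
  refine tendsto_nhds_unique lim_l (lim_r.neg.congr' ?_)
  filter_upwards [hw.eventually_zero hη hH0, hw.eventually_zero hη hP0] with n hn hn'
  have hwd : Differentiable ℝ (w n) := (hw.smooth n).differentiable (by simp)
  have hpd : ∀ x, partialD k (fun x => P (w n x)) x = H (w n x) * partialD k (w n) x :=
    fun x => partialD_comp (hP _) (hwd x) k
  have hts : tsupport (fun x => P (w n x)) ⊆ K :=
    closure_minimal (fun x hx => by_contra fun h => hx (hn' x h).1) hKc.isClosed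
  have hcw : ∀ {φ : ℝ → ℝ}, Continuous φ → ContinuousOn (fun x => φ (w n x)) K :=
    fun hφ => (hφ.comp (hw.smooth n).continuous).continuousOn
  have full : ∀ {f : EuclideanSpace ℝ (Fin d) → ℝ}, (∀ x ∉ K, f x = 0) → ContinuousOn f K →
      Integrable f ∧ ∫ x, f x = ∫ x in K, f x := by
    intro f hf0 hfc
    refine ⟨(integrableOn_iff_integrable_of_support_subset
      fun x hx => by_contra fun h => hx (hf0 x h)).1 (hfc.integrableOn_compact hKc),
      (setIntegral_eq_integral_of_forall_compl_eq_zero hf0).symm⟩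
  have f1 := full (f := fun x => partialD k b x * P (w n x))
    (fun x hx => by simp [(hn' x hx).1]) (hdbK.mul (hcw hPc))
  have f2 := full (f := fun x => b x * partialD k (fun x => P (w n x)) x)
    (fun x hx => by simp [hpd, (hn x hx).1]) (by
      simp only [hpd]
      exact hbK.mul ((hcw hH).mul (continuous_partialD (hw.smooth n) k).continuousOn))
  have f3 := full (f := fun x => b x * P (w n x))
    (fun x hx => by simp [(hn' x hx).1]) (hbK.mul (hcw hPc))
  have hparts := integral_mul_fderiv_eq_neg_fderiv_mul_of_integrable
    (f := b) (g := fun x => P (w n x)) (v := EuclideanSpace.single k 1) (μ := volume)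
    f1.1 f2.1 f3.1 (fun x hx => hbd x (hKΩ (hts hx)))
    (fun x _ => ((hP _).differentiableAt.comp x (hwd x) : DifferentiableAt ℝ (P ∘ w n) x))
  have hparts' : ∫ x, b x * partialD k (fun x => P (w n x)) x =
      -∫ x, partialD k b x * P (w n x) := hparts
  rw [f2.2, f1.2] at hparts'
  have e1 : ∫ x in K, P (w n x) * partialD k b x = ∫ x in K, partialD k b x * P (w n x) :=
    integral_congr_ae (Filter.Eventually.of_forall fun x => mul_comm _ _)
  rw [e1, ← hparts']
  refine integral_congr_ae (Filter.Eventually.of_forall fun x => ?_)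
  simp only [hpd]
  ring

end L1Method

/-! ### Stability of the elliptic problem in `L²` and `L^∞` -/

/-- A smooth nondecreasing approximation of the identity on `ℝ`, within `2 ε` of it, that vanishes
on `[-ε, ε]`. -/
noncomputable def smoothTrunc (ε s : ℝ) : ℝ := s * Real.smoothTransition (s ^ 2 / ε ^ 2 - 1)

section SmoothTrunc

variable {ε : ℝ}

theorem contDiff_smoothTrunc (ε : ℝ) : ContDiff ℝ ∞ (smoothTrunc ε) :=
  contDiff_id.mul (Real.smoothTransition.contDiff.comp
    (((contDiff_id.pow 2).div_const _).sub contDiff_const))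

theorem smoothTrunc_eq_zero (hε : 0 < ε) {s : ℝ} (hs : |s| ≤ ε) : smoothTrunc ε s = 0 := by
  have h1 : s ^ 2 ≤ ε ^ 2 := sq_le_sq.2 (by rwa [abs_of_pos hε])
  rw [smoothTrunc, Real.smoothTransition.zero_of_nonpos, mul_zero]
  rw [sub_nonpos, div_le_one (by positivity)]
  exact h1

theorem abs_smoothTrunc_le (ε s : ℝ) : |smoothTrunc ε s| ≤ |s| := by
  rw [smoothTrunc, abs_mul, abs_of_nonneg (Real.smoothTransition.nonneg _)]
  exact mul_le_of_le_one_right (abs_nonneg _) (Real.smoothTransition.le_one _)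

theorem abs_smoothTrunc_sub_le (hε : 0 < ε) (s : ℝ) : |smoothTrunc ε s - s| ≤ 2 * ε := by
  rcases le_total (2 * ε) |s| with h | h
  · have h1 : (2 * ε) ^ 2 ≤ s ^ 2 := sq_le_sq.2 (by rwa [abs_of_pos (by positivity)])
    rw [smoothTrunc, Real.smoothTransition.one_of_one_le, mul_one, sub_self, abs_zero]
    · positivity
    · rw [le_sub_iff_add_le, le_div_iff₀ (by positivity)]
      nlinarith
  · have h0 := Real.smoothTransition.nonneg (s ^ 2 / ε ^ 2 - 1)
    have h1 := Real.smoothTransition.le_one (s ^ 2 / ε ^ 2 - 1)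
    have e : smoothTrunc ε s - s = s * (Real.smoothTransition (s ^ 2 / ε ^ 2 - 1) - 1) := by
      rw [smoothTrunc]; ring
    rw [e, abs_mul]
    refine (mul_le_of_le_one_right (abs_nonneg _) ?_).trans h
    rw [abs_le]
    constructor <;> linarith

theorem smoothTrunc_nonneg {s : ℝ} (hs : 0 ≤ s) : 0 ≤ smoothTrunc ε s :=
  mul_nonneg hs (Real.smoothTransition.nonneg _)

theorem smoothTrunc_neg (s : ℝ) : smoothTrunc ε (-s) = -smoothTrunc ε s := by
  simp [smoothTrunc]

theorem monotone_smoothTrunc (ε : ℝ) : Monotone (smoothTrunc ε) := by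
  refine monotone_of_odd_of_monotoneOn_nonneg (fun s => smoothTrunc_neg s) ?_
  intro s hs t _ hst
  have hs' : (0 : ℝ) ≤ s := hs
  refine mul_le_mul hst (Real.smoothTransition.monotone ?_) (Real.smoothTransition.nonneg _)
    (hs'.trans hst)
  gcongr

/-- The primitive of `smoothTrunc ε` that vanishes at zero, an approximation of `s ^ 2 / 2`. -/
noncomputable def smoothTruncInt (ε s : ℝ) : ℝ := ∫ x in (0 : ℝ)..s, smoothTrunc ε x

theorem hasDerivAt_smoothTruncInt (ε s : ℝ) :
    HasDerivAt (smoothTruncInt ε) (smoothTrunc ε s) s :=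
  (contDiff_smoothTrunc ε).continuous.integral_hasStrictDerivAt 0 s |>.hasDerivAt

theorem smoothTruncInt_eq_zero (hε : 0 < ε) {s : ℝ} (hs : |s| ≤ ε) : smoothTruncInt ε s = 0 := by
  rw [smoothTruncInt, intervalIntegral.integral_congr (g := fun _ => (0 : ℝ))]
  · simp
  · intro x hx
    refine smoothTrunc_eq_zero hε ?_
    rcases Set.mem_uIcc.1 hx with h | h <;> rw [abs_le] at hs ⊢ <;>
      constructor <;> linarith [h.1, h.2, hs.1, hs.2]

theorem smoothTruncInt_nonneg (ε s : ℝ) : 0 ≤ smoothTruncInt ε s := by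
  rcases le_total 0 s with h | h
  · exact intervalIntegral.integral_nonneg h fun x hx => smoothTrunc_nonneg hx.1
  · rw [smoothTruncInt, intervalIntegral.integral_symm, ← intervalIntegral.integral_neg]
    refine intervalIntegral.integral_nonneg h fun x hx => ?_
    rw [← smoothTrunc_neg]
    exact smoothTrunc_nonneg (by linarith [hx.2])

theorem abs_two_mul_smoothTruncInt_sub_le (hε : 0 < ε) (s : ℝ) :
    |2 * smoothTruncInt ε s - s ^ 2| ≤ 4 * ε * |s| := by
  have h1 : smoothTruncInt ε s - s ^ 2 / 2 = ∫ x in (0 : ℝ)..s, (smoothTrunc ε x - x) := by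
    have hid : IntervalIntegrable (fun x : ℝ => x) volume 0 s := continuous_id.intervalIntegrable _ _
    rw [intervalIntegral.integral_sub ((contDiff_smoothTrunc ε).continuous.intervalIntegrable _ _)
      hid, integral_id, smoothTruncInt]
    ring
  have h2 := intervalIntegral.norm_integral_le_of_norm_le_const (a := 0) (b := s)
    (f := fun x => smoothTrunc ε x - x) (C := 2 * ε) fun x _ => abs_smoothTrunc_sub_le hε x
  rw [← h1, Real.norm_eq_abs, sub_zero] at h2
  have e : 2 * smoothTruncInt ε s - s ^ 2 = 2 * (smoothTruncInt ε s - s ^ 2 / 2) := by ring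
  rw [e, abs_mul, abs_two]
  linarith

end SmoothTrunc

theorem hasDerivAt_expNegInvGlue {x : ℝ} :
    HasDerivAt expNegInvGlue (x⁻¹ ^ 2 * expNegInvGlue x) x := by
  simpa using expNegInvGlue.hasDerivAt_polynomial_eval_inv_mul 1 x

namespace L1Method

open scoped Topology

variable {d : ℕ} {Ω : Set (EuclideanSpace ℝ (Fin d))} {v F G : EuclideanSpace ℝ (Fin d) → ℝ}
  {L : Coeffs d} {κ : ℝ}

theorem aestronglyMeasurable_rhs (hΩ : IsOpen Ω) (hv : L.Solves Ω v F)
    (hFG : ∀ x ∈ Ω, F x = G x - κ * v x) : AEStronglyMeasurable G (volume.restrict Ω) := by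
  have h1 : AEStronglyMeasurable F (volume.restrict Ω) := hv.2.2.1.aestronglyMeasurable
  have h2 : AEStronglyMeasurable v (volume.restrict Ω) :=
    (hv.1.mono subset_closure).aestronglyMeasurable hΩ.measurableSet
  refine (h1.add (h2.const_mul κ)).congr ?_
  filter_upwards [ae_restrict_mem hΩ.measurableSet] with x hx
  simp only [Pi.add_apply]
  rw [hFG x hx]
  ring

/-- Energy estimate: testing with `v` itself, through its smooth truncations. -/
theorem stability_two (hΩ : IsOpen Ω) (hΩb : Bornology.IsBounded Ω) (hL : L.Admissible Ω)
    (hcoef : ∀ x ∈ Ω, 0 ≤ L.c x - 1 / 2 * ∑ k, partialD k (L.b k) x)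
    (hv : L.Solves Ω v F) (hκ : 0 < κ) (hFG : ∀ x ∈ Ω, F x = G x - κ * v x) :
    ENNReal.ofReal κ * eLpNorm v 2 (volume.restrict Ω) ≤ eLpNorm G 2 (volume.restrict Ω) := by
  by_cases htop : eLpNorm G 2 (volume.restrict Ω) = ⊤
  · rw [htop]; exact le_top
  have hGm : MemLp G 2 (volume.restrict Ω) :=
    ⟨aestronglyMeasurable_rhs hΩ hv hFG, lt_top_iff_ne_top.2 htop⟩
  obtain ⟨hvc, hv0, hF, g, hg, heq⟩ := hv
  have hcl : IsCompact (closure Ω) := hΩb.isCompact_closure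
  have hfin : IsFiniteMeasure (volume.restrict Ω) :=
    ⟨by simpa using hΩb.measure_lt_top⟩
  have hvm : MemLp v 2 (volume.restrict Ω) :=
    (memLp_restrict_of_continuousOn hcl hvc 2).mono_measure
      (Measure.restrict_mono subset_closure le_rfl)
  obtain ⟨R, hR⟩ := hcl.exists_bound_of_continuousOn hvc
  obtain ⟨C, hC⟩ := hcl.exists_bound_of_continuousOn hL.c_cont
  have hmem := ae_restrict_mem (μ := volume) hΩ.measurableSet
  have hvv : Integrable (fun x => v x * v x) (volume.restrict Ω) := hvm.integrable_mul hvm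
  have hGv : Integrable (fun x => |G x| * |v x|) (volume.restrict Ω) :=
    hGm.abs.integrable_mul hvm.abs
  set A : ℝ := (volume.restrict Ω).real Set.univ with hA
  have key : ∀ ε > 0, κ * ∫ x in Ω, v x * v x ≤
      (∫ x in Ω, |G x| * |v x|) + ε * ((2 * κ * R + 6 * C * R) * A) := by
    intro ε hε
    have hH := contDiff_smoothTrunc ε
    obtain ⟨ia, ib, ic, iF, hid⟩ := integral_test hΩ hΩb hL hvc hv0 hF hg heq hε hH
      fun s hs => smoothTrunc_eq_zero hε hs
    have hconv := fun k => integral_convection hΩ hΩb hvc hv0 hg (hL.b_smooth k) k hε hH.continuous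
      (fun s hs => smoothTrunc_eq_zero hε hs) (hasDerivAt_smoothTruncInt ε)
      fun s hs => smoothTruncInt_eq_zero hε hs
    have hHv : AEStronglyMeasurable (fun x => smoothTrunc ε (v x)) (volume.restrict Ω) :=
      hH.continuous.comp_aestronglyMeasurable hvm.1
    have iHv : Integrable (fun x => smoothTrunc ε (v x) * v x) (volume.restrict Ω) := by
      refine hvv.mono' (hHv.mul hvm.1) (Filter.Eventually.of_forall fun x => ?_)
      rw [Real.norm_eq_abs, abs_mul, ← abs_mul_abs_self (v x)]
      exact mul_le_mul_of_nonneg_right (abs_smoothTrunc_le ε _) (abs_nonneg _)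
    have iHG : Integrable (fun x => smoothTrunc ε (v x) * G x) (volume.restrict Ω) := by
      refine hGv.mono' (hHv.mul hGm.1) (Filter.Eventually.of_forall fun x => ?_)
      rw [Real.norm_eq_abs, abs_mul, mul_comm]
      exact mul_le_mul_of_nonneg_left (abs_smoothTrunc_le ε _) (abs_nonneg _)
    -- the right-hand side
    have hF' : ∫ x in Ω, smoothTrunc ε (v x) * F x =
        (∫ x in Ω, smoothTrunc ε (v x) * G x) - κ * ∫ x in Ω, smoothTrunc ε (v x) * v x := by
      rw [← integral_const_mul, ← integral_sub iHG (iHv.const_mul κ)]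
      refine integral_congr_ae ?_
      filter_upwards [hmem] with x hx
      rw [hFG x hx]
      ring
    have hGle : ∫ x in Ω, smoothTrunc ε (v x) * G x ≤ ∫ x in Ω, |G x| * |v x| := by
      refine integral_mono iHG hGv fun x => (le_abs_self _).trans ?_
      rw [abs_mul, mul_comm]
      exact mul_le_mul_of_nonneg_left (abs_smoothTrunc_le ε _) (abs_nonneg _)
    have hvle : κ * ∫ x in Ω, v x * v x ≤
        κ * (∫ x in Ω, smoothTrunc ε (v x) * v x) + κ * (2 * ε * R * A) := by
      rw [← mul_add]
      refine mul_le_mul_of_nonneg_left ?_ hκ.le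
      have : ∫ x in Ω, 2 * ε * R = 2 * ε * R * A := by
        rw [integral_const, smul_eq_mul, mul_comm, hA]
      rw [← this, ← integral_add iHv (integrable_const _)]
      refine integral_mono_ae hvv (iHv.add (integrable_const _)) ?_
      filter_upwards [hmem] with x hx
      have h1 := abs_smoothTrunc_sub_le hε (v x)
      have h2 : |v x| ≤ R := hR x (subset_closure hx)
      have h3 : (v x - smoothTrunc ε (v x)) * v x ≤ 2 * ε * R := by
        refine (le_abs_self _).trans ?_
        rw [abs_mul, abs_sub_comm]
        exact mul_le_mul h1 h2 (abs_nonneg _) (by positivity)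
      linarith
    -- the diffusion term
    have hdiff : 0 ≤ ∑ k, ∫ x in Ω, deriv (smoothTrunc ε) (v x) *
        (L.a k x * (g k x) * (g k x)) := by
      refine Finset.sum_nonneg fun k _ => integral_nonneg_of_ae ?_
      filter_upwards [hmem] with x hx
      have h1 := (hL.a_pos k x (subset_closure hx)).le
      have h2 : 0 ≤ deriv (smoothTrunc ε) (v x) := (monotone_smoothTrunc ε).deriv_nonneg
      have h3 : 0 ≤ L.a k x * (g k x * g k x) := mul_nonneg h1 (mul_self_nonneg _)
      simp only [Pi.zero_apply, mul_assoc]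
      exact mul_nonneg h2 h3
    -- the lower-order terms, up to an error of order `ε` equal to
    -- `∫ 2 P(v) (c - ½ ∑ ∂_k b_k)` with the primitive `P` of the truncation
    have hlow : -(ε * (6 * C * R * A)) ≤
        (∫ x in Ω, smoothTrunc ε (v x) * (L.c x * v x))
          - ∑ k, ∫ x in Ω, smoothTruncInt ε (v x) * partialD k (L.b k) x := by
      rw [← integral_finsetSum _ fun k _ => (hconv k).1, ← integral_sub ic
        (integrable_finsetSum _ fun k _ => (hconv k).1)]
      have : ∫ x in Ω, -(ε * (6 * C * R)) = -(ε * (6 * C * R * A)) := by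
        rw [integral_const, smul_eq_mul, hA]
        ring
      rw [← this]
      refine integral_mono_ae (integrable_const _)
        (ic.sub (integrable_finsetSum _ fun k _ => (hconv k).1)) ?_
      filter_upwards [hmem] with x hx
      have h1 := hcoef x hx
      have h2 : |L.c x| ≤ C := hC x (subset_closure hx)
      have h3 : |v x| ≤ R := hR x (subset_closure hx)
      have h4 := abs_smoothTrunc_sub_le hε (v x)
      have h5 := abs_two_mul_smoothTruncInt_sub_le hε (v x)
      have h6 := smoothTruncInt_nonneg ε (v x)
      set s := v x
      set Hs := smoothTrunc ε s
      set Ps := smoothTruncInt ε s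
      have h7 : |Hs * s - 2 * Ps| ≤ 6 * ε * R := by
        have e : Hs * s - 2 * Ps = (Hs - s) * s - (2 * Ps - s ^ 2) := by ring
        have h8 : |(Hs - s) * s| ≤ 2 * ε * R := by
          rw [abs_mul]
          exact mul_le_mul h4 h3 (abs_nonneg _) (by positivity)
        have h9 : 4 * ε * |s| ≤ 4 * ε * R := by gcongr
        rw [e]
        refine (abs_sub _ _).trans ?_
        linarith
      have h8 : |L.c x * (Hs * s - 2 * Ps)| ≤ C * (6 * ε * R) := by
        rw [abs_mul]
        exact mul_le_mul h2 h7 (abs_nonneg _) ((abs_nonneg _).trans h2)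
      have h9 : 0 ≤ 2 * Ps * (L.c x - 1 / 2 * ∑ k, partialD k (L.b k) x) := by positivity
      have h10 := (abs_le.1 h8).1
      simp only [← Finset.mul_sum]
      linarith
    have hid' : (∑ k, ∫ x in Ω, deriv (smoothTrunc ε) (v x) * (L.a k x * g k x * g k x))
        - (∑ k, ∫ x in Ω, smoothTruncInt ε (v x) * partialD k (L.b k) x)
        + ∫ x in Ω, smoothTrunc ε (v x) * (L.c x * v x) =
        ∫ x in Ω, smoothTrunc ε (v x) * F x := by
      rw [← hid, ← Finset.sum_sub_distrib]
      congr 1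
      refine Finset.sum_congr rfl fun k _ => ?_
      rw [(hconv k).2]
      ring
    rw [hF'] at hid'
    linarith
  have hmain : κ * ∫ x in Ω, v x * v x ≤ ∫ x in Ω, |G x| * |v x| := by
    set D := (2 * κ * R + 6 * C * R) * A
    refine le_of_forall_pos_le_add fun e he => ?_
    have hD : 0 < |D| + 1 := by positivity
    refine (key (e / (|D| + 1)) (by positivity)).trans ?_
    have h1 : e / (|D| + 1) * D ≤ e := by
      rw [div_mul_eq_mul_div, div_le_iff₀ hD]
      exact mul_le_mul_of_nonneg_left ((le_abs_self D).trans (by linarith)) he.le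
    linarith
  -- the Cauchy–Schwarz inequality, and division by the norm of `v`
  have hCS : ENNReal.ofReal (∫ x in Ω, |G x| * |v x|) ≤
      eLpNorm G 2 (volume.restrict Ω) * eLpNorm v 2 (volume.restrict Ω) := by
    rw [ofReal_integral_eq_lintegral_ofReal hGv (Filter.Eventually.of_forall fun x => by positivity)]
    have := eLpNorm_smul_le_mul_eLpNorm (p := 2) (q := 2) (r := 1) hvm.1 hGm.1
    rw [eLpNorm_one_eq_lintegral_enorm] at this
    refine le_trans (le_of_eq (lintegral_congr fun x => ?_)) this
    rw [Pi.smul_apply', smul_eq_mul, enorm_mul, ENNReal.ofReal_mul (abs_nonneg _),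
      Real.enorm_eq_ofReal_abs, Real.enorm_eq_ofReal_abs]
  have hsq : ENNReal.ofReal (∫ x in Ω, v x * v x) = eLpNorm v 2 (volume.restrict Ω) ^ 2 := by
    rw [eLpNorm_two_sq, ofReal_integral_eq_lintegral_ofReal hvv
      (Filter.Eventually.of_forall fun x => mul_self_nonneg _)]
    refine lintegral_congr fun x => ?_
    rw [Real.enorm_eq_ofReal_abs, sq, ← ENNReal.ofReal_mul (abs_nonneg _), abs_mul_abs_self]
  by_cases hz : eLpNorm v 2 (volume.restrict Ω) = 0
  · rw [hz, mul_zero]; exact zero_le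
  · have h1 : ENNReal.ofReal κ * eLpNorm v 2 (volume.restrict Ω) ^ 2 ≤
        eLpNorm G 2 (volume.restrict Ω) * eLpNorm v 2 (volume.restrict Ω) := by
      rw [← hsq, ← ENNReal.ofReal_mul hκ.le]
      exact (ENNReal.ofReal_le_ofReal hmain).trans hCS
    rw [sq, ← mul_assoc] at h1
    exact (ENNReal.mul_le_mul_iff_left hz hvm.2.ne).1 h1

/-- One-sided maximum principle: near a positive maximum of `v`, the equation is tested with
`H(v)`, where `H / H'` is so small on the relevant range that the convection term is absorbed by
the diffusion term and the zero-order term. -/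
theorem le_of_solves (hΩ : IsOpen Ω) (hΩb : Bornology.IsBounded Ω) (hL : L.Admissible Ω)
    (hcoef : ∀ x ∈ Ω, 0 ≤ L.c x) (hv : L.Solves Ω v F) (hκ : 0 < κ)
    (hFG : ∀ x ∈ Ω, F x = G x - κ * v x) {N : ℝ} (hN : 0 ≤ N)
    (hG : ∀ᵐ x ∂(volume.restrict Ω), |G x| ≤ N) : ∀ x ∈ Ω, κ * v x ≤ N := by
  by_contra! hcon
  obtain ⟨x₀, hx₀, hx₀'⟩ := hcon
  obtain ⟨hvc, hv0, hF, g, hg, heq⟩ := hv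
  have hcl : IsCompact (closure Ω) := hΩb.isCompact_closure
  obtain ⟨xm, hxm, hmax⟩ := hcl.exists_isMaxOn ⟨x₀, subset_closure hx₀⟩ hvc
  have hmax' : ∀ x ∈ Ω, v x ≤ v xm := fun x hx => hmax (subset_closure hx)
  set V := v xm with hV
  have hVN : N < κ * V := hx₀'.trans_le (mul_le_mul_of_nonneg_left (hmax' x₀ hx₀) hκ.le)
  have hV0 : 0 < V := by
    by_contra! h
    nlinarith
  have hxmΩ : xm ∈ Ω := by
    by_contra h
    have : xm ∈ frontier Ω := ⟨hxm, fun h' => h (interior_subset h')⟩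
    rw [hV, hv0 xm this] at hV0
    exact lt_irrefl _ hV0
  have ha : ∃ a₀ > 0, ∀ k, ∀ x ∈ Ω, a₀ ≤ L.a k x := by
    have h1 : ∀ k, ∃ a₀ > 0, ∀ x ∈ Ω, a₀ ≤ L.a k x := by
      intro k
      obtain ⟨y, hy, hmin⟩ := hcl.exists_isMinOn ⟨x₀, subset_closure hx₀⟩ (hL.a_cont k)
      exact ⟨L.a k y, hL.a_pos k y hy, fun x hx => hmin (subset_closure hx)⟩
    choose a₀ ha₀ ha₀' using h1
    rcases isEmpty_or_nonempty (Fin d) with hd | hd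
    · exact ⟨1, one_pos, fun k => isEmptyElim k⟩
    · obtain ⟨k₀, hk₀⟩ := Finite.exists_min a₀
      exact ⟨a₀ k₀, ha₀ k₀, fun k x hx => (hk₀ k).trans (ha₀' k x hx)⟩
  obtain ⟨a₀, ha₀, ha₀'⟩ := ha
  have hb : ∃ B, ∀ k, ∀ x ∈ Ω, |L.b k x| ≤ B := by
    have h1 : ∀ k, ∃ B, ∀ x ∈ closure Ω, ‖L.b k x‖ ≤ B := fun k =>
      hcl.exists_bound_of_continuousOn (hL.b_cont k)
    choose B hB using h1
    rcases isEmpty_or_nonempty (Fin d) with hd | hd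
    · exact ⟨1, fun k => isEmptyElim k⟩
    · obtain ⟨k₀, hk₀⟩ := Finite.exists_max B
      exact ⟨B k₀, fun k x hx => (hB k x (subset_closure hx)).trans (hk₀ k)⟩
  obtain ⟨B, hB⟩ := hb
  set Q := (d : ℝ) * (B ^ 2 / (4 * a₀)) with hQ
  -- a level close enough to the maximum
  have hlev : ∃ l, 0 < l ∧ l < V ∧ 0 < κ * l - N - Q * (V - l) ^ 2 := by
    have h1 : ∀ᶠ l in 𝓝[<] V, 0 < κ * l - N - Q * (V - l) ^ 2 := by
      have hcont : Continuous fun l => κ * l - N - Q * (V - l) ^ 2 := by fun_prop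
      refine (hcont.continuousWithinAt (s := Set.Iio V) (x := V)).eventually_const_lt ?_
      simp only [sub_self]
      nlinarith
    have h2 : ∀ᶠ l in 𝓝[<] V, 0 < l :=
      (continuous_id.continuousWithinAt (s := Set.Iio V) (x := V)).eventually_const_lt hV0
    obtain ⟨l, hl1, hl2, hl3⟩ := (h1.and (h2.and self_mem_nhdsWithin)).exists
    exact ⟨l, hl2, hl3, hl1⟩
  obtain ⟨l, hl0, hlV, hδ⟩ := hlev
  set δ := κ * l - N - Q * (V - l) ^ 2 with hδdef
  -- this choice gives `H' = H / (s - l) ^ 2`, hence `H ≤ (V - l) ^ 2 H'` on `[l, V]`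
  set H : ℝ → ℝ := fun s => expNegInvGlue (s - l) with hHdef
  have hH : ContDiff ℝ ∞ H := expNegInvGlue.contDiff.comp (contDiff_id.sub contDiff_const)
  have hHnn : ∀ s, 0 ≤ H s := fun s => expNegInvGlue.nonneg _
  have hHz : ∀ s, s ≤ l → H s = 0 := fun s hs => expNegInvGlue.zero_of_nonpos (by linarith)
  have hH' : ∀ s, deriv H s = (s - l)⁻¹ ^ 2 * H s := fun s => by
    have := (hasDerivAt_expNegInvGlue (x := s - l)).comp s ((hasDerivAt_id s).sub_const l)
    have h2 : HasDerivAt H ((s - l)⁻¹ ^ 2 * expNegInvGlue (s - l) * 1) s := this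
    rw [h2.deriv, mul_one]
  obtain ⟨ia, ib, ic, iF, hid⟩ := integral_test hΩ hΩb hL hvc hv0 hF hg heq hl0 hH
    fun s hs => hHz s ((le_abs_self s).trans hs)
  have iab : ∀ k, IntegrableOn (fun x => deriv H (v x) * (L.a k x * g k x * g k x)
      + H (v x) * (L.b k x * g k x)) Ω := fun k => (ia k).add (ib k)
  have iS : IntegrableOn (fun x => ∑ k, (deriv H (v x) * (L.a k x * g k x * g k x)
      + H (v x) * (L.b k x * g k x))) Ω := integrable_finsetSum _ fun k _ => iab k
  have hzero : ∫ x in Ω, ((∑ k, (deriv H (v x) * (L.a k x * g k x * g k x)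
      + H (v x) * (L.b k x * g k x))) + H (v x) * (L.c x * v x) - H (v x) * F x) = 0 := by
    have iSc : IntegrableOn (fun x => (∑ k, (deriv H (v x) * (L.a k x * g k x * g k x)
      + H (v x) * (L.b k x * g k x))) + H (v x) * (L.c x * v x)) Ω := iS.add ic
    rw [integral_sub iSc iF, integral_add iS ic, integral_finsetSum _ fun k _ => iab k,
      ← hid]
    simp only [fun k => integral_add (ia k) (ib k), sub_self]
  have hpt : ∀ᵐ x ∂(volume.restrict Ω), δ * H (v x) ≤
      (∑ k, (deriv H (v x) * (L.a k x * g k x * g k x)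
      + H (v x) * (L.b k x * g k x))) + H (v x) * (L.c x * v x) - H (v x) * F x := by
    filter_upwards [ae_restrict_mem hΩ.measurableSet, hG] with x hx hGx
    rcases le_or_gt (v x) l with h | h
    · simp [hH', hHz _ h]
    have hs : 0 < v x - l := by linarith
    have hsV : v x - l ≤ V - l := by linarith [hmax' x hx]
    have hHx := hHnn (v x)
    set s := v x with hsdef
    have hterm : ∀ k, -(H s * ((V - l) ^ 2 * (B ^ 2 / (4 * a₀)))) ≤
        deriv H s * (L.a k x * g k x * g k x) + H s * (L.b k x * g k x) := by
      intro k
      set a := L.a k x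
      set b := L.b k x
      set y := g k x
      have h1 : a₀ ≤ a := ha₀' k x hx
      have hapos : 0 < a := ha₀.trans_le h1
      have h2 : b ^ 2 ≤ B ^ 2 := sq_le_sq' (abs_le.1 (hB k x hx)).1 (abs_le.1 (hB k x hx)).2
      have h3 : b ^ 2 / (4 * a) ≤ B ^ 2 / (4 * a₀) := by gcongr
      have h4 : (s - l) ^ 2 * (b ^ 2 / (4 * a)) ≤ (V - l) ^ 2 * (B ^ 2 / (4 * a₀)) := by gcongr
      -- completion of the square
      have e : (s - l)⁻¹ ^ 2 * (a * y * y) + b * y + (s - l) ^ 2 * (b ^ 2 / (4 * a)) =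
          a * ((s - l)⁻¹ * y + (s - l) * b / (2 * a)) ^ 2 := by
        field_simp
        ring
      have h5 : 0 ≤ (s - l)⁻¹ ^ 2 * (a * y * y) + b * y + (s - l) ^ 2 * (b ^ 2 / (4 * a)) := by
        rw [e]; positivity
      have h6 := mul_nonneg hHx (h5.trans (add_le_add_right h4 _))
      rw [hH']
      linarith
    have hsum := Finset.sum_le_sum fun (k : Fin d) (_ : k ∈ Finset.univ) => hterm k
    rw [Finset.sum_const, Finset.card_univ, Fintype.card_fin, nsmul_eq_mul] at hsum
    have hc : 0 ≤ H s * (L.c x * s) := mul_nonneg hHx (mul_nonneg (hcoef x hx) (by linarith))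
    have hF2 : H s * F x ≤ H s * (N - κ * l) := by
      refine mul_le_mul_of_nonneg_left ?_ hHx
      rw [hFG x hx]
      nlinarith [(abs_le.1 hGx).2]
    have e2 : δ * H s = H s * (κ * l - N) - (d : ℝ) * (H s * ((V - l) ^ 2 * (B ^ 2 / (4 * a₀)))) := by
      rw [hδdef, hQ]; ring
    rw [e2]
    linarith
  have hδH : Integrable (fun x => δ * H (v x)) (volume.restrict Ω) := by
    refine ((iS.add ic).sub iF).mono' ?_ ?_
    · exact (hH.continuous.comp_aestronglyMeasurable
        ((hvc.mono subset_closure).aestronglyMeasurable hΩ.measurableSet)).const_mul δ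
    · filter_upwards [hpt] with x hx
      rw [Real.norm_of_nonneg (mul_nonneg hδ.le (hHnn _))]
      exact hx
  have hle : ∫ x in Ω, δ * H (v x) ≤ 0 := by
    rw [← hzero]
    exact integral_mono_ae hδH ((iS.add ic).sub iF) hpt
  -- hence `H(v) = 0` almost everywhere, although it is positive on a nonempty open set
  have hae := (integral_eq_zero_iff_of_nonneg (fun x => mul_nonneg hδ.le (hHnn (v x))) hδH).1
    (le_antisymm hle (integral_nonneg fun x => mul_nonneg hδ.le (hHnn (v x))))
  have hopen : IsOpen (Ω ∩ v ⁻¹' Set.Ioi l) :=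
    (hvc.mono subset_closure).isOpen_inter_preimage hΩ isOpen_Ioi
  have hpos : 0 < volume (Ω ∩ v ⁻¹' Set.Ioi l) := hopen.measure_pos volume ⟨xm, hxmΩ, hlV⟩
  rw [Filter.EventuallyEq, ae_restrict_iff' hΩ.measurableSet] at hae
  refine hpos.ne' (measure_mono_null (fun x hx => ?_) hae)
  intro h
  have h1 := h hx.1
  have h2 : 0 < H (v x) := expNegInvGlue.pos_of_pos (sub_pos.2 hx.2)
  simp only [Pi.zero_apply] at h1
  exact (mul_pos hδ h2).ne' h1

theorem integrableOn_mul_of_test {K : Set (EuclideanSpace ℝ (Fin d))} (hΩ : IsOpen Ω)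
    (hK : IsCompact K) {f φ : EuclideanSpace ℝ (Fin d) → ℝ} (hf : IntegrableOn f K)
    (hφ : Continuous φ) (hφ0 : ∀ x ∉ K, φ x = 0) : IntegrableOn (fun x => f x * φ x) Ω := by
  refine IntegrableOn.of_forall_sdiff_eq_zero (s := K) ?_ hΩ.measurableSet fun x hx => by
    simp [hφ0 x hx.2]
  exact IntegrableOn.mul_continuousOn hf hφ.continuousOn hK

/-- Linearity of the boundary value problem. -/
theorem Coeffs.Solves.sub (hΩ : IsOpen Ω) (hL : L.Admissible Ω) {v₁ v₂ F₁ F₂ :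
    EuclideanSpace ℝ (Fin d) → ℝ} (h₁ : L.Solves Ω v₁ F₁) (h₂ : L.Solves Ω v₂ F₂) :
    L.Solves Ω (fun x => v₁ x - v₂ x) (fun x => F₁ x - F₂ x) := by
  obtain ⟨hc₁, h0₁, hF₁, g₁, hg₁, he₁⟩ := h₁
  obtain ⟨hc₂, h0₂, hF₂, g₂, hg₂, he₂⟩ := h₂
  have hpd : ∀ φ, IsTest Ω φ → ∀ k, Continuous (partialD k φ) ∧
      ∀ x ∉ tsupport φ, partialD k φ x = 0 := by
    intro φ hφ k
    refine ⟨continuous_partialD hφ.1 k, fun x hx => ?_⟩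
    have h1 := support_fderiv_subset ℝ (f := φ)
    have h2 : fderiv ℝ φ x = 0 := by_contra fun h => hx (h1 h)
    simp [partialD, h2]
  have hφ0 : ∀ φ : EuclideanSpace ℝ (Fin d) → ℝ, ∀ x ∉ tsupport φ, φ x = 0 := fun φ x hx =>
    image_eq_zero_of_notMem_tsupport hx
  refine ⟨hc₁.sub hc₂, fun x hx => by simp only [h0₁ x hx, h0₂ x hx, sub_self], hF₁.sub hF₂,
    fun k x => g₁ k x - g₂ k x, fun k => ⟨fun K hK hKΩ => ((hg₁ k).1 K hK hKΩ).sub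
      ((hg₂ k).1 K hK hKΩ), fun φ hφ => ?_⟩, fun φ hφ => ?_⟩
  · have hK : IsCompact (tsupport φ) := hφ.2.1
    have hKcl := hφ.2.2.trans subset_closure
    have i1 := integrableOn_mul_of_test hΩ hK ((hc₁.mono hKcl).integrableOn_compact hK)
      (hpd φ hφ k).1 (hpd φ hφ k).2
    have i2 := integrableOn_mul_of_test hΩ hK ((hc₂.mono hKcl).integrableOn_compact hK)
      (hpd φ hφ k).1 (hpd φ hφ k).2
    have hfin : IsFiniteMeasure (volume.restrict (tsupport φ)) :=
      ⟨by simpa using hK.measure_lt_top⟩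
    have j1 := integrableOn_mul_of_test hΩ hK
      (((hg₁ k).1 _ hK hφ.2.2).integrable one_le_two) hφ.1.continuous (hφ0 φ)
    have j2 := integrableOn_mul_of_test hΩ hK
      (((hg₂ k).1 _ hK hφ.2.2).integrable one_le_two) hφ.1.continuous (hφ0 φ)
    simp only [sub_mul]
    rw [integral_sub i1 i2, integral_sub j1 j2, (hg₁ k).2 φ hφ, (hg₂ k).2 φ hφ]
    ring
  · have hK : IsCompact (tsupport φ) := hφ.2.1
    have hKcl := hφ.2.2.trans subset_closure
    have hint : ∀ v g : EuclideanSpace ℝ (Fin d) → ℝ, ∀ k, ContinuousOn v (closure Ω) →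
        IsWeakPartialL2Loc Ω k v g →
        IntegrableOn (fun x => L.a k x * g x * partialD k φ x + L.b k x * g x * φ x) Ω := by
      intro v g k _ hg
      have hgK := hg.1 _ hK hφ.2.2
      refine Integrable.add ?_ ?_
      · exact integrableOn_mul_of_test hΩ hK ((memLp_restrict_of_continuousOn hK
          ((hL.a_cont k).mono hKcl) 2).integrable_mul hgK) (hpd φ hφ k).1 (hpd φ hφ k).2
      · exact integrableOn_mul_of_test hΩ hK ((memLp_restrict_of_continuousOn hK
          ((hL.b_cont k).mono hKcl) 2).integrable_mul hgK) hφ.1.continuous (hφ0 φ)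
    have hintc : ∀ v : EuclideanSpace ℝ (Fin d) → ℝ, ContinuousOn v (closure Ω) →
        IntegrableOn (fun x => L.c x * v x * φ x) Ω := fun v hv =>
      integrableOn_mul_of_test hΩ hK
        (((hL.c_cont.mul hv).mono hKcl).integrableOn_compact hK) hφ.1.continuous (hφ0 φ)
    have i1 := integrable_finsetSum Finset.univ fun k _ => hint v₁ (g₁ k) k hc₁ (hg₁ k)
    have i2 := integrable_finsetSum Finset.univ fun k _ => hint v₂ (g₂ k) k hc₂ (hg₂ k)
    have j1 := integrableOn_mul_of_test hΩ hK (hF₁.integrableOn_compact_subset hφ.2.2 hK)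
      hφ.1.continuous (hφ0 φ)
    have j2 := integrableOn_mul_of_test hΩ hK (hF₂.integrableOn_compact_subset hφ.2.2 hK)
      hφ.1.continuous (hφ0 φ)
    have e1 := he₁ φ hφ
    have e2 := he₂ φ hφ
    have e3 : ∫ x in Ω, (F₁ x - F₂ x) * φ x = (∫ x in Ω, F₁ x * φ x) - ∫ x in Ω, F₂ x * φ x := by
      simp only [sub_mul]
      exact integral_sub j1 j2
    have k1 : IntegrableOn (fun x => (∑ k, (L.a k x * g₁ k x * partialD k φ x
        + L.b k x * g₁ k x * φ x)) + L.c x * v₁ x * φ x) Ω := i1.add (hintc v₁ hc₁)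
    have k2 : IntegrableOn (fun x => (∑ k, (L.a k x * g₂ k x * partialD k φ x
        + L.b k x * g₂ k x * φ x)) + L.c x * v₂ x * φ x) Ω := i2.add (hintc v₂ hc₂)
    rw [e3, ← e1, ← e2, ← integral_sub k1 k2]
    refine integral_congr_ae (Filter.Eventually.of_forall fun x => ?_)
    simp only
    rw [show ∀ A B C D : ℝ, A + B - (C + D) = (A - C) + (B - D) from fun _ _ _ _ => by ring,
      ← Finset.sum_sub_distrib]
    congr 1
    · exact Finset.sum_congr rfl fun k _ => by ring
    · ring

theorem solves_zero (L : Coeffs d) (Ω : Set (EuclideanSpace ℝ (Fin d))) :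
    L.Solves Ω (fun _ => 0) (fun _ => 0) := by
  refine ⟨continuousOn_const, fun _ _ => rfl, (locallyIntegrable_const 0).locallyIntegrableOn Ω,
    fun _ _ => 0, fun k => ⟨fun K _ _ => MemLp.zero', fun φ _ => by simp⟩, fun φ _ => by simp⟩

theorem stability_top (hΩ : IsOpen Ω) (hΩb : Bornology.IsBounded Ω) (hL : L.Admissible Ω)
    (hcoef : ∀ x ∈ Ω, 0 ≤ L.c x) (hv : L.Solves Ω v F) (hκ : 0 < κ)
    (hFG : ∀ x ∈ Ω, F x = G x - κ * v x) :
    ENNReal.ofReal κ * eLpNorm v ⊤ (volume.restrict Ω) ≤ eLpNorm G ⊤ (volume.restrict Ω) := by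
  by_cases htop : eLpNorm G ⊤ (volume.restrict Ω) = ⊤
  · rw [htop]; exact le_top
  set N := (eLpNorm G ⊤ (volume.restrict Ω)).toReal with hN
  have hNof : ENNReal.ofReal N = eLpNorm G ⊤ (volume.restrict Ω) := ENNReal.ofReal_toReal htop
  have hG : ∀ᵐ x ∂(volume.restrict Ω), |G x| ≤ N := by
    filter_upwards [ae_le_eLpNormEssSup (f := G) (μ := volume.restrict Ω)] with x hx
    rw [← eLpNorm_exponent_top, ← hNof, Real.enorm_eq_ofReal_abs] at hx
    exact (ENNReal.ofReal_le_ofReal_iff ENNReal.toReal_nonneg).1 hx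
  have h1 := le_of_solves hΩ hΩb hL hcoef hv hκ hFG ENNReal.toReal_nonneg hG
  have h2 := le_of_solves (G := fun x => -G x) hΩ hΩb hL hcoef
    ((solves_zero L Ω).sub hΩ hL hv) hκ
    (fun x hx => by simp only [hFG x hx]; ring) ENNReal.toReal_nonneg
    (by simpa only [abs_neg] using hG)
  have h3 : eLpNorm v ⊤ (volume.restrict Ω) ≤ ENNReal.ofReal (N / κ) := by
    rw [eLpNorm_exponent_top]
    refine eLpNormEssSup_le_of_ae_bound ?_
    filter_upwards [ae_restrict_mem hΩ.measurableSet] with x hx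
    rw [Real.norm_eq_abs, abs_le, le_div_iff₀ hκ, neg_le_iff_add_nonneg, ← sub_nonneg]
    have h4 := h2 x hx
    have h5 := h1 x hx
    refine ⟨?_, by linarith⟩
    have e : v x + N / κ - 0 = (κ * v x + N) / κ := by field_simp; ring
    rw [e]
    exact div_nonneg (by linarith) hκ.le
  calc ENNReal.ofReal κ * eLpNorm v ⊤ (volume.restrict Ω)
      ≤ ENNReal.ofReal κ * ENNReal.ofReal (N / κ) := by gcongr
    _ = ENNReal.ofReal N := by rw [← ENNReal.ofReal_mul hκ.le, mul_div_cancel₀ _ hκ.ne']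
    _ = _ := hNof

/-- Stability of `L v + κ v = G` in `L_p`, `p ∈ {2, ∞}`. -/
theorem stability {p : ℝ≥0∞} (hp : p = 2 ∨ p = ⊤) (hΩ : IsOpen Ω)
    (hΩb : Bornology.IsBounded Ω) (hL : L.Admissible Ω)
    (hcoef : ∀ x ∈ Ω, 0 ≤ L.c x - (p⁻¹).toReal * ∑ k, partialD k (L.b k) x)
    (hv : L.Solves Ω v F) (hκ : 0 < κ) (hFG : ∀ x ∈ Ω, F x = G x - κ * v x) :
    ENNReal.ofReal κ * eLpNorm v p (volume.restrict Ω) ≤ eLpNorm G p (volume.restrict Ω) := by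
  rcases hp with rfl | rfl
  · exact stability_two hΩ hΩb hL (by simpa using hcoef) hv hκ hFG
  · exact stability_top hΩ hΩb hL (by simpa using hcoef) hv hκ hFG

end L1Method

/-! ### The L1 operator as a sum with increasing weights -/

namespace L1Method

/-- The weight `Γ(1-α)⁻¹ τ_j⁻¹ ∫_{t_{j-1}}^{t_j} (t_m - s)^{-α} ds` of the increment
`V^j - V^{j-1}` in `δ_t^α V^m`. -/
noncomputable def l1Weight (α : ℝ) (t : ℕ → ℝ) (m j : ℕ) : ℝ :=
  1 / Real.Gamma (1 - α) * ((∫ s in (t (j - 1))..(t j), (t m - s) ^ (-α)) / (t j - t (j - 1)))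

/-- Summation by parts. -/
theorem sum_mul_sub_eq {m : ℕ} (hm : 1 ≤ m) (w V : ℕ → ℝ) :
    ∑ j ∈ Finset.Icc 1 m, w j * (V j - V (j - 1)) =
      w m * V m - ∑ j ∈ Finset.Ico 1 m, (w (j + 1) - w j) * V j - w 1 * V 0 := by
  induction m, hm using Nat.le_induction with
  | base => simp; ring
  | succ m hm ih =>
    rw [Finset.sum_Icc_succ_top (by omega), ih, Finset.sum_Ico_succ_top hm, Nat.add_sub_cancel]
    ring

/-- The L1 operator in terms of its values, with the value at `t_m` separated. -/
theorem deltaAlpha_eq (α : ℝ) (t V : ℕ → ℝ) {m : ℕ} (hm : 1 ≤ m) :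
    deltaAlpha α t V m = l1Weight α t m m * V m -
      ∑ j ∈ Finset.Ico 1 m, (l1Weight α t m (j + 1) - l1Weight α t m j) * V j -
      l1Weight α t m 1 * V 0 := by
  rw [← sum_mul_sub_eq hm, deltaAlpha, Finset.mul_sum]
  refine Finset.sum_congr rfl fun j _ => ?_
  rw [deltaT, l1Weight]
  ring

section Weights

variable {α : ℝ} {t : ℕ → ℝ} {m j : ℕ}

theorem mul_le_integral_kernel (hα0 : 0 < α) (hα1 : α < 1) {a b c : ℝ} (hab : a ≤ b)
    (hbc : b ≤ c) : (c - a) ^ (-α) * (b - a) ≤ ∫ s in a..b, (c - s) ^ (-α) := by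
  have h := intervalIntegral.integral_mono_on_of_le_Ioo hab
    (intervalIntegrable_const (c := (c - a) ^ (-α)) (μ := volume))
    (intervalIntegrable_sub_rpow_neg hα1 a b c) fun s hs =>
      Real.rpow_le_rpow_of_nonpos (by linarith [hs.2]) (by linarith [hs.1]) (by linarith)
  rw [intervalIntegral.integral_const, smul_eq_mul] at h
  linarith

theorem integral_kernel_le_mul (hα0 : 0 < α) (hα1 : α < 1) {a b c : ℝ} (hab : a ≤ b)
    (hbc : b < c) : ∫ s in a..b, (c - s) ^ (-α) ≤ (c - b) ^ (-α) * (b - a) := by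
  have h := intervalIntegral.integral_mono_on_of_le_Ioo hab
    (intervalIntegrable_sub_rpow_neg hα1 a b c)
    (intervalIntegrable_const (c := (c - b) ^ (-α)) (μ := volume)) fun s hs =>
      Real.rpow_le_rpow_of_nonpos (by linarith) (by linarith [hs.2]) (by linarith)
  rw [intervalIntegral.integral_const, smul_eq_mul] at h
  linarith

theorem le_l1Weight (hα0 : 0 < α) (hα1 : α < 1) (hmono : StrictMono t)
    (hj : j ∈ Finset.Icc 1 m) :
    1 / Real.Gamma (1 - α) * (t m - t (j - 1)) ^ (-α) ≤ l1Weight α t m j := by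
  obtain ⟨hj1, hjm⟩ := Finset.mem_Icc.1 hj
  have hΓ : 0 < Real.Gamma (1 - α) := Real.Gamma_pos_of_pos (by linarith)
  have h1 : t (j - 1) < t j := hmono (by omega)
  refine mul_le_mul_of_nonneg_left ?_ (by positivity)
  rw [le_div_iff₀ (by linarith)]
  exact mul_le_integral_kernel hα0 hα1 h1.le (hmono.monotone hjm)

theorem l1Weight_pos (hα0 : 0 < α) (hα1 : α < 1) (hmono : StrictMono t)
    (hj : j ∈ Finset.Icc 1 m) : 0 < l1Weight α t m j := by
  obtain ⟨hj1, hjm⟩ := Finset.mem_Icc.1 hj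
  have hΓ : 0 < Real.Gamma (1 - α) := Real.Gamma_pos_of_pos (by linarith)
  have h1 : 0 < t m - t (j - 1) := sub_pos.2 (hmono (by omega))
  exact lt_of_lt_of_le (by positivity) (le_l1Weight hα0 hα1 hmono hj)

theorem l1Weight_le_succ (hα0 : 0 < α) (hα1 : α < 1) (hmono : StrictMono t)
    (hj : j ∈ Finset.Ico 1 m) : l1Weight α t m j ≤ l1Weight α t m (j + 1) := by
  obtain ⟨hj1, hjm⟩ := Finset.mem_Ico.1 hj
  have hΓ : 0 < Real.Gamma (1 - α) := Real.Gamma_pos_of_pos (by linarith)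
  have h1 : t (j - 1) < t j := hmono (by omega)
  refine le_trans ?_ (le_l1Weight hα0 hα1 hmono (Finset.mem_Icc.2 ⟨by omega, hjm⟩))
  refine mul_le_mul_of_nonneg_left ?_ (by positivity)
  rw [div_le_iff₀ (by linarith), Nat.add_sub_cancel]
  exact integral_kernel_le_mul hα0 hα1 h1.le (hmono hjm)

/-- On a uniform mesh the weights are a multiple of a convolution kernel. -/
theorem l1Weight_uniform (hα1 : α < 1) {τ : ℝ} (hτ : 0 < τ) (ht : ∀ i, t i = τ * i)
    (hj : j ∈ Finset.Icc 1 m) :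
    l1Weight α t m j = τ ^ (-α) / (Real.Gamma (1 - α) * (1 - α)) * l1Kernel α (m - j) := by
  obtain ⟨hj1, hjm⟩ := Finset.mem_Icc.1 hj
  have hΓ : Real.Gamma (1 - α) ≠ 0 := (Real.Gamma_pos_of_pos (by linarith)).ne'
  have h3 : 1 - α ≠ 0 := by linarith
  have hjm' : (j : ℝ) ≤ m := by exact_mod_cast hjm
  have e1 : τ * m - τ * ((j - 1 : ℕ) : ℝ) = τ * (((m - j : ℕ) : ℝ) + 1) := by
    push_cast [hj1, hjm]; ring
  have e2 : τ * m - τ * (j : ℝ) = τ * ((m - j : ℕ) : ℝ) := by push_cast [hjm]; ring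
  have e3 : τ * j - τ * ((j - 1 : ℕ) : ℝ) = τ := by push_cast [hj1]; ring
  have e4 : τ ^ (1 - α) = τ * τ ^ (-α) := by
    rw [sub_eq_add_neg, Real.rpow_add hτ, Real.rpow_one]
  rw [l1Weight, integral_sub_rpow_neg hα1, ht, ht, ht, e1, e2, e3,
    Real.mul_rpow hτ.le (by positivity), Real.mul_rpow hτ.le (by positivity), e4, l1Kernel]
  field_simp

end Weights

/-! ### The recursion for the norms of the errors -/

variable {d : ℕ} {α T : ℝ} {t : ℕ → ℝ} {Ω : Set (EuclideanSpace ℝ (Fin d))}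
  {u : EuclideanSpace ℝ (Fin d) → ℝ → ℝ}

theorem IsSolution.timeRegular {L : Coeffs d} {f : EuclideanSpace ℝ (Fin d) → ℝ → ℝ}
    {u₀ : EuclideanSpace ℝ (Fin d) → ℝ} (h : IsSolution α T Ω L f u₀ u) :
    ∃ K, ∀ x ∈ Ω, TimeRegular α T K (u x) := by
  obtain ⟨K, hK⟩ := h.bound
  exact ⟨K, fun x hx => ⟨h.cont.comp (by fun_prop : ContinuousOn (fun s => (x, s)) (Set.Icc 0 T))
    fun s hs => ⟨subset_closure hx, hs⟩, h.diff_one x hx, h.diff_two x hx,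
    fun s hs => (hK x hx s hs).1⟩⟩

/-- The pieces of the truncation error are measurable in space. The time derivative of the
continuous extension of `u` is jointly measurable, and agrees with that of `u` inside `(0, T)`. -/
theorem aemeasurable_truncPiece (hΩ : IsOpen Ω)
    (hu : ContinuousOn (Function.uncurry u) (closure Ω ×ˢ Set.Icc 0 T)) (hmono : StrictMono t)
    (ht0 : t 0 = 0) {m j : ℕ} (hmT : t m ≤ T) (hj : j ∈ Finset.Icc 1 m) :
    AEMeasurable (fun x => truncPiece α t (u x) m j) (volume.restrict Ω) := by
  obtain ⟨hj1, hjm⟩ := Finset.mem_Icc.1 hj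
  have hT := mesh_mem_Icc hmono ht0 hmT le_rfl
  have hT0 : (0 : ℝ) ≤ T := hT.1.trans hT.2
  have hj' := mesh_mem_Icc hmono ht0 hmT hjm
  have hj'' := mesh_mem_Icc hmono ht0 hmT (show j - 1 ≤ m by omega)
  have h1 : t (j - 1) ≤ t j := hmono.monotone (Nat.sub_le _ _)
  refine aemeasurable_restrict_of_measurable_subtype hΩ.measurableSet ?_
  let w : Ω → ℝ → ℝ := fun x s => u x (Set.projIcc 0 T hT0 s)
  have hw : Continuous (Function.uncurry w) := by
    refine hu.comp_continuous (f := fun q : Ω × ℝ => ((q.1 : EuclideanSpace ℝ (Fin d)),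
      ((Set.projIcc 0 T hT0 q.2 : Set.Icc (0 : ℝ) T) : ℝ))) ?_
      fun q => ⟨subset_closure q.1.2, (Set.projIcc 0 T hT0 q.2).2⟩
    exact (continuous_subtype_val.comp continuous_fst).prodMk
      (continuous_subtype_val.comp (continuous_projIcc.comp continuous_snd))
  have hproj : ∀ s ∈ Set.Icc 0 T, ((Set.projIcc 0 T hT0 s : Set.Icc (0 : ℝ) T) : ℝ) = s :=
    fun s hs => by rw [Set.projIcc_of_mem hT0 hs]
  have hval : ∀ s ∈ Set.Icc 0 T, Measurable fun x : Ω => u x s := fun s hs => by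
    have : Continuous fun x : Ω => w x s := hw.comp (by fun_prop : Continuous fun x : Ω => (x, s))
    simpa only [w, hproj s hs] using this.measurable
  have hδ : Measurable fun x : Ω => deltaT t (fun i => u x (t i)) j :=
    ((hval _ hj').sub (hval _ hj'')).div_const _
  have hderiv : ∀ x : Ω, ∀ s ∈ Set.Ioo 0 T, deriv (w x) s = deriv (u x) s := by
    intro x s hs
    refine Filter.EventuallyEq.deriv_eq ?_
    filter_upwards [isOpen_Ioo.mem_nhds hs] with y hy
    simp only [w, hproj y (Set.Ioo_subset_Icc_self hy)]
  have hint : (fun x : Ω => truncPiece α t (u x) m j) = fun x : Ω =>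
      ∫ s in Set.Ioo (t (j - 1)) (t j), (t m - s) ^ (-α) *
        (deltaT t (fun i => u x (t i)) j - deriv (w x) s) := by
    funext x
    rw [truncPiece, intervalIntegral.integral_of_le h1, integral_Ioc_eq_integral_Ioo]
    refine setIntegral_congr_fun measurableSet_Ioo fun s hs => ?_
    simp only [hderiv x s ⟨hj''.1.trans_lt hs.1, hs.2.trans_le hj'.2⟩]
  rw [hint]
  refine (StronglyMeasurable.integral_prod_right (Measurable.stronglyMeasurable ?_)).measurable
  exact ((by fun_prop : Measurable fun s : ℝ => (t m - s) ^ (-α)).comp measurable_snd).mul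
    ((hδ.comp measurable_fst).sub (measurable_deriv_with_param hw))

/-- The error of the semidiscretization solves an elliptic problem, whose stability gives a
recursive inequality for the norms of the errors. -/
theorem error_recursion {p : ℝ≥0∞} (hp : p = 2 ∨ p = ⊤) (hα0 : 0 < α) (hα1 : α < 1)
    (hΩ : IsOpen Ω) (hΩb : Bornology.IsBounded Ω) {L : Coeffs d} (hL : L.Admissible Ω)
    (hcoef : ∀ x ∈ Ω, 0 ≤ L.c x - (p⁻¹).toReal * ∑ k, partialD k (L.b k) x)
    {f : EuclideanSpace ℝ (Fin d) → ℝ → ℝ} {u₀ : EuclideanSpace ℝ (Fin d) → ℝ}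
    (hu : IsSolution α T Ω L f u₀ u) {M : ℕ} (hmono : StrictMono t) (ht0 : t 0 = 0)
    (htM : t M ≤ T) {U : ℕ → EuclideanSpace ℝ (Fin d) → ℝ}
    (hU : IsSemidiscrete α t M Ω L f u₀ U) {m : ℕ} (hm : 1 ≤ m) (hmM : m ≤ M) :
    ENNReal.ofReal (l1Weight α t m m) *
        eLpNorm (fun x => u x (t m) - U m x) p (volume.restrict Ω) ≤
      ∑ j ∈ Finset.Ico 1 m, ENNReal.ofReal (l1Weight α t m (j + 1) - l1Weight α t m j) *
        eLpNorm (fun x => u x (t j) - U j x) p (volume.restrict Ω) +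
      ENNReal.ofReal (1 / Real.Gamma (1 - α)) * ∑ j ∈ Finset.Icc 1 m,
        ENNReal.ofReal (truncWeight α t m j) *
          eLpNorm (fun x => psi α t (u x) j) p (volume.restrict Ω) := by
  have hΓ : 0 < Real.Gamma (1 - α) := Real.Gamma_pos_of_pos (by linarith)
  have hp1 : 1 ≤ p := by rcases hp with rfl | rfl <;> norm_num
  have hmT : t m ≤ T := (hmono.monotone hmM).trans htM
  obtain ⟨K, hreg⟩ := hu.timeRegular
  have hmem : ∀ j, 1 ≤ j → j ≤ M → t j ∈ Set.Ioc 0 T := fun j hj hjM =>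
    ⟨ht0 ▸ hmono hj, (hmono.monotone hjM).trans htM⟩
  have hsol : ∀ j, 1 ≤ j → j ≤ M → L.Solves Ω (fun x => u x (t j) - U j x) _ := fun j hj hjM =>
    (hu.equation (t j) (hmem j hj hjM)).sub hΩ hL (hU.equation j (Finset.mem_Icc.2 ⟨hj, hjM⟩))
  let S : EuclideanSpace ℝ (Fin d) → ℝ := ∑ j ∈ Finset.Ico 1 m,
    (l1Weight α t m (j + 1) - l1Weight α t m j) • fun x => u x (t j) - U j x
  let R : EuclideanSpace ℝ (Fin d) → ℝ := (1 / Real.Gamma (1 - α)) •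
    ∑ j ∈ Finset.Icc 1 m, fun x => truncPiece α t (u x) m j
  have hstab := stability (G := S + R) hp hΩ hΩb hL hcoef (hsol m hm hmM)
    (l1Weight_pos hα0 hα1 hmono (Finset.mem_Icc.2 ⟨hm, le_rfl⟩)) (fun x hx => by
      have h1 := (hreg x hx).deltaAlpha_sub_caputo hα0 hα1 hmono ht0 hmT
      rw [deltaAlpha_eq _ _ _ hm] at h1
      rw [deltaAlpha_eq _ _ _ hm]
      have h0 : u x (t 0) = U 0 x := by rw [ht0, hu.initial x hx, hU.initial x hx]
      rw [h0] at h1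
      simp only [S, R, Pi.add_apply, Finset.sum_apply, Pi.smul_apply, smul_eq_mul, mul_sub,
        Finset.sum_sub_distrib]
      linarith)
  refine hstab.trans ?_
  have hSm : ∀ j ∈ Finset.Ico 1 m, AEStronglyMeasurable
      ((l1Weight α t m (j + 1) - l1Weight α t m j) • fun x => u x (t j) - U j x)
      (volume.restrict Ω) := fun j hj => by
    obtain ⟨hj1, hjm⟩ := Finset.mem_Ico.1 hj
    exact (((hsol j hj1 (by omega)).1.mono subset_closure).aestronglyMeasurable
      hΩ.measurableSet).const_smul _
  have hRm : ∀ j ∈ Finset.Icc 1 m, AEStronglyMeasurable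
      (fun x => truncPiece α t (u x) m j) (volume.restrict Ω) := fun j hj =>
    (aemeasurable_truncPiece hΩ hu.cont hmono ht0 hmT hj).aestronglyMeasurable
  refine (eLpNorm_add_le (Finset.aestronglyMeasurable_sum _ hSm)
    ((Finset.aestronglyMeasurable_sum _ hRm).const_smul _) hp1).trans ?_
  refine add_le_add ((eLpNorm_sum_le hSm hp1).trans (Finset.sum_le_sum fun j hj => ?_)) ?_
  · rw [eLpNorm_const_smul, Real.enorm_eq_ofReal
      (sub_nonneg.2 (l1Weight_le_succ hα0 hα1 hmono hj))]
  · rw [eLpNorm_const_smul, Real.enorm_eq_ofReal (by positivity)]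
    refine mul_le_mul_right ((eLpNorm_sum_le hRm hp1).trans (Finset.sum_le_sum fun j hj => ?_)) _
    have hw := truncWeight_pos hα0 hα1 hmono ht0 hj
    refine eLpNorm_le_mul_eLpNorm_of_ae_le_mul' (c := (truncWeight α t m j).toNNReal) ?_ p
    filter_upwards [ae_restrict_mem hΩ.measurableSet] with x hx
    rw [Real.enorm_eq_ofReal_abs, enorm_eq_self]
    exact ofReal_abs_truncPiece_le (hreg x hx) hα0 hα1 hmono ht0 hmT hj

theorem eLpNorm_error_lt_top {p : ℝ≥0∞} (hΩb : Bornology.IsBounded Ω) {L : Coeffs d}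
    {f : EuclideanSpace ℝ (Fin d) → ℝ → ℝ} {u₀ : EuclideanSpace ℝ (Fin d) → ℝ}
    (hu : IsSolution α T Ω L f u₀ u) {M : ℕ} (hmono : StrictMono t) (ht0 : t 0 = 0)
    (htM : t M ≤ T) {U : ℕ → EuclideanSpace ℝ (Fin d) → ℝ}
    (hU : IsSemidiscrete α t M Ω L f u₀ U) {j : ℕ} (hj : 1 ≤ j) (hjM : j ≤ M) :
    eLpNorm (fun x => u x (t j) - U j x) p (volume.restrict Ω) < ⊤ := by
  have hc : ContinuousOn (fun x => u x (t j) - U j x) (closure Ω) :=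
    (hu.equation (t j) ⟨ht0 ▸ hmono hj, (hmono.monotone hjM).trans htM⟩).1.sub
      (hU.equation j (Finset.mem_Icc.2 ⟨hj, hjM⟩)).1
  exact (eLpNorm_mono_measure _ (Measure.restrict_mono subset_closure le_rfl)).trans_lt
    (memLp_restrict_of_continuousOn hΩb.isCompact_closure hc p).2

/-- The recursion in real form, for given finite bounds `B j` on the norms of `ψ^j`. -/
theorem error_recursion_real {p : ℝ≥0∞} (hp : p = 2 ∨ p = ⊤) (hα0 : 0 < α) (hα1 : α < 1)
    (hΩ : IsOpen Ω) (hΩb : Bornology.IsBounded Ω) {L : Coeffs d} (hL : L.Admissible Ω)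
    (hcoef : ∀ x ∈ Ω, 0 ≤ L.c x - (p⁻¹).toReal * ∑ k, partialD k (L.b k) x)
    {f : EuclideanSpace ℝ (Fin d) → ℝ → ℝ} {u₀ : EuclideanSpace ℝ (Fin d) → ℝ}
    (hu : IsSolution α T Ω L f u₀ u) {M : ℕ} (hmono : StrictMono t) (ht0 : t 0 = 0)
    (htM : t M ≤ T) {U : ℕ → EuclideanSpace ℝ (Fin d) → ℝ}
    (hU : IsSemidiscrete α t M Ω L f u₀ U) {m : ℕ} (hm : 1 ≤ m) (hmM : m ≤ M) {B : ℕ → ℝ}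
    (hB0 : ∀ j, 0 ≤ B j) (hB : ∀ j ∈ Finset.Icc 1 m,
      eLpNorm (fun x => psi α t (u x) j) p (volume.restrict Ω) ≤ ENNReal.ofReal (B j)) :
    l1Weight α t m m * (eLpNorm (fun x => u x (t m) - U m x) p (volume.restrict Ω)).toReal ≤
      ∑ j ∈ Finset.Ico 1 m, (l1Weight α t m (j + 1) - l1Weight α t m j) *
        (eLpNorm (fun x => u x (t j) - U j x) p (volume.restrict Ω)).toReal +
      1 / Real.Gamma (1 - α) * ∑ j ∈ Finset.Icc 1 m, truncWeight α t m j * B j := by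
  have hΓ : 0 < Real.Gamma (1 - α) := Real.Gamma_pos_of_pos (by linarith)
  have hfin := fun j hj hjM => (eLpNorm_error_lt_top hΩb hu hmono ht0 htM hU (p := p) (j := j)
    hj hjM).ne
  have hrec := error_recursion hp hα0 hα1 hΩ hΩb hL hcoef hu hmono ht0 htM hU hm hmM
  have hw := fun j hj => (truncWeight_pos (m := m) (j := j) hα0 hα1 hmono ht0 hj).le
  have hd : ∀ j ∈ Finset.Ico 1 m, 0 ≤ l1Weight α t m (j + 1) - l1Weight α t m j :=
    fun j hj => sub_nonneg.2 (l1Weight_le_succ hα0 hα1 hmono hj)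
  rw [← ENNReal.ofReal_le_ofReal_iff (add_nonneg
      (Finset.sum_nonneg fun j hj => mul_nonneg (hd j hj) ENNReal.toReal_nonneg)
      (mul_nonneg (by positivity) (Finset.sum_nonneg fun j hj => mul_nonneg (hw j hj) (hB0 j)))),
    ENNReal.ofReal_mul (l1Weight_pos hα0 hα1 hmono (Finset.mem_Icc.2 ⟨hm, le_rfl⟩)).le,
    ENNReal.ofReal_toReal (hfin m hm hmM), ENNReal.ofReal_add
      (Finset.sum_nonneg fun j hj => mul_nonneg (hd j hj) ENNReal.toReal_nonneg)
      (mul_nonneg (by positivity) (Finset.sum_nonneg fun j hj => mul_nonneg (hw j hj) (hB0 j))),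
    ENNReal.ofReal_mul (by positivity), ENNReal.ofReal_sum_of_nonneg fun j hj =>
      mul_nonneg (hd j hj) ENNReal.toReal_nonneg, ENNReal.ofReal_sum_of_nonneg fun j hj =>
      mul_nonneg (hw j hj) (hB0 j)]
  refine hrec.trans (add_le_add (Finset.sum_le_sum fun j hj => ?_)
    (mul_le_mul_right (Finset.sum_le_sum fun j hj => ?_) _))
  · obtain ⟨hj1, hjm⟩ := Finset.mem_Ico.1 hj
    rw [ENNReal.ofReal_mul (hd j hj), ENNReal.ofReal_toReal (hfin j hj1 (by omega))]
  · rw [ENNReal.ofReal_mul (hw j hj)]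
    exact mul_le_mul_right (hB j hj) _

/-! ### The error bounds -/

/-- The truncation weights on a graded mesh sum up to a multiple of `t_m ^ (-α)`. -/
theorem sum_truncWeight_le (hα0 : 0 < α) (hT : 0 < T) {r : ℝ} (hr : 1 ≤ r) {M : ℕ}
    (hM : 1 ≤ M) {m : ℕ} (hm : 1 ≤ m) :
    ∑ j ∈ Finset.Icc 1 m, truncWeight α (mesh T r M) m j ≤
      (1 / α * (α * 2 ^ (α + 1) + (2 * r) ^ α) + (2 / α + 2 / (1 - α))) * mesh T r M m ^ (-α) := by
  have h := mul_le_mul_of_nonneg_left (sum_mesh_le hα0 hT hr hM hm) (show 0 ≤ 1 / α by positivity)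
  rw [← Finset.Ico_insert_right hm, Finset.sum_insert Finset.right_notMem_Ico, add_mul, add_comm]
  refine add_le_add ?_ (by rw [truncWeight, if_pos rfl])
  rw [Finset.mul_sum, ← mul_assoc] at h
  refine (Finset.sum_le_sum fun j hj => ?_).trans h
  rw [truncWeight, if_neg (Finset.mem_Ico.1 hj).2.ne]

/-- On a uniform mesh, truncation errors that decay like `j ^ (-1-γ)` lead to errors of size
`m ^ (α-1)`. -/
theorem exists_le_of_uniform {γ : ℝ} (hα0 : 0 < α) (hα1 : α < 1) (hγ : 0 < γ) (hγα : γ ≤ α) :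
    ∃ C : ℝ, 0 < C ∧ ∀ (τ Ψ : ℝ) (t : ℕ → ℝ) (E : ℕ → ℝ) (N : ℕ), 0 < τ → 0 ≤ Ψ →
      (∀ i, t i = τ * i) →
      (∀ m, 1 ≤ m → m ≤ N → l1Weight α t m m * E m ≤
        ∑ j ∈ Finset.Ico 1 m, (l1Weight α t m (j + 1) - l1Weight α t m j) * E j +
        1 / Real.Gamma (1 - α) * ∑ j ∈ Finset.Icc 1 m,
          truncWeight α t m j * (τ ^ γ * t j ^ (α - 1 - γ) * Ψ)) →
      ∀ m, 1 ≤ m → m ≤ N → E m ≤ C * t m ^ (α - 1) * Ψ := by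
  obtain ⟨C₁, hC₁, h₁⟩ := exists_sum_div_le hα0 hα1 hγ
  obtain ⟨C₂, hC₂, h₂⟩ := exists_sum_mul_diff_le hα0 hγ hγα
  have h3 : 0 < 1 - α := by linarith
  have hΓ : 0 < Real.Gamma (1 - α) := Real.Gamma_pos_of_pos h3
  set C₃ := (1 - α) * (1 / α * C₂ + (2 / α + 2 / (1 - α))) with hC₃
  have hC₃pos : 0 < C₃ := by positivity
  refine ⟨C₃ * C₁, by positivity, fun τ Ψ t E N hτ hΨ ht hE m hm hmN => ?_⟩
  set κ := τ ^ (-α) / (Real.Gamma (1 - α) * (1 - α)) with hκ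
  have hκpos : 0 < κ := by positivity
  have eτ : τ ^ γ * τ ^ (α - 1 - γ) = τ ^ (α - 1) := by
    rw [← Real.rpow_add hτ]; ring_nf
  have ej : ∀ j : ℕ, 1 ≤ j → (j : ℝ) ^ (-α) * (j : ℝ) ^ (α - 1 - γ) = (j : ℝ) ^ (-1 - γ) :=
    fun j hj => by
      rw [← Real.rpow_add (by exact_mod_cast hj)]; ring_nf
  -- the truncation error, after division by the last weight `κ`
  have hres : ∀ n, 1 ≤ n → 1 / Real.Gamma (1 - α) * ∑ j ∈ Finset.Icc 1 n,
      truncWeight α t n j * (τ ^ γ * t j ^ (α - 1 - γ) * Ψ) ≤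
      κ * (C₃ * τ ^ (α - 1) * Ψ * (n : ℝ) ^ (-1 - γ)) := by
    intro n hn
    have hsum : ∑ j ∈ Finset.Icc 1 n, truncWeight α t n j * (τ ^ γ * t j ^ (α - 1 - γ) * Ψ) ≤
        (1 / α * C₂ + (2 / α + 2 / (1 - α))) *
          (τ ^ (-α) * τ ^ (α - 1) * Ψ * (n : ℝ) ^ (-1 - γ)) := by
      rw [← Finset.Ico_insert_right hn, Finset.sum_insert Finset.right_notMem_Ico, add_mul,
        add_comm]
      refine add_le_add ?_ (le_of_eq ?_)
      · calc ∑ j ∈ Finset.Ico 1 n, truncWeight α t n j * (τ ^ γ * t j ^ (α - 1 - γ) * Ψ)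
            = 1 / α * (τ ^ (-α) * τ ^ (α - 1) * Ψ) * ∑ j ∈ Finset.Ico 1 n, (j : ℝ) ^ (-1 - γ) *
              (((n : ℝ) - j) ^ (-α) - ((n : ℝ) - (j - 1 : ℕ)) ^ (-α)) := by
              rw [Finset.mul_sum]
              refine Finset.sum_congr rfl fun j hj => ?_
              obtain ⟨hj1, hjn⟩ := Finset.mem_Ico.1 hj
              have hj0 : (0 : ℝ) < j := by exact_mod_cast hj1
              have hjn' : (j : ℝ) < n := by exact_mod_cast hjn
              have e1 : (τ * j - τ * ((j - 1 : ℕ) : ℝ)) / (τ * j) = (j : ℝ)⁻¹ := by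
                push_cast [hj1]
                field_simp
                ring
              have h5 : ((j - 1 : ℕ) : ℝ) ≤ j := by exact_mod_cast Nat.sub_le _ _
              rw [truncWeight, if_neg hjn.ne, ht, ht, ht, e1, ← mul_sub, ← mul_sub,
                Real.inv_rpow hj0.le, ← Real.rpow_neg hj0.le,
                Real.mul_rpow hτ.le (by linarith), Real.mul_rpow hτ.le (by linarith),
                Real.mul_rpow hτ.le hj0.le, ← ej j hj1, ← eτ]
              ring
          _ ≤ 1 / α * (τ ^ (-α) * τ ^ (α - 1) * Ψ) * (C₂ * (n : ℝ) ^ (-1 - γ)) :=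
              mul_le_mul_of_nonneg_left (h₂ n hn) (by positivity)
          _ = _ := by ring
      · rw [truncWeight, if_pos rfl, ht, Real.mul_rpow hτ.le (by positivity),
          Real.mul_rpow hτ.le (by positivity), ← ej n hn, ← eτ]
        ring
    refine (mul_le_mul_of_nonneg_left hsum (by positivity)).trans (le_of_eq ?_)
    rw [hκ, hC₃]
    field_simp
  have hvol : ∀ n, 1 ≤ n → n ≤ N → E n ≤
      ∑ j ∈ Finset.Ico 1 n, (l1Kernel α (n - j - 1) - l1Kernel α (n - j)) * E j +
        C₃ * τ ^ (α - 1) * Ψ * (n : ℝ) ^ (-1 - γ) := by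
    intro n hn hnN
    have h4 := (hE n hn hnN).trans (add_le_add le_rfl (hres n hn))
    rw [l1Weight_uniform hα1 hτ ht (Finset.mem_Icc.2 ⟨hn, le_rfl⟩), Nat.sub_self,
      l1Kernel_zero hα1, mul_one] at h4
    have e5 : ∑ j ∈ Finset.Ico 1 n, (l1Weight α t n (j + 1) - l1Weight α t n j) * E j =
        κ * ∑ j ∈ Finset.Ico 1 n, (l1Kernel α (n - j - 1) - l1Kernel α (n - j)) * E j := by
      rw [Finset.mul_sum]
      refine Finset.sum_congr rfl fun j hj => ?_
      obtain ⟨hj1, hjn⟩ := Finset.mem_Ico.1 hj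
      rw [l1Weight_uniform hα1 hτ ht (Finset.mem_Icc.2 ⟨by omega, hjn⟩),
        l1Weight_uniform hα1 hτ ht (Finset.mem_Icc.2 ⟨hj1, hjn.le⟩), Nat.sub_sub]
      ring
    rw [e5, ← mul_add] at h4
    exact le_of_mul_le_mul_left h4 hκpos
  have h6 := le_sum_div_of_volterra (l1Kernel_zero hα1) (l1Kernel_pos hα1)
    (l1Kernel_antitone hα0 hα1) (l1Kernel_sq_le hα0 hα1)
    (F := fun n => C₃ * τ ^ (α - 1) * Ψ * (n : ℝ) ^ (-1 - γ)) (fun n => by positivity) hvol hmN hm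
  have hm0 : (0 : ℝ) ≤ m := Nat.cast_nonneg m
  calc E m ≤ ∑ j ∈ Finset.Icc 1 m, C₃ * τ ^ (α - 1) * Ψ * (j : ℝ) ^ (-1 - γ) /
        ∑ k ∈ Finset.range (m - j + 1), l1Kernel α k := h6
    _ = C₃ * τ ^ (α - 1) * Ψ * ∑ j ∈ Finset.Icc 1 m, (j : ℝ) ^ (-1 - γ) /
          ((m - j + 1 : ℕ) : ℝ) ^ (1 - α) := by
        rw [Finset.mul_sum]
        refine Finset.sum_congr rfl fun j _ => ?_
        rw [sum_l1Kernel hα1, mul_div_assoc]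
    _ ≤ C₃ * τ ^ (α - 1) * Ψ * (C₁ * (m : ℝ) ^ (α - 1)) :=
        mul_le_mul_of_nonneg_left (h₁ m hm) (by positivity)
    _ = _ := by
        rw [ht, Real.mul_rpow hτ.le hm0]
        ring

end L1Method

open L1Method in
theorem mainTheorem3 (α r : ℝ) (hα0 : 0 < α) (hα1 : α < 1) (hr : 1 ≤ r) :
    ∃ C : ℝ, 0 < C ∧
      ∀ (d : ℕ) (Ω : Set (EuclideanSpace ℝ (Fin d))) (L : L1Method.Coeffs d) (T : ℝ)
        (f : EuclideanSpace ℝ (Fin d) → ℝ → ℝ) (u₀ : EuclideanSpace ℝ (Fin d) → ℝ)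
        (u : EuclideanSpace ℝ (Fin d) → ℝ → ℝ) (p : ℝ≥0∞),
        0 < d → IsOpen Ω → Bornology.IsBounded Ω → L.Admissible Ω → 0 < T →
        (p = 2 ∨ p = ⊤) →
        (∀ x ∈ Ω, 0 ≤ L.c x - (p⁻¹).toReal * ∑ k, L1Method.partialD k (L.b k) x) →
        L1Method.IsSolution α T Ω L f u₀ u →
        ∀ (M : ℕ) (U : ℕ → EuclideanSpace ℝ (Fin d) → ℝ),
          L1Method.IsSemidiscrete α (L1Method.mesh T r M) M Ω L f u₀ U →
          ∀ m ∈ Finset.Icc 1 M,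
            (eLpNorm (fun x => u x (L1Method.mesh T r M m) - U m x) p (volume.restrict Ω) ≤
              ENNReal.ofReal C *
                ⨆ j ∈ Finset.Icc 1 m,
                  eLpNorm (fun x => L1Method.psi α (L1Method.mesh T r M) (u x) j) p
                    (volume.restrict Ω)) ∧
            (r = 1 →
              eLpNorm (fun x => u x (L1Method.mesh T r M m) - U m x) p (volume.restrict Ω) ≤
                ENNReal.ofReal C * ENNReal.ofReal ((L1Method.mesh T r M m) ^ (α - 1)) *
                  ⨆ j ∈ Finset.Icc 1 m,
                    ENNReal.ofReal ((T / M) ^ (-(min α (1 - α))) *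
                        (L1Method.mesh T r M j) ^ (1 - α + min α (1 - α))) *
                      eLpNorm (fun x => L1Method.psi α (L1Method.mesh T r M) (u x) j) p
                        (volume.restrict Ω)) := by
  have hγ : 0 < min α (1 - α) := lt_min hα0 (by linarith)
  set γ := min α (1 - α) with hγdef
  obtain ⟨C₂, hC₂, h₂⟩ := exists_le_of_uniform hα0 hα1 hγ (min_le_left _ _)
  set C₁ := 1 / α * (α * 2 ^ (α + 1) + (2 * r) ^ α) + (2 / α + 2 / (1 - α)) with hC₁def
  have h1α : 0 < 1 - α := by linarith
  have hr0 : 0 < r := by linarith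
  have hC₁ : 0 < C₁ := by positivity
  have hΓ : 0 < Real.Gamma (1 - α) := Real.Gamma_pos_of_pos h1α
  refine ⟨max C₁ C₂, lt_max_of_lt_left hC₁, fun d Ω L T f u₀ u p _ hΩ hΩb hL hT hp hcoef hu M U hU
    m hm => ?_⟩
  obtain ⟨hm1, hmM⟩ := Finset.mem_Icc.1 hm
  have hM : 1 ≤ M := hm1.trans hmM
  have hmono := mesh_strictMono hT hr hM
  have ht0 := mesh_zero (T := T) hr M
  have htM : mesh T r M M ≤ T := (mesh_self hM).le
  have htm := mesh_pos (r := r) hT hM hm1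
  have hfin := fun j hj hjM => (eLpNorm_error_lt_top hΩb hu hmono ht0 htM hU (p := p) (j := j)
    hj hjM).ne
  constructor
  · set S := ⨆ j ∈ Finset.Icc 1 m,
      eLpNorm (fun x => psi α (mesh T r M) (u x) j) p (volume.restrict Ω) with hS
    by_cases hStop : S = ⊤
    · rw [hStop, ENNReal.mul_top (ENNReal.ofReal_pos.2 (lt_max_of_lt_left hC₁)).ne']
      exact le_top
    -- the constant `C₁ * S` is a barrier for the scalar inequality
    have hbound : (eLpNorm (fun x => u x (mesh T r M m) - U m x) p (volume.restrict Ω)).toReal ≤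
        C₁ * S.toReal := by
      refine le_of_l1_weights (w := l1Weight α (mesh T r M)) (N := m)
        (E := fun j => (eLpNorm (fun x => u x (mesh T r M j) - U j x) p (volume.restrict Ω)).toReal)
        (R := fun n => 1 / Real.Gamma (1 - α) *
          ∑ j ∈ Finset.Icc 1 n, truncWeight α (mesh T r M) n j * S.toReal)
        (fun n hn _ => l1Weight_pos hα0 hα1 hmono (Finset.mem_Icc.2 ⟨hn, le_rfl⟩))
        (fun n _ j hj => l1Weight_le_succ hα0 hα1 hmono hj) (fun n hn hnm => ?_)
        (fun n hn hnm => ?_) hm1 le_rfl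
      · refine error_recursion_real hp hα0 hα1 hΩ hΩb hL hcoef hu hmono ht0 htM hU hn
          (hnm.trans hmM) (fun _ => ENNReal.toReal_nonneg) fun j hj => ?_
        rw [ENNReal.ofReal_toReal hStop]
        exact le_iSup₂ (f := fun j (_ : j ∈ Finset.Icc 1 m) =>
          eLpNorm (fun x => psi α (mesh T r M) (u x) j) p (volume.restrict Ω)) j
          (Finset.Icc_subset_Icc_right hnm hj)
      · have h3 := le_l1Weight hα0 hα1 hmono (Finset.mem_Icc.2 ⟨le_rfl, hn⟩ : 1 ∈ Finset.Icc 1 n)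
        rw [Nat.sub_self, ht0, sub_zero] at h3
        have h4 := sum_truncWeight_le hα0 hT hr hM hn
        have hS0 : 0 ≤ S.toReal := ENNReal.toReal_nonneg
        calc 1 / Real.Gamma (1 - α) *
              ∑ j ∈ Finset.Icc 1 n, truncWeight α (mesh T r M) n j * S.toReal
            = 1 / Real.Gamma (1 - α) * S.toReal *
              ∑ j ∈ Finset.Icc 1 n, truncWeight α (mesh T r M) n j := by
              rw [← Finset.sum_mul]; ring
          _ ≤ 1 / Real.Gamma (1 - α) * S.toReal * (C₁ * mesh T r M n ^ (-α)) :=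
              mul_le_mul_of_nonneg_left h4 (by positivity)
          _ = C₁ * S.toReal * (1 / Real.Gamma (1 - α) * mesh T r M n ^ (-α)) := by ring
          _ ≤ _ := mul_le_mul_of_nonneg_left h3 (by positivity)
    rw [← ENNReal.ofReal_toReal hStop, ← ENNReal.ofReal_mul (by positivity),
      ENNReal.le_ofReal_iff_toReal_le (hfin m hm1 hmM) (by positivity)]
    exact hbound.trans (mul_le_mul_of_nonneg_right (le_max_left _ _) ENNReal.toReal_nonneg)
  · rintro rfl
    set t := mesh T 1 M with htdef
    set S := ⨆ j ∈ Finset.Icc 1 m, ENNReal.ofReal ((T / M) ^ (-γ) * t j ^ (1 - α + γ)) *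
      eLpNorm (fun x => psi α t (u x) j) p (volume.restrict Ω) with hS
    have hM0 : (0 : ℝ) < M := by exact_mod_cast hM
    have hτ : 0 < T / M := by positivity
    by_cases hStop : S = ⊤
    · rw [hStop, ENNReal.mul_top (mul_ne_zero (ENNReal.ofReal_pos.2 (lt_max_of_lt_left hC₁)).ne'
        (ENNReal.ofReal_pos.2 (by positivity)).ne')]
      exact le_top
    have hpsi : ∀ j ∈ Finset.Icc 1 m, eLpNorm (fun x => psi α t (u x) j) p (volume.restrict Ω) ≤
        ENNReal.ofReal ((T / M) ^ γ * t j ^ (α - 1 - γ) * S.toReal) := by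
      intro j hj
      have htj : 0 < t j := mesh_pos hT hM (Finset.mem_Icc.1 hj).1
      have h3 : ENNReal.ofReal ((T / M) ^ (-γ) * t j ^ (1 - α + γ)) *
          eLpNorm (fun x => psi α t (u x) j) p (volume.restrict Ω) ≤ S :=
        le_iSup₂ (f := fun j (_ : j ∈ Finset.Icc 1 m) =>
          ENNReal.ofReal ((T / M) ^ (-γ) * t j ^ (1 - α + γ)) *
            eLpNorm (fun x => psi α t (u x) j) p (volume.restrict Ω)) j hj
      have e1 : (T / M) ^ γ * t j ^ (α - 1 - γ) * ((T / M) ^ (-γ) * t j ^ (1 - α + γ)) = 1 := by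
        rw [Real.rpow_neg hτ.le, show α - 1 - γ = -(1 - α + γ) by ring, Real.rpow_neg htj.le]
        field_simp
      rw [ENNReal.ofReal_mul (by positivity), ENNReal.ofReal_toReal hStop]
      refine le_trans (le_of_eq ?_) (mul_le_mul_right h3 _)
      rw [← mul_assoc, ← ENNReal.ofReal_mul (by positivity), e1, ENNReal.ofReal_one, one_mul]
    -- the hypothesis on `ψ^j`, solved for its norm, is the decay required on a uniform mesh
    have hbound := h₂ (T / M) S.toReal t
      (fun j => (eLpNorm (fun x => u x (t j) - U j x) p (volume.restrict Ω)).toReal) m hτ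
      ENNReal.toReal_nonneg (mesh_one_right T M) (fun n hn hnm =>
        error_recursion_real hp hα0 hα1 hΩ hΩb hL hcoef hu hmono ht0 htM hU hn (hnm.trans hmM)
          (B := fun j => (T / M) ^ γ * t j ^ (α - 1 - γ) * S.toReal)
          (fun j => mul_nonneg (mul_nonneg (by positivity) (Real.rpow_nonneg
            (ht0 ▸ hmono.monotone (Nat.zero_le j)) _)) ENNReal.toReal_nonneg)
          fun j hj => hpsi j (Finset.Icc_subset_Icc_right hnm hj)) m hm1 le_rfl
    rw [← ENNReal.ofReal_toReal hStop, ← ENNReal.ofReal_mul (by positivity),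
      ← ENNReal.ofReal_mul (by positivity),
      ENNReal.le_ofReal_iff_toReal_le (hfin m hm1 hmM) (by positivity)]
    refine hbound.trans (mul_le_mul_of_nonneg_right ?_ ENNReal.toReal_nonneg)
    exact mul_le_mul_of_nonneg_right (le_max_right _ _) (by positivity)
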